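/- Let $n\ge 1$, write $\Delta(x,r)$ for Euclidean balls in $\mathbb{R}^n$ and $f_r(x)=r^{-n}f(x/r)$. A weight is a non-negative locally integrable function $w$ on $\mathbb{R}^n$; it is doubling if $w\,dx$ is non-trivial and there is a constant $K$ with $w(\Delta(x,2r))\le K\,w(\Delta(x,r))$ for all $x\in\mathbb{R}^n$, $r>0$, where $w(E)=\int_E w\,dx$; the least such $K$ is its doubling constant. For a Borel measure $\mu$ on $\mathbb{R}^n\times(0,\infty)$ let $\|\mu\|_{\mathcal C}=\sup_{x\in\mathbb{R}^n,\,r>0}|\Delta(x,r)|^{-1}\mu(\Delta(x,r)\times(0,r))\in[0,\infty]$. Let $[w]_{A_\infty}\in[0,\infty]$ be the infimum of the constants $C<\infty$ such that $$\frac{1}{|\Delta(x,r)|}\int_{\Delta(x,r)}w\,dz\le C\exp\Big\{\frac{1}{|\Delta(x,r)|}\int_{\Delta(x,r)}\log w\,dz\Big\}\quad\text{for all }x\in\mathbb{R}^n,\ r>0$$ (with $\log 0=-\infty$, $\exp(-\infty)=0$ and $\inf\emptyset=\infty$). Let $\phi(x)=\pi^{-n/2}e^{-|x|^2}$ and fix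 a non-negative, radially decreasing (i.e. $|x|\le|y|$ implies $\varphi(y)\le\varphi(x)$) function $\varphi\in C_c^\infty(\Delta(0,2))$ with $\nabla\varphi=0$ on $\Delta(0,1)$ and $\int\varphi=1$. For a doubling weight $w$ define measures on $\mathbb{R}^n\times(0,\infty)$ by $$d\mu_w(x,r)=|\nabla_x\log(w*\phi_r)(x)|^2\,r\,dx\,dr,\qquad d\tilde\mu_w(x,r)=|\nabla_x\log(w*\varphi_r)(x)|^2\,r\,dx\,dr .$$ **Theorem.** For every doubling weight $w$, $\|\mu_w\|_{\mathcal C}<\infty$ if and only if $\|\tilde\mu_w\|_{\mathcal C}<\infty$. Moreover, for every $K$ there is a constant $C_2>1$, depending only on $n$, $K$ (and the fixed $\varphi$), such that every doubling weight $w$ with doubling constant at most $K$ satisfies $$\frac1{C_2}\|\mu_w\|_{\mathcal C}\le\|\tilde\mu_w\|_{\mathcal C}\le C_2\|\mu_w\|_{\mathcal C}.$$ In particular, for every $\epsilon_0>0$ and every $K$ there is $\tilde\delta_0>0$, depending only on $\epsilon_0$, $n$, $K$ (and the fixed $\varphi$), such that every doubling weight $w$ with doubling constant at most $K$ and $\|\tilde\mu_w\|_{\mathcal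 C}\le\tilde\delta_0$ satisfies $[w]_{A_\infty}\le1+\epsilon_0$. -/

import Mathlib

open MeasureTheory Set
open scoped ENNReal NNReal

noncomputable section

namespace CarlesonWeights

/-- `ℝⁿ` with the Euclidean norm and Lebesgue measure. -/
abbrev Rn (n : ℕ) : Type := EuclideanSpace ℝ (Fin n)

/-- A weight: a non-negative, locally integrable function on `ℝⁿ`. -/
structure IsWeight {n : ℕ} (w : Rn n → ℝ) : Prop where
  nonneg : ∀ x, 0 ≤ w x
  locallyIntegrable : LocallyIntegrable w volume

/-- The measure `w dx`. -/
def weightMeasure {n : ℕ} (w : Rn n → ℝ) : Measure (Rn n) :=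
  volume.withDensity (fun x => ENNReal.ofReal (w x))

/-- `ν` is non-trivial and `ν(Δ(x,2r)) ≤ K ν(Δ(x,r))` for all balls, that is, `ν` is doubling and
its doubling constant (the least admissible `K`) is at most `K`. -/
structure IsDoublingWith {n : ℕ} (ν : Measure (Rn n)) (K : ℝ≥0) : Prop where
  ne_zero : ν ≠ 0
  doubling : ∀ (x : Rn n) (r : ℝ), 0 < r →
    ν (Metric.ball x (2 * r)) ≤ (K : ℝ≥0∞) * ν (Metric.ball x r)

/-- The Gaussian `π^{-n/2} exp(-|x|²)`. -/
def gaussian (n : ℕ) (x : Rn n) : ℝ :=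
  Real.pi ^ (-(n : ℝ) / 2) * Real.exp (-‖x‖ ^ 2)

/-- The reference bump functions: smooth, compactly supported in `Δ(0,2)`, non-negative, radially
decreasing (in particular radial), with vanishing gradient on `Δ(0,1)` and integral one. -/
structure IsReferenceBump {n : ℕ} (φ : Rn n → ℝ) : Prop where
  smooth : ContDiff ℝ ((⊤ : ℕ∞) : WithTop ℕ∞) φ
  hasCompactSupport : HasCompactSupport φ
  tsupport_subset : tsupport φ ⊆ Metric.ball 0 2
  nonneg : ∀ x, 0 ≤ φ x
  radially_decreasing : ∀ x y, ‖x‖ ≤ ‖y‖ → φ y ≤ φ x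
  gradient_eq_zero : ∀ x ∈ Metric.ball (0 : Rn n) 1, gradient φ x = 0
  integral_eq_one : ∫ x, φ x = 1

/-- The `L¹`-normalized dilation `f_r(x) = r^{-n} f(x/r)`. -/
def dilate {n : ℕ} (f : Rn n → ℝ) (r : ℝ) (x : Rn n) : ℝ :=
  (r ^ n)⁻¹ * f (r⁻¹ • x)

/-- The convolution `(w ∗ f_r)(x) = ∫ w(y) f_r(x - y) dy`. -/
def convDilate {n : ℕ} (w f : Rn n → ℝ) (r : ℝ) (x : Rn n) : ℝ :=
  ∫ y, w y * dilate f r (x - y)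

/-- The measure `|∇ₓ log (w ∗ f_r)(x)|² r dx dr`, carried by `ℝⁿ × (0,∞)`. -/
def logGradMeasure {n : ℕ} (w f : Rn n → ℝ) : Measure (Rn n × ℝ) :=
  ((volume : Measure (Rn n)).prod (volume.restrict (Ioi (0 : ℝ)))).withDensity
    (fun p => ENNReal.ofReal
      (‖gradient (fun z => Real.log (convDilate w f p.2 z)) p.1‖ ^ 2 * p.2))

/-- The Carleson norm: the supremum of `μ(Δ(x,r) × (0,r)) / |Δ(x,r)|` over all balls. -/
def carlesonNorm {n : ℕ} (μ : Measure (Rn n × ℝ)) : ℝ≥0∞ :=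
  ⨆ (x : Rn n) (r : ℝ) (_ : 0 < r),
    μ (Metric.ball x r ×ˢ Ioo 0 r) / volume (Metric.ball x r)

/-- The average of `log w` over `Δ(x,r)`, where `log 0 = -∞`, as an extended real: the average of
the positive part minus the average of the negative part. For a weight the average of the positive
part is finite, so the difference is meaningful; it is `-∞` if `log w` is not integrable. -/
def logAverage {n : ℕ} (w : Rn n → ℝ) (x : Rn n) (r : ℝ) : EReal :=
  ((⨍⁻ z in Metric.ball x r, (ENNReal.log (ENNReal.ofReal (w z))).toENNReal ∂volume : ℝ≥0∞) :
      EReal) -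
    ((⨍⁻ z in Metric.ball x r, (-ENNReal.log (ENNReal.ofReal (w z))).toENNReal ∂volume : ℝ≥0∞) :
      EReal)

/-- The `A_∞` characteristic: the infimum of the constants `C` such that
`⨍_{Δ(x,r)} w ≤ C exp (⨍_{Δ(x,r)} log w)` for all balls; it is `∞` if there is no finite such `C`,
that is, if `w` is not in `A_∞`. -/
def aInftyConst {n : ℕ} (w : Rn n → ℝ) : ℝ≥0∞ :=
  sInf {C : ℝ≥0∞ | ∃ c : ℝ≥0, C = (c : ℝ≥0∞) ∧ ∀ (x : Rn n) (r : ℝ), 0 < r →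
    (⨍⁻ z in Metric.ball x r, ENNReal.ofReal (w z) ∂volume) ≤
      (c : ℝ≥0∞) * EReal.exp (logAverage w x r)}

end CarlesonWeights

end

open CarlesonWeights

/-! The proof has two halves. The first compares the Carleson norms of any two non-negative Schwartz
kernels that have integral one and are bounded below on the unit ball (`IsGood`). The second treats
the Gaussian alone.

Comparison. Let `A_s` be averaging against `φ` at scale `s`. Peeling averages off `ψ` one at a time
gives `ψ = ∑_{m<J} A_{σ(m)} ψ_m + ψ_J`, where `ψ_m` is the remainder `resid φ σ ψ m`. Because `φ`
has integral one, `1 - A_s` gains a factor `s` at the price of one derivative, so for `σ(m) = t ε^m`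
and `ε` small the remainders decay like any prescribed power of `ε^m` (`exists_norm_resid_le`).
Convolution with a doubling measure `ν` and one integration by parts turn this into a formula for
`∇(ν ∗ ψ)` in terms of the gradients of `ν ∗ φ_{σ(m)}` (`IsDoublingWith.conv_fderiv_eq_sum`).
Doubling compares `ν ∗ φ_{σ(m)}(y)` with `ν ∗ ψ(0)` up to powers of `ε^{-m}` and `1 + |y|`, which
the remainders absorb (`exists_logGrad_unit_le`). Cauchy–Schwarz and integration over a Carleson box
then give `exists_boxNorm_le`. Used in both directions, it proves the first two claims and reduces
the third to the Gaussian.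

Gaussian. A Carleson norm `N` controls `r |∇ log u_r|` pointwise by a multiple of `√N`, where `u_r`
is the Gaussian extension of `w` (`exists_logGrad_le_boxNorm`). The semigroup law writes `u_{2ρ}` as
a Gaussian average of `u_ρ`, so `log u_{2ρ} - log u_ρ` is at most a linear average of differences of
`log u_ρ` plus a quadratic one. Against a Lipschitz cutoff the linear part is `O(Λ m ρ)` by symmetry
of the Gaussian, where `Λ` bounds `r |∇ log u_r|` and `m` is the Lipschitz constant; this sums over
dyadic scales. The quadratic part is a piece of the Carleson integral. Hence the integral of `log u`
against the cutoff drops little from a scale `t` to zero (`exists_integral_logConv_sub_le`), and the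
limit of `log u` is at most `log w` by concavity (`IsWeight.le_integral_log_add`,
`IsWeight.le_integral_log_of_le`).

On a ball of radius `R`, take `t` a small multiple of `R`. Then `log u_t` is nearly a constant `log
a`, the average of `w` is at most about `a`, and the average of `log w` is at least about `log a`
(`exists_average_bounds`). Choosing the parameters in the right order makes the ratio at most `1 +
ε` (`exists_jensenBound_lt`). -/

noncomputable section

namespace CarlesonWeights

open scoped SchwartzMap

section

/-! ### Polynomially decaying weights and doubling measures -/

/-- The polynomially decaying function `(1 + ‖x‖)^{-M}`. -/
def wt {n : ℕ} (M : ℕ) (x : Rn n) : ℝ := ((1 + ‖x‖) ^ M)⁻¹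

variable {n : ℕ}

lemma wt_pos (M : ℕ) (x : Rn n) : 0 < wt M x := by unfold wt; positivity

lemma wt_nonneg (M : ℕ) (x : Rn n) : 0 ≤ wt M x := (wt_pos M x).le

lemma wt_le_one (M : ℕ) (x : Rn n) : wt M x ≤ 1 := by
  unfold wt
  exact inv_le_one_of_one_le₀ (one_le_pow₀ (by linarith [norm_nonneg x]))

lemma wt_neg (M : ℕ) (x : Rn n) : wt M (-x) = wt M x := by simp [wt]

lemma wt_add (M N : ℕ) (x : Rn n) : wt (M + N) x = wt M x * wt N x := by
  rw [wt, pow_add, mul_inv]; rfl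

lemma pow_mul_wt (M N : ℕ) (x : Rn n) : (1 + ‖x‖) ^ M * wt (M + N) x = wt N x := by
  rw [wt_add, ← mul_assoc]
  have : (1 + ‖x‖) ^ M * wt M x = 1 := by
    unfold wt; exact mul_inv_cancel₀ (by positivity)
  rw [this, one_mul]

lemma wt_antitone {M N : ℕ} (h : M ≤ N) (x : Rn n) : wt N x ≤ wt M x := by
  obtain ⟨k, rfl⟩ := Nat.exists_eq_add_of_le h
  rw [wt_add]
  exact mul_le_of_le_one_right (wt_nonneg _ _) (wt_le_one _ _)

lemma continuous_wt (M : ℕ) : Continuous (wt M : Rn n → ℝ) := by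
  unfold wt
  exact Continuous.inv₀ (by fun_prop) (fun x => by positivity)

/-- Peetre's inequality: `1 + ‖x‖ ≤ (1 + ‖x - y‖)(1 + ‖y‖)`. -/
lemma wt_sub_le (M : ℕ) (x y : Rn n) : wt M (x - y) ≤ (1 + ‖y‖) ^ M * wt M x := by
  unfold wt
  have h1 : 0 < (1 + ‖x - y‖) ^ M := by positivity
  have h2 : 0 < (1 + ‖x‖) ^ M := by positivity
  rw [← div_eq_mul_inv, inv_eq_one_div, div_le_div_iff₀ h1 h2, one_mul, ← mul_pow]
  refine pow_le_pow_left₀ (by positivity) ?_ _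
  have : ‖x‖ ≤ ‖x - y‖ + ‖y‖ := by simpa using norm_add_le (x - y) y
  nlinarith [norm_nonneg y, norm_nonneg (x - y)]

lemma wt_sub_smul_le (M : ℕ) {s : ℝ} (hs : 0 ≤ s) (hs1 : s ≤ 1) (x y : Rn n) :
    wt M (x - s • y) ≤ (1 + ‖y‖) ^ M * wt M x := by
  refine (wt_sub_le M x (s • y)).trans ?_
  refine mul_le_mul_of_nonneg_right ?_ (wt_nonneg _ _)
  refine pow_le_pow_left₀ (by positivity) ?_ _
  rw [norm_smul, Real.norm_of_nonneg hs]
  nlinarith [norm_nonneg y]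

lemma exists_two_pow_between {t : ℝ} (ht : 1 ≤ t) : ∃ k : ℕ, t ≤ 2 ^ k ∧ (2 : ℝ) ^ k ≤ 2 * t := by
  obtain ⟨k, h1, h2⟩ := exists_nat_pow_near ht (one_lt_two)
  exact ⟨k + 1, h2.le, by rw [pow_succ]; linarith⟩

lemma ofReal_wt_le_tsum (M : ℕ) (x : Rn n) :
    ENNReal.ofReal (wt M x) ≤
      ∑' k : ℕ, (2 ^ M * ((2 ^ M) ^ k)⁻¹ : ℝ≥0∞) *
        (Metric.ball (0 : Rn n) (2 ^ k)).indicator 1 x := by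
  obtain ⟨k, h1, h2⟩ := exists_nat_pow_near (x := 1 + ‖x‖) (by linarith [norm_nonneg x]) one_lt_two
  -- Only the term of the first dyadic ball containing `x` is kept. The prefactor `2 ^ M` pays for
  -- the shift from `k` to `k + 1`.
  refine le_trans ?_ (ENNReal.le_tsum (k + 1))
  have hx : x ∈ Metric.ball (0 : Rn n) (2 ^ (k + 1)) := by
    rw [mem_ball_zero_iff]; linarith
  rw [indicator_of_mem hx, Pi.one_apply, mul_one]
  have e : (2 ^ M * ((2 ^ M) ^ (k + 1))⁻¹ : ℝ≥0∞) = ENNReal.ofReal (((2 : ℝ) ^ k) ^ M)⁻¹ := by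
    rw [ENNReal.ofReal_inv_of_pos (by positivity),       ENNReal.ofReal_pow (by positivity), ENNReal.ofReal_pow (by positivity)]
    have : ENNReal.ofReal 2 = 2 := by simp
    rw [this, ← pow_mul, ← pow_mul, mul_comm k M, mul_add, pow_add, mul_one, ENNReal.mul_inv (by simp) (by simp), mul_comm, mul_assoc,
      ENNReal.inv_mul_cancel (by simp) (by simp), mul_one]
  rw [e]
  apply ENNReal.ofReal_le_ofReal
  unfold wt
  exact inv_anti₀ (by positivity) (pow_le_pow_left₀ (by positivity) h1 _)

/-! ### Growth and integrability for doubling measures. -/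

section Doubling

variable {ν : Measure (Rn n)} {K : ℝ≥0}

lemma IsDoublingWith.measure_ball_two_pow_le (h : IsDoublingWith ν K) (x : Rn n) {r : ℝ}
    (hr : 0 < r) (k : ℕ) :
    ν (Metric.ball x (2 ^ k * r)) ≤ (K : ℝ≥0∞) ^ k * ν (Metric.ball x r) := by
  induction k with
  | zero => simp
  | succ k ih =>
    have := h.doubling x (2 ^ k * r) (by positivity)
    rw [pow_succ' (2 : ℝ), mul_assoc, pow_succ' (K : ℝ≥0∞), mul_assoc]
    exact this.trans (by gcongr)

/-- If one ball were null, doubling would make all its dyadic dilates null, and these exhaust the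
space. -/
lemma IsDoublingWith.measure_ball_pos (h : IsDoublingWith ν K) (x : Rn n) {r : ℝ}
    (hr : 0 < r) : 0 < ν (Metric.ball x r) := by
  by_contra h0
  have h0 : ν (Metric.ball x r) = 0 := by simpa using h0
  apply h.ne_zero
  rw [← Measure.measure_univ_eq_zero]
  have : (univ : Set (Rn n)) ⊆ ⋃ k : ℕ, Metric.ball x (2 ^ k * r) := by
    intro y _
    obtain ⟨k, hk⟩ := pow_unbounded_of_one_lt (dist y x / r) one_lt_two
    exact mem_iUnion.2 ⟨k, by rw [Metric.mem_ball]; rwa [div_lt_iff₀ hr] at hk⟩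
  refine measure_mono_null this (measure_iUnion_null fun k => ?_)
  have := h.measure_ball_two_pow_le x hr k
  rw [h0, mul_zero] at this
  exact le_antisymm this bot_le

/-- The ball of radius `2 ^ k` has mass at most `2 ^ (D k)` times that of the unit ball and carries
the weight `2 ^ (-M k)`, so `M ≥ D + 1` leaves a geometric series of ratio at most `1/2`. -/
lemma IsDoublingWith.lintegral_wt_le (h : IsDoublingWith ν K) {D M : ℕ} (hD : (K : ℝ) ≤ 2 ^ D)
    (hM : D + 1 ≤ M) :
    ∫⁻ y, ENNReal.ofReal (wt M y) ∂ν ≤ 2 ^ (M + 1) * ν (Metric.ball 0 1) := by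
  calc ∫⁻ y, ENNReal.ofReal (wt M y) ∂ν
      ≤ ∫⁻ y, ∑' k : ℕ, (2 ^ M * ((2 ^ M) ^ k)⁻¹ : ℝ≥0∞) *
        (Metric.ball (0 : Rn n) (2 ^ k)).indicator 1 y ∂ν :=
        lintegral_mono fun y => ofReal_wt_le_tsum M y
    _ = ∑' k : ℕ, (2 ^ M * ((2 ^ M) ^ k)⁻¹ : ℝ≥0∞) * ν (Metric.ball (0 : Rn n) (2 ^ k)) := by
        rw [lintegral_tsum]
        · congr 1; ext k
          rw [lintegral_const_mul _ (measurable_one.indicator measurableSet_ball),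
            lintegral_indicator_one measurableSet_ball]
        · intro k
          exact ((measurable_one.indicator measurableSet_ball).const_mul _).aemeasurable
    _ ≤ ∑' k : ℕ, (2 ^ M * ν (Metric.ball 0 1)) * (2⁻¹ : ℝ≥0∞) ^ k := by
        refine ENNReal.tsum_le_tsum fun k => ?_
        have h1 := h.measure_ball_two_pow_le 0 one_pos k
        rw [mul_one] at h1
        have h2 : ((2 ^ M) ^ k)⁻¹ * (K : ℝ≥0∞) ^ k ≤ (2⁻¹ : ℝ≥0∞) ^ k := by
          rw [ENNReal.inv_pow, ← mul_pow]
          refine pow_le_pow_left' ?_ _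
          have hK : (K : ℝ≥0∞) ≤ 2 ^ D := by exact_mod_cast hD
          calc (2 ^ M)⁻¹ * (K : ℝ≥0∞) ≤ (2 ^ (D + 1))⁻¹ * 2 ^ D := by
                gcongr
                exact one_le_two
            _ = 2⁻¹ := by
                rw [pow_succ', ENNReal.mul_inv (by simp) (by simp), mul_assoc,
                  ENNReal.inv_mul_cancel (by simp) (by simp), mul_one]
        calc (2 ^ M * ((2 ^ M) ^ k)⁻¹ : ℝ≥0∞) * ν (Metric.ball (0 : Rn n) (2 ^ k))
            ≤ (2 ^ M * ((2 ^ M) ^ k)⁻¹ : ℝ≥0∞) * ((K : ℝ≥0∞) ^ k * ν (Metric.ball 0 1)) := by gcongr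
          _ = 2 ^ M * ν (Metric.ball 0 1) * (((2 ^ M) ^ k)⁻¹ * (K : ℝ≥0∞) ^ k) := by ring
          _ ≤ _ := by gcongr
    _ = 2 ^ (M + 1) * ν (Metric.ball 0 1) := by
        rw [ENNReal.tsum_mul_left, ENNReal.tsum_geometric, ENNReal.one_sub_inv_two, inv_inv]
        ring

variable [IsLocallyFiniteMeasure ν]

lemma IsDoublingWith.real_ball_pos (h : IsDoublingWith ν K) (x : Rn n) {r : ℝ}
    (hr : 0 < r) : 0 < ν.real (Metric.ball x r) :=
  ENNReal.toReal_pos (h.measure_ball_pos x hr).ne' measure_ball_lt_top.ne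

/-- A dyadic ball about the origin of radius comparable to `1 + ‖y‖` contains `Δ(y,1)`; it takes
about `log₂ (1 + ‖y‖)` doublings to reach it, whence growth of degree `D`. -/
lemma IsDoublingWith.real_ball_le (h : IsDoublingWith ν K) {D : ℕ} (hD : (K : ℝ) ≤ 2 ^ D)
    (y : Rn n) :
    ν.real (Metric.ball y 1) ≤ 2 ^ D * (1 + ‖y‖) ^ D * ν.real (Metric.ball 0 1) := by
  obtain ⟨k, h1, h2⟩ := exists_two_pow_between (t := 1 + ‖y‖) (by linarith [norm_nonneg y])
  have hsub : Metric.ball y 1 ⊆ Metric.ball (0 : Rn n) (2 ^ k * 1) := by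
    apply Metric.ball_subset_ball'
    rw [dist_zero_right]; linarith
  have h3 : ν.real (Metric.ball y 1) ≤ (K : ℝ) ^ k * ν.real (Metric.ball 0 1) := by
    have := (measure_mono hsub).trans (h.measure_ball_two_pow_le 0 one_pos k)
    have h4 := ENNReal.toReal_mono (ENNReal.mul_ne_top (by simp) measure_ball_lt_top.ne) this
    simpa [Measure.real] using h4
  refine h3.trans (mul_le_mul_of_nonneg_right ?_ measureReal_nonneg)
  calc (K : ℝ) ^ k ≤ (2 ^ D) ^ k := pow_le_pow_left₀ K.2 hD _
    _ = (2 ^ k) ^ D := by rw [← pow_mul, ← pow_mul, mul_comm]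
    _ ≤ (2 * (1 + ‖y‖)) ^ D := pow_le_pow_left₀ (by positivity) h2 _
    _ = _ := by rw [mul_pow]

lemma IsDoublingWith.integrable_wt (h : IsDoublingWith ν K) {D M : ℕ} (hD : (K : ℝ) ≤ 2 ^ D)
    (hM : D + 1 ≤ M) : Integrable (wt M) ν := by
  refine ⟨(continuous_wt M).aestronglyMeasurable, ?_⟩
  rw [hasFiniteIntegral_iff_ofReal (ae_of_all _ fun x => wt_nonneg _ _)]
  exact (h.lintegral_wt_le hD hM).trans_lt (ENNReal.mul_lt_top (by simp) measure_ball_lt_top)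

lemma IsDoublingWith.integral_wt_le (h : IsDoublingWith ν K) {D M : ℕ} (hD : (K : ℝ) ≤ 2 ^ D)
    (hM : D + 1 ≤ M) : ∫ y, wt M y ∂ν ≤ 2 ^ (M + 1) * ν.real (Metric.ball 0 1) := by
  rw [integral_eq_lintegral_of_nonneg_ae (ae_of_all _ fun x => wt_nonneg _ _)
    (continuous_wt M).aestronglyMeasurable]
  have := ENNReal.toReal_mono (ENNReal.mul_ne_top (by simp) measure_ball_lt_top.ne)
    (h.lintegral_wt_le hD hM)
  simpa [Measure.real] using this

end Doubling

lemma volume_ball_scale (x : Rn n) {t : ℝ} (ht : 0 < t) (r : ℝ) :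
    volume (Metric.ball x (t * r)) = ENNReal.ofReal (t ^ n) * volume (Metric.ball x r) := by
  rw [Measure.addHaar_ball_mul_of_pos _ _ ht, Measure.addHaar_ball_center _ x]
  simp

lemma isDoublingWith_volume : IsDoublingWith (volume : Measure (Rn n)) (2 ^ n) where
  ne_zero := NeZero.ne _
  doubling x r hr := by
    rw [volume_ball_scale x zero_lt_two, ENNReal.ofReal_pow zero_le_two]
    simp

lemma integrable_wt_volume {M : ℕ} (hM : n + 1 ≤ M) : Integrable (wt M : Rn n → ℝ) :=
  isDoublingWith_volume.integrable_wt (D := n) (by simp) hM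

end

section

/-! ### Convolution of a doubling measure with a dilated kernel -/

variable {n : ℕ} {F : Type} [NormedAddCommGroup F] [NormedSpace ℝ F]

/-- The convolution of the measure `ν` with the dilation `f_s`. -/
def conv (ν : Measure (Rn n)) (f : Rn n → F) (s : ℝ) (x : Rn n) : F :=
  ∫ z, (s ^ n)⁻¹ • f (s⁻¹ • (x - z)) ∂ν

/-- The kernel comparison and the telescoping use only the measure `w dx`. Working with measures
makes rescaling a push-forward. -/
lemma convDilate_eq_conv {w : Rn n → ℝ} (hw : IsWeight w) (f : Rn n → ℝ) (s : ℝ) (x : Rn n) :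
    convDilate w f s x = conv (weightMeasure w) f s x := by
  have h : AEMeasurable (fun x => (w x).toNNReal) (volume : Measure (Rn n)) :=
    hw.locallyIntegrable.aestronglyMeasurable.aemeasurable.real_toNNReal
  have := integral_withDensity_eq_integral_smul₀ h
    (fun z => (s ^ n)⁻¹ • f (s⁻¹ • (x - z)))
  unfold conv weightMeasure convDilate dilate
  refine Eq.trans ?_ this.symm
  congr 1; ext y
  rw [NNReal.smul_def, Real.coe_toNNReal _ (hw.nonneg y)]
  simp

/-- The image of `ν` under the affine map taking `Δ(x,r)` to the unit ball. -/
def rescale (ν : Measure (Rn n)) (r : ℝ) (x : Rn n) : Measure (Rn n) :=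
  ν.map (fun z => r⁻¹ • (z - x))

lemma isClosedEmbedding_rescale {r : ℝ} (hr : 0 < r) (x : Rn n) :
    MeasurableEmbedding (fun z : Rn n => r⁻¹ • (z - x)) :=
  ((Homeomorph.subRight x).trans
    (Homeomorph.smulOfNeZero r⁻¹ (inv_ne_zero hr.ne'))).measurableEmbedding

lemma rescale_ball (ν : Measure (Rn n)) {r : ℝ} (hr : 0 < r) (x y : Rn n) (s : ℝ) :
    rescale ν r x (Metric.ball y s) = ν (Metric.ball (x + r • y) (r * s)) := by
  rw [rescale, (isClosedEmbedding_rescale hr x).map_apply]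
  congr 1; ext z
  rw [mem_preimage, Metric.mem_ball, Metric.mem_ball, dist_eq_norm, dist_eq_norm]
  have : z - (x + r • y) = r • (r⁻¹ • (z - x) - y) := by
    rw [smul_sub, smul_inv_smul₀ hr.ne']; abel
  rw [this, norm_smul, Real.norm_of_nonneg hr.le, mul_lt_mul_iff_right₀ hr]

lemma rescale_unit_ball (ν : Measure (Rn n)) {r : ℝ} (hr : 0 < r) (x : Rn n) :
    rescale ν r x (Metric.ball 0 1) = ν (Metric.ball x r) := by
  rw [rescale_ball ν hr]; simp

lemma integral_rescale (ν : Measure (Rn n)) {r : ℝ} (hr : 0 < r) (x : Rn n) (g : Rn n → F) :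
    ∫ z, g z ∂(rescale ν r x) = ∫ z, g (r⁻¹ • (z - x)) ∂ν :=
  (isClosedEmbedding_rescale hr x).integral_map g

/-- This reduces estimates to the origin and the unit scale. The factor `r ^ n` appears because
`rescale` preserves total mass; it cancels in `logGrad`. -/
lemma conv_rescale (ν : Measure (Rn n)) (f : Rn n → F) {r : ℝ} (hr : 0 < r) (x y : Rn n) (s : ℝ) :
    conv (rescale ν r x) f s y = r ^ n • conv ν f (r * s) (x + r • y) := by
  unfold conv
  rw [integral_rescale ν hr, ← integral_smul]
  congr 1; ext z
  rw [smul_smul, mul_pow, mul_inv, ← mul_assoc, mul_inv_cancel₀ (by positivity), one_mul,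
    mul_inv, mul_comm r⁻¹, mul_smul]
  congr 3
  simp only [smul_sub, smul_add, inv_smul_smul₀ hr.ne']
  abel

lemma IsDoublingWith.rescale_measure {ν : Measure (Rn n)} {K : ℝ≥0} (h : IsDoublingWith ν K) {r : ℝ}
    (hr : 0 < r) (x : Rn n) : IsDoublingWith (rescale ν r x) K where
  ne_zero h0 := by
    have h1 := rescale_unit_ball ν hr x
    rw [h0] at h1
    exact (h.measure_ball_pos x hr).ne h1
  doubling y s hs := by
    rw [rescale_ball ν hr, rescale_ball ν hr, mul_left_comm]
    exact h.doubling _ _ (by positivity)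

lemma isLocallyFiniteMeasure_rescale (ν : Measure (Rn n)) [IsLocallyFiniteMeasure ν] {r : ℝ}
    (hr : 0 < r) (x : Rn n) : IsLocallyFiniteMeasure (rescale ν r x) :=
  ⟨fun y => ⟨Metric.ball y 1, Metric.ball_mem_nhds _ one_pos, by
    rw [rescale_ball ν hr]; exact measure_ball_lt_top⟩⟩

lemma exists_norm_le_wt (f : 𝓢(Rn n, F)) (M : ℕ) : ∃ C : ℝ, 0 ≤ C ∧ ∀ x, ‖f x‖ ≤ C * wt M x := by
  refine ⟨2 ^ M * ((Finset.Iic (M, 0)).sup fun m => SchwartzMap.seminorm ℝ m.1 m.2) f,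
    by positivity, fun x => ?_⟩
  have := SchwartzMap.one_add_le_sup_seminorm_apply (𝕜 := ℝ) (m := (M, 0)) le_rfl le_rfl f x
  rw [norm_iteratedFDeriv_zero] at this
  rw [wt, ← div_eq_mul_inv, le_div_iff₀ (by positivity), mul_comm]
  exact this

/-! ### Size and differentiability of convolutions with a doubling measure. -/

section Bounds

variable {ν : Measure (Rn n)} {K : ℝ≥0} [IsLocallyFiniteMeasure ν]

lemma IsDoublingWith.integrable_of_le_wt (h : IsDoublingWith ν K) {D M : ℕ}
    (hD : (K : ℝ) ≤ 2 ^ D) (hM : D + 1 ≤ M) {f : Rn n → F} (hf : Continuous f) {C : ℝ}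
    (hC : ∀ x, ‖f x‖ ≤ C * wt M x) : Integrable f ν :=
  ((h.integrable_wt hD hM).const_mul C).mono' hf.aestronglyMeasurable (ae_of_all _ hC)

lemma exists_le_two_pow (K : ℝ≥0) : ∃ D : ℕ, (K : ℝ) ≤ 2 ^ D := by
  obtain ⟨D, hD⟩ := pow_unbounded_of_one_lt (K : ℝ) one_lt_two
  exact ⟨D, hD.le⟩

lemma IsDoublingWith.integrable_conv (h : IsDoublingWith ν K) (f : 𝓢(Rn n, F)) {s : ℝ} (hs : 0 < s)
    (x : Rn n) : Integrable (fun z => f (s⁻¹ • (x - z))) ν := by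
  have := isLocallyFiniteMeasure_rescale ν hs x
  obtain ⟨D, hD⟩ := exists_le_two_pow K
  obtain ⟨C, -, hC⟩ := exists_norm_le_wt f (D + 1)
  have := (h.rescale_measure hs x).integrable_of_le_wt hD le_rfl (f := fun y => f (-y)) (C := C)
    (f.continuous.comp continuous_neg) (fun y => by simpa [wt_neg] using hC (-y))
  have h2 := ((isClosedEmbedding_rescale hs x).integrable_map_iff).1 this
  refine h2.congr (ae_of_all _ fun z => ?_)
  simp only [Function.comp]
  rw [← smul_neg, neg_sub]

lemma IsDoublingWith.norm_integral_le_of_le_wt (h : IsDoublingWith ν K) {D M : ℕ}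
    (hD : (K : ℝ) ≤ 2 ^ D) (hM : D + 1 ≤ M) {f : Rn n → F} {C : ℝ} (hC0 : 0 ≤ C)
    (hC : ∀ x, ‖f x‖ ≤ C * wt M x) :
    ‖∫ x, f x ∂ν‖ ≤ C * 2 ^ (M + 1) * ν.real (Metric.ball 0 1) := by
  refine (norm_integral_le_of_norm_le ((h.integrable_wt hD hM).const_mul C)
    (ae_of_all _ hC)).trans ?_
  rw [integral_const_mul, mul_assoc]
  exact mul_le_mul_of_nonneg_left (h.integral_wt_le hD hM) hC0

lemma IsDoublingWith.norm_conv_le (h : IsDoublingWith ν K) {D M : ℕ}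
    (hD : (K : ℝ) ≤ 2 ^ D) (hM : D + 1 ≤ M) {f : Rn n → F} {C : ℝ} (hC0 : 0 ≤ C)
    (hC : ∀ x, ‖f x‖ ≤ C * wt M x) {s : ℝ} (hs : 0 < s) (x : Rn n) :
    ‖conv ν f s x‖ ≤ C * 2 ^ (M + 1) * (s ^ n)⁻¹ * ν.real (Metric.ball x s) := by
  have := isLocallyFiniteMeasure_rescale ν hs x
  have h1 := (h.rescale_measure hs x).norm_integral_le_of_le_wt hD hM (f := fun y => f (-y)) hC0
    (fun y => by simpa [wt_neg] using hC (-y))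
  rw [integral_rescale ν hs, Measure.real, rescale_unit_ball ν hs] at h1
  unfold conv
  rw [integral_smul, norm_smul, norm_inv, norm_pow, Real.norm_of_nonneg hs.le]
  have h2 : ∀ z, f (s⁻¹ • (x - z)) = f (-(s⁻¹ • (z - x))) := fun z => by
    rw [← smul_neg, neg_sub]
  simp_rw [h2]
  calc _ ≤ (s ^ n)⁻¹ * (C * 2 ^ (M + 1) * ν.real (Metric.ball x s)) := by gcongr; exact h1
    _ = _ := by ring

lemma IsDoublingWith.le_conv (h : IsDoublingWith ν K) {f : 𝓢(Rn n, ℝ)} (h0 : ∀ x, 0 ≤ f x) {c : ℝ}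
    (hc : ∀ x ∈ Metric.ball 0 1, c ≤ f x) {s : ℝ} (hs : 0 < s) (x : Rn n) :
    c * (s ^ n)⁻¹ * ν.real (Metric.ball x s) ≤ conv ν f s x := by
  have hint : Integrable (fun z => (s ^ n)⁻¹ • f (s⁻¹ • (x - z))) ν :=
    (h.integrable_conv f hs x).smul (s ^ n)⁻¹
  have h1 : ∫ z in Metric.ball x s, c * (s ^ n)⁻¹ ∂ν ≤ conv ν f s x := by
    refine le_trans ?_ (setIntegral_le_integral (s := Metric.ball x s)
      hint (ae_of_all _ fun z => ?_))
    · refine setIntegral_mono_on (integrableOn_const measure_ball_lt_top.ne)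
        hint.integrableOn measurableSet_ball fun z hz => ?_
      rw [smul_eq_mul, mul_comm]
      refine mul_le_mul_of_nonneg_left (hc _ ?_) (by positivity)
      rw [mem_ball_zero_iff, norm_smul, norm_inv, Real.norm_of_nonneg hs.le, inv_mul_lt_iff₀ hs,
        mul_one, ← dist_eq_norm, dist_comm]
      exact hz
    · exact smul_nonneg (by positivity) (h0 _)
  rw [setIntegral_const, smul_eq_mul] at h1
  linarith

/-- Differentiation under the integral sign at the origin and at scale one; the general case follows
by rescaling. For `‖x‖ < 1`, Peetre's inequality yields the majorant with its factor `2 ^ (D + 1)`.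
-/
lemma IsDoublingWith.hasFDerivAt_conv_unit (h : IsDoublingWith ν K) (f : 𝓢(Rn n, F)) :
    HasFDerivAt (conv ν f 1) (conv ν (fderiv ℝ f) 1 0) 0 := by
  obtain ⟨D, hD⟩ := exists_le_two_pow K
  obtain ⟨C, hC0, hC⟩ := exists_norm_le_wt (SchwartzMap.fderivCLM ℝ (Rn n) F f) (D + 1)
  have hC : ∀ x, ‖fderiv ℝ f x‖ ≤ C * wt (D + 1) x := hC
  have key := hasFDerivAt_integral_of_dominated_of_fderiv_le (μ := ν) (𝕜 := ℝ)
    (F := fun x z => f (x - z)) (F' := fun x z => fderiv ℝ f (x - z)) (x₀ := 0)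
    (s := Metric.ball 0 1) (bound := fun z => C * 2 ^ (D + 1) * wt (D + 1) z)
    (Metric.ball_mem_nhds _ one_pos)
    (Filter.Eventually.of_forall fun x =>
      (f.continuous.comp (by fun_prop)).aestronglyMeasurable)
    (by simpa using h.integrable_conv f one_pos 0)
    (((SchwartzMap.fderivCLM ℝ (Rn n) F f).continuous.comp (by fun_prop :
      Continuous fun z : Rn n => 0 - z)).aestronglyMeasurable)
    (ae_of_all _ fun z x hx => ?_) ((h.integrable_wt hD le_rfl).const_mul _)
    (ae_of_all _ fun z x _ => ?_)
  · have e1 : conv ν f 1 = fun x => ∫ z, f (x - z) ∂ν := by ext x; simp [conv]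
    have e2 : conv ν (fderiv ℝ f) 1 0 = ∫ z, fderiv ℝ f (0 - z) ∂ν := by simp [conv]
    rw [e1, e2]
    exact key
  · refine (hC _).trans ?_
    rw [mul_assoc]
    refine mul_le_mul_of_nonneg_left ?_ hC0
    rw [← wt_neg, neg_sub]
    refine (wt_sub_le _ _ _).trans ?_
    refine mul_le_mul_of_nonneg_right ?_ (wt_nonneg _ _)
    rw [mem_ball_zero_iff] at hx
    exact pow_le_pow_left₀ (by positivity) (by linarith) _
  · have := (f.differentiableAt (x := x - z)).hasFDerivAt.comp x ((hasFDerivAt_id x).sub_const z)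
    rw [ContinuousLinearMap.comp_id] at this
    exact this

lemma IsDoublingWith.hasFDerivAt_conv (h : IsDoublingWith ν K) (f : 𝓢(Rn n, F)) {s : ℝ}
    (hs : 0 < s) (x : Rn n) :
    HasFDerivAt (conv ν f s) (s⁻¹ • conv ν (fderiv ℝ f) s x) x := by
  have := isLocallyFiniteMeasure_rescale ν hs x
  have h1 := (h.rescale_measure hs x).hasFDerivAt_conv_unit f
  have e1 : conv ν f s = fun y => (s ^ n)⁻¹ • conv (rescale ν s x) f 1 (s⁻¹ • (y - x)) := by
    ext y
    rw [conv_rescale ν f hs, smul_smul, inv_mul_cancel₀ (by positivity), one_smul, mul_one,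
      smul_inv_smul₀ hs.ne', add_sub_cancel]
  have h2 : HasFDerivAt (fun y : Rn n => s⁻¹ • (y - x)) (s⁻¹ • ContinuousLinearMap.id ℝ (Rn n)) x :=
    ((hasFDerivAt_id x).sub_const x).const_smul s⁻¹
  have h3 : HasFDerivAt (conv (rescale ν s x) f 1) (conv (rescale ν s x) (fderiv ℝ f) 1 0)
    (s⁻¹ • (x - x)) := by simpa using h1
  have e2 : s⁻¹ • conv ν (fderiv ℝ f) s x = (s ^ n)⁻¹ •
      (conv (rescale ν s x) (fderiv ℝ f) 1 0).comp (s⁻¹ • ContinuousLinearMap.id ℝ (Rn n)) := by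
    rw [conv_rescale ν _ hs, ContinuousLinearMap.comp_smul, ContinuousLinearMap.comp_id, mul_one,
      smul_zero, add_zero, smul_comm s⁻¹ (s ^ n), smul_smul (s ^ n)⁻¹,
      inv_mul_cancel₀ (by positivity), one_smul]
  rw [e1, e2]
  exact (h3.comp x h2).const_smul (s ^ n)⁻¹

end Bounds

lemma stronglyMeasurable_conv (ν : Measure (Rn n)) [SFinite ν] {f : Rn n → F} (hf : Continuous f) :
    StronglyMeasurable (fun p : Rn n × ℝ => conv ν f p.2 p.1) := by
  unfold conv
  apply StronglyMeasurable.integral_prod_right' (f := fun q : (Rn n × ℝ) × Rn n =>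
    (q.1.2 ^ n)⁻¹ • f (q.1.2⁻¹ • (q.1.1 - q.2)))
  refine StronglyMeasurable.smul ?_ ?_
  · exact (Measurable.stronglyMeasurable (by fun_prop))
  · exact hf.comp_stronglyMeasurable (Measurable.stronglyMeasurable (by fun_prop))

/-- The kernels considered: Schwartz, non-negative, bounded below on the unit ball, integral one. -/
structure IsGood (f : 𝓢(Rn n, ℝ)) : Prop where
  nonneg : ∀ x, 0 ≤ f x
  exists_le : ∃ c : ℝ, 0 < c ∧ ∀ x ∈ Metric.ball 0 1, c ≤ f x
  integral_eq_one : ∫ x, f x = 1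

/-- The size of the logarithmic gradient of `ν ∗ f_s` at `x`. -/
def logGrad (ν : Measure (Rn n)) (f : Rn n → ℝ) (x : Rn n) (s : ℝ) : ℝ :=
  s⁻¹ * (conv ν f s x)⁻¹ * ‖conv ν (fderiv ℝ f) s x‖

/-- The scale-invariant quantity is `s * logGrad ν f x s`. Normalization of the measure drops out
because the numerator and denominator of `logGrad` are both linear in it. -/
lemma logGrad_rescale (ν : Measure (Rn n)) (f : Rn n → ℝ) {r : ℝ} (hr : 0 < r) (x y : Rn n) (s : ℝ) :
    logGrad (rescale ν r x) f y s = r * logGrad ν f (x + r • y) (r * s) := by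
  unfold logGrad
  rw [conv_rescale ν f hr, conv_rescale ν _ hr, norm_smul, norm_pow, Real.norm_of_nonneg hr.le,
    smul_eq_mul, mul_inv, mul_inv]
  field_simp

section Good

variable {ν : Measure (Rn n)} {K : ℝ≥0} [IsLocallyFiniteMeasure ν]

lemma IsGood.conv_pos {f : 𝓢(Rn n, ℝ)} (hf : IsGood f) (h : IsDoublingWith ν K) {s : ℝ}
    (hs : 0 < s) (x : Rn n) : 0 < conv ν f s x := by
  obtain ⟨c, hc, hc1⟩ := hf.exists_le
  have := h.real_ball_pos x hs
  exact lt_of_lt_of_le (by positivity) (h.le_conv hf.nonneg hc1 hs x)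

lemma IsGood.hasFDerivAt_log {f : 𝓢(Rn n, ℝ)} (hf : IsGood f) (h : IsDoublingWith ν K) {s : ℝ}
    (hs : 0 < s) (x : Rn n) : HasFDerivAt (fun z => Real.log (conv ν f s z))
      ((conv ν f s x)⁻¹ • s⁻¹ • conv ν (fderiv ℝ f) s x) x :=
  (h.hasFDerivAt_conv f hs x).log (hf.conv_pos h hs x).ne'

lemma IsGood.norm_fderiv_log {f : 𝓢(Rn n, ℝ)} (hf : IsGood f) (h : IsDoublingWith ν K) {s : ℝ}
    (hs : 0 < s) (x : Rn n) :
    ‖(conv ν f s x)⁻¹ • s⁻¹ • conv ν (fderiv ℝ f) s x‖ = logGrad ν f x s := by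
  rw [norm_smul, norm_smul, norm_inv, norm_inv, Real.norm_of_nonneg hs.le,
    Real.norm_of_nonneg (hf.conv_pos h hs x).le, logGrad]
  ring

lemma IsGood.norm_gradient_log {f : 𝓢(Rn n, ℝ)} (hf : IsGood f) (h : IsDoublingWith ν K) {s : ℝ}
    (hs : 0 < s) (x : Rn n) :
    ‖gradient (fun z => Real.log (conv ν f s z)) x‖ = logGrad ν f x s := by
  rw [gradient, LinearIsometryEquiv.norm_map, (hf.hasFDerivAt_log h hs x).fderiv,
    hf.norm_fderiv_log h hs]

end Good

lemma measurable_logGrad (ν : Measure (Rn n)) [SFinite ν] (f : 𝓢(Rn n, ℝ)) :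
    Measurable (fun p : Rn n × ℝ => logGrad ν f p.1 p.2) := by
  unfold logGrad
  have h1 := (stronglyMeasurable_conv ν f.continuous).measurable
  have h2 := (stronglyMeasurable_conv ν
    (SchwartzMap.fderivCLM ℝ (Rn n) ℝ f).continuous).norm.measurable
  exact (measurable_snd.inv.mul h1.inv).mul h2

end

section

/-! ### Iterated remainders of smoothing by a reference kernel -/

variable {n : ℕ} {F : Type} [NormedAddCommGroup F] [NormedSpace ℝ F]

/-- The average `∫ φ(y) g(x - s y) dy`. -/
def smear (φ : Rn n → ℝ) (s : ℝ) (g : Rn n → F) (x : Rn n) : F :=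
  ∫ y, φ y • g (x - s • y)

/-- The remainders `(1 - A_{σ(m-1)}) ⋯ (1 - A_{σ(0)}) ψ`, with `A_s` smoothing at scale `s`. -/
def resid (φ : Rn n → ℝ) (σ : ℕ → ℝ) (ψ : Rn n → F) : ℕ → Rn n → F
  | 0 => ψ
  | m + 1 => fun x => resid φ σ ψ m x - smear φ (σ m) (resid φ σ ψ m) x

/-- Weighted `L¹` norm of a kernel. -/
def moment (φ : Rn n → ℝ) (M : ℕ) : ℝ := ∫ y, ‖φ y‖ * (1 + ‖y‖) ^ M

lemma moment_nonneg (φ : Rn n → ℝ) (M : ℕ) : 0 ≤ moment φ M :=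
  integral_nonneg fun _ => by positivity

lemma integrable_norm_mul_pow (φ : 𝓢(Rn n, F)) (M : ℕ) :
    Integrable (fun y => ‖φ y‖ * (1 + ‖y‖) ^ M) := by
  obtain ⟨C, hC0, hC⟩ := exists_norm_le_wt φ (M + (n + 1))
  refine ((integrable_wt_volume le_rfl).const_mul C).mono'
    (φ.continuous.norm.mul (by fun_prop)).aestronglyMeasurable (ae_of_all _ fun y => ?_)
  rw [Real.norm_of_nonneg (by positivity), ← pow_mul_wt M (n + 1)]
  calc _ ≤ C * wt (M + (n + 1)) y * (1 + ‖y‖) ^ M := by gcongr; exact hC y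
    _ = _ := by ring

lemma moment_mono (φ : 𝓢(Rn n, ℝ)) {M N : ℕ} (h : M ≤ N) : moment φ M ≤ moment φ N :=
  integral_mono (integrable_norm_mul_pow φ M) (integrable_norm_mul_pow φ N) fun y =>
    mul_le_mul_of_nonneg_left (pow_le_pow_right₀ (by linarith [norm_nonneg y]) h) (norm_nonneg _)

lemma norm_smear_le (φ : 𝓢(Rn n, ℝ)) {s : ℝ} (hs : 0 ≤ s) (hs1 : s ≤ 1) {g : Rn n → F} {B : ℝ}
    (hB : 0 ≤ B) {M : ℕ} (hg : ∀ x, ‖g x‖ ≤ B * wt M x) (x : Rn n) :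
    ‖smear φ s g x‖ ≤ B * moment φ M * wt M x := by
  refine (norm_integral_le_of_norm_le ((integrable_norm_mul_pow φ M).mul_const (B * wt M x))
    (ae_of_all _ fun y => ?_)).trans_eq ?_
  · rw [norm_smul, mul_assoc]
    refine mul_le_mul_of_nonneg_left ((hg _).trans ?_) (norm_nonneg _)
    calc _ ≤ B * ((1 + ‖y‖) ^ M * wt M x) := by gcongr; exact wt_sub_smul_le M hs hs1 x y
      _ = _ := by ring
  · rw [integral_mul_const, moment]; ring

lemma bounded_of_le_wt {g : Rn n → F} {B : ℝ} (hB : 0 ≤ B) {M : ℕ}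
    (hg : ∀ x, ‖g x‖ ≤ B * wt M x) (x : Rn n) : ‖g x‖ ≤ B :=
  (hg x).trans (mul_le_of_le_one_right hB (wt_le_one _ _))

lemma integrable_smear (φ : 𝓢(Rn n, ℝ)) (s : ℝ) {g : Rn n → F} (hc : Continuous g) {B : ℝ}
    (hg : ∀ x, ‖g x‖ ≤ B) (x : Rn n) : Integrable (fun y => φ y • g (x - s • y)) := by
  refine (φ.integrable (μ := volume)).norm.mul_const B |>.mono'
    (φ.continuous.smul (hc.comp (by fun_prop))).aestronglyMeasurable (ae_of_all _ fun y => ?_)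
  rw [norm_smul]
  exact mul_le_mul_of_nonneg_left (hg _) (norm_nonneg _)

/-- Since `φ` has integral one, the difference is an average of `g x - g (x - s y)`, estimated by
the mean value inequality. Of the `M + 1` moments, `M` come from moving the weight along the segment
and one from its length. -/
lemma norm_sub_smear_le [CompleteSpace F] (φ : 𝓢(Rn n, ℝ)) (hφ : ∫ x, φ x = 1) {s : ℝ} (hs : 0 ≤ s)
    (hs1 : s ≤ 1) {g : Rn n → F} {g' : Rn n → Rn n →L[ℝ] F} (hg : ∀ x, HasFDerivAt g (g' x) x)
    {B₀ B : ℝ} (hB0 : ∀ x, ‖g x‖ ≤ B₀) (hB : 0 ≤ B) {M : ℕ}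
    (hg' : ∀ x, ‖g' x‖ ≤ B * wt M x) (x : Rn n) :
    ‖g x - smear φ s g x‖ ≤ s * B * moment φ (M + 1) * wt M x := by
  have hc : Continuous g := continuous_iff_continuousAt.2 fun x => (hg x).continuousAt
  have e : g x - smear φ s g x = ∫ y, φ y • (g x - g (x - s • y)) := by
    simp_rw [smul_sub]
    rw [integral_sub ((φ.integrable).smul_const _) (integrable_smear φ s hc hB0 x),
      integral_smul_const, hφ, one_smul]
    rfl
  rw [e]
  refine (norm_integral_le_of_norm_le ((integrable_norm_mul_pow φ (M + 1)).mul_const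
    (s * B * wt M x)) (ae_of_all _ fun y => ?_)).trans_eq ?_
  · rw [norm_smul, mul_assoc]
    refine mul_le_mul_of_nonneg_left ?_ (norm_nonneg _)
    have h1 : ∀ z ∈ segment ℝ (x - s • y) x, ‖g' z‖ ≤ B * ((1 + ‖y‖) ^ M * wt M x) := by
      intro z hz
      obtain ⟨a, b, ha, hb, hab, rfl⟩ := hz
      have : a • (x - s • y) + b • x = x - (a * s) • y := by
        rw [smul_sub, smul_smul, sub_add_eq_add_sub, ← add_smul, hab, one_smul]
      rw [this]
      refine (hg' _).trans (mul_le_mul_of_nonneg_left ?_ hB)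
      exact wt_sub_smul_le M (by positivity) (mul_le_one₀ (by linarith) hs hs1) x y
    have h2 := (convex_segment (x - s • y) x).norm_image_sub_le_of_norm_hasFDerivWithin_le
      (fun z _ => (hg z).hasFDerivWithinAt) h1 (left_mem_segment ℝ _ _) (right_mem_segment ℝ _ _)
    refine h2.trans ?_
    have h3 : ‖x - (x - s • y)‖ ≤ s * (1 + ‖y‖) := by
      rw [sub_sub_cancel, norm_smul, Real.norm_of_nonneg hs]
      gcongr; linarith
    calc _ ≤ B * ((1 + ‖y‖) ^ M * wt M x) * (s * (1 + ‖y‖)) := by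
          gcongr
          exact mul_nonneg hB (mul_nonneg (by positivity) (wt_nonneg _ _))
      _ = _ := by ring
  · rw [integral_mul_const, moment]; ring

/-- The derivative falls on `g`, so smoothing, and hence forming remainders, commutes with
differentiation. -/
lemma hasFDerivAt_smear (φ : 𝓢(Rn n, ℝ)) {s : ℝ} {g : Rn n → F}
    {g' : Rn n → Rn n →L[ℝ] F} (hg : ∀ x, HasFDerivAt g (g' x) x) (hc' : Continuous g')
    {B₀ B : ℝ} (hB0 : ∀ x, ‖g x‖ ≤ B₀) (hB : ∀ x, ‖g' x‖ ≤ B) (x : Rn n) :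
    HasFDerivAt (smear φ s g) (smear φ s g' x) x := by
  have hc : Continuous g := continuous_iff_continuousAt.2 fun x => (hg x).continuousAt
  refine hasFDerivAt_integral_of_dominated_of_fderiv_le (μ := volume) (𝕜 := ℝ)
    (F := fun x y => φ y • g (x - s • y)) (F' := fun x y => φ y • g' (x - s • y)) (x₀ := x)
    (s := univ) (bound := fun y => ‖φ y‖ * B) Filter.univ_mem
    (Filter.Eventually.of_forall fun x => (integrable_smear φ s hc hB0 x).aestronglyMeasurable)
    (integrable_smear φ s hc hB0 x) (integrable_smear φ s hc' hB x).aestronglyMeasurable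
    (ae_of_all _ fun y x _ => ?_) ((φ.integrable (μ := volume)).norm.mul_const B)
    (ae_of_all _ fun y x _ => ?_)
  · rw [norm_smul]
    exact mul_le_mul_of_nonneg_left (hB _) (norm_nonneg _)
  · have := (hg (x - s • y)).comp x ((hasFDerivAt_id x).sub_const (s • y))
    rw [ContinuousLinearMap.comp_id] at this
    exact this.const_smul (φ y)

section Resid

variable (φ : 𝓢(Rn n, ℝ)) {ε : ℝ} {σ : ℕ → ℝ}

lemma norm_resid_le (hσ : ∀ m, 0 ≤ σ m) (hσ1 : ∀ m, σ m ≤ 1) {M : ℕ} {ψ : Rn n → F} {C : ℝ}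
    (hC : 0 ≤ C) (hψ : ∀ x, ‖ψ x‖ ≤ C * wt M x) (m : ℕ) (x : Rn n) :
    ‖resid φ σ ψ m x‖ ≤ C * (1 + moment φ M) ^ m * wt M x := by
  have hA := moment_nonneg φ M
  induction m generalizing x with
  | zero => simpa [resid] using hψ x
  | succ m ih =>
    refine (norm_sub_le _ _).trans ((add_le_add (ih x)
      (norm_smear_le φ (hσ m) (hσ1 m) (by positivity) ih x)).trans_eq ?_)
    ring

/-- The target space is quantified inside the induction because the step also needs the case of
`fderiv ℝ ψ`, whose values are linear maps, to know that the derivative is continuous. -/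
lemma hasFDerivAt_resid (hσ : ∀ m, 0 ≤ σ m) (hσ1 : ∀ m, σ m ≤ 1) (m : ℕ) :
    ∀ (F : Type) [NormedAddCommGroup F] [NormedSpace ℝ F] (ψ : 𝓢(Rn n, F)) (x : Rn n),
      HasFDerivAt (resid φ σ ψ m) (resid φ σ (fderiv ℝ ψ) m x) x := by
  induction m with
  | zero => intro F _ _ ψ x; exact ψ.differentiableAt.hasFDerivAt
  | succ m ih =>
    intro F _ _ ψ x
    have hA := moment_nonneg φ 0
    obtain ⟨C, hC0, hC⟩ := exists_norm_le_wt ψ 0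
    obtain ⟨C', hC0', hC'⟩ := exists_norm_le_wt (SchwartzMap.fderivCLM ℝ (Rn n) F ψ) 0
    refine (ih F ψ x).sub (hasFDerivAt_smear φ (ih F ψ) ?_
      (bounded_of_le_wt (by positivity) (norm_resid_le φ hσ hσ1 hC0 hC m))
      (bounded_of_le_wt (by positivity) (norm_resid_le φ hσ hσ1 hC0' hC' m)) x)
    exact continuous_iff_continuousAt.2 fun x =>
      (ih _ (SchwartzMap.fderivCLM ℝ (Rn n) F ψ) x).continuousAt

lemma continuous_resid (hσ : ∀ m, 0 ≤ σ m) (hσ1 : ∀ m, σ m ≤ 1) (ψ : 𝓢(Rn n, F)) (m : ℕ) :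
    Continuous (resid φ σ ψ m) :=
  continuous_iff_continuousAt.2 fun x => (hasFDerivAt_resid φ hσ hσ1 m F ψ x).continuousAt

/-- Induction on `N`, the number of derivatives of `ψ` spent. By the previous stage for `fderiv ℝ
ψ`, the derivative of the `m`-th remainder is `O(((1 + A) ε^N)^m)`; the next factor `1 - A_{σ(m)}`
contributes a further `ε^m`, which raises `N` by one. The constant must not depend on `σ`, since the
scales later carry a free parameter `t`. -/
lemma exists_norm_resid_le (hφ : ∫ x, φ x = 1) (hε : 0 < ε) (hε1 : ε ≤ 1) (M N : ℕ) :
    ∀ (F : Type) [NormedAddCommGroup F] [NormedSpace ℝ F] [CompleteSpace F] (ψ : 𝓢(Rn n, F)),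
      ∃ C : ℝ, 0 ≤ C ∧ ∀ σ : ℕ → ℝ, (∀ m, 0 ≤ σ m) → (∀ m, σ m ≤ ε ^ m) → ∀ m x,
        ‖resid φ σ ψ m x‖ ≤ C * ((1 + moment φ (M + 1)) * ε ^ N) ^ m * wt M x := by
  have hA := moment_nonneg φ M
  have hAA := moment_mono φ (Nat.le_succ M)
  induction N with
  | zero =>
    intro F _ _ _ ψ
    obtain ⟨C, hC0, hC⟩ := exists_norm_le_wt ψ M
    refine ⟨C, hC0, fun σ h0 h1 m x => ?_⟩
    refine (norm_resid_le φ h0 (fun m => (h1 m).trans (pow_le_one₀ hε.le hε1)) hC0 hC m x).trans ?_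
    refine mul_le_mul_of_nonneg_right ?_ (wt_nonneg _ _)
    rw [pow_zero, mul_one]
    gcongr
  | succ N ih =>
    intro F _ _ _ ψ
    obtain ⟨C₀, hC₀0, hC₀⟩ := exists_norm_le_wt ψ M
    obtain ⟨C₁, hC₁0, hC₁⟩ := ih _ (SchwartzMap.fderivCLM ℝ (Rn n) F ψ)
    set A := moment φ (M + 1) with hAdef
    have hA1 : 0 ≤ A := hA.trans hAA
    -- `C₀` serves `m = 0`. The other summand serves `m + 1`, where the gain is only an `m`-th
    -- power, so one factor has to be divided out.
    refine ⟨C₀ + C₁ * A / ((1 + A) * ε ^ (N + 1)), by positivity, fun σ h0 h1 m x => ?_⟩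
    have hσ1 : ∀ m, σ m ≤ 1 := fun m => (h1 m).trans (pow_le_one₀ hε.le hε1)
    cases m with
    | zero =>
      rw [pow_zero, mul_one]
      refine (hC₀ x).trans (mul_le_mul_of_nonneg_right ?_ (wt_nonneg _ _))
      exact le_add_of_nonneg_right (by positivity)
    | succ m =>
      have h2 := norm_sub_smear_le φ hφ (h0 m) (hσ1 m) (hasFDerivAt_resid φ h0 hσ1 m F ψ)
        (bounded_of_le_wt (by positivity) (norm_resid_le φ h0 hσ1 hC₀0 hC₀ m))
        (by positivity) (hC₁ σ h0 h1 m) x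
      refine h2.trans (mul_le_mul_of_nonneg_right ?_ (wt_nonneg _ _))
      calc _ ≤ ε ^ m * (C₁ * ((1 + A) * ε ^ N) ^ m) * A := by gcongr; exact h1 m
        _ = C₁ * A / ((1 + A) * ε ^ (N + 1)) * ((1 + A) * ε ^ (N + 1)) ^ (m + 1) := by
            have : (1 + A) * ε ^ (N + 1) ≠ 0 := by positivity
            have e : ((1 + A) * ε ^ (N + 1)) ^ m = ε ^ m * ((1 + A) * ε ^ N) ^ m := by
              rw [← mul_pow]; congr 1; ring
            rw [pow_succ ((1 + A) * ε ^ (N + 1)) m, e]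
            field_simp
        _ ≤ _ := by
            gcongr
            exact le_add_of_nonneg_left hC₀0

end Resid

/-! ### Moving the average and the derivative onto the measure. -/

section Pairing

lemma integrable_smul_of_le_wt {p : Rn n → ℝ} {q : Rn n → F} (hp : Continuous p)
    (hq : Continuous q) {C : ℝ} (h : ∀ y, ‖p y‖ * ‖q y‖ ≤ C * wt (n + 1) y) :
    Integrable fun y => p y • q y :=
  ((integrable_wt_volume (n := n) le_rfl).const_mul C).mono' (hp.smul hq).aestronglyMeasurable
    (ae_of_all _ fun y => by rw [norm_smul]; exact h y)

variable {ν : Measure (Rn n)} {K : ℝ≥0} [IsLocallyFiniteMeasure ν]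

lemma IsDoublingWith.norm_conv_le_of_le_one (h : IsDoublingWith ν K) {D : ℕ}
    (hD : (K : ℝ) ≤ 2 ^ D) {f : Rn n → F} {C : ℝ} (hC0 : 0 ≤ C)
    (hC : ∀ x, ‖f x‖ ≤ C * wt (D + 1) x) {s : ℝ} (hs : 0 < s) (hs1 : s ≤ 1) (y : Rn n) :
    ‖conv ν f s y‖ ≤ C * 2 ^ (D + 1 + 1) * 2 ^ D * (s ^ n)⁻¹ * ν.real (Metric.ball 0 1) *
      (1 + ‖y‖) ^ D := by
  refine (h.norm_conv_le hD le_rfl hC0 hC hs y).trans ?_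
  have h1 : ν.real (Metric.ball y s) ≤ 2 ^ D * (1 + ‖y‖) ^ D * ν.real (Metric.ball 0 1) :=
    (measureReal_mono (Metric.ball_subset_ball hs1) measure_ball_lt_top.ne).trans
      (h.real_ball_le hD y)
  calc _ ≤ C * 2 ^ (D + 1 + 1) * (s ^ n)⁻¹ * (2 ^ D * (1 + ‖y‖) ^ D * ν.real (Metric.ball 0 1)) := by
        gcongr
    _ = _ := by ring

lemma smear_eq (φ : Rn n → ℝ) {s : ℝ} (hs : 0 < s) (g : Rn n → F) (z : Rn n) :
    smear φ s g (-z) = ∫ y, ((s ^ n)⁻¹ * φ (s⁻¹ • (y - z))) • g (-y) := by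
  rw [← integral_add_right_eq_self _ z]
  have h := Measure.integral_comp_inv_smul (volume : Measure (Rn n))
    (fun u => φ u • g (-z - s • u)) s
  have e : ∀ y : Rn n, ((s ^ n)⁻¹ * φ (s⁻¹ • (y + z - z))) • g (-(y + z)) =
      (s ^ n)⁻¹ • (fun u => φ u • g (-z - s • u)) (s⁻¹ • y) := by
    intro y
    simp only [add_sub_cancel_right, smul_inv_smul₀ hs.ne', mul_smul]
    congr 3; abel
  simp_rw [e]
  rw [integral_smul, h, smul_smul, smear]
  simp [abs_of_pos hs, inv_mul_cancel₀ (pow_pos hs n).ne']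

/-- Fubini: smoothing the test function is dual to smoothing the measure. The reflected argument
`-z` appears because `conv ν f 1 0` integrates `f (-z)`. The decay of `g` has order `D + (n + 1)`,
where `D` absorbs the growth of `conv ν φ s` and `n + 1` gives Lebesgue integrability. -/
lemma IsDoublingWith.integral_smear_eq [CompleteSpace F] (h : IsDoublingWith ν K) {D : ℕ} (hD : (K : ℝ) ≤ 2 ^ D)
    (φ : 𝓢(Rn n, ℝ)) {s : ℝ} (hs : 0 < s) (hs1 : s ≤ 1) {g : Rn n → F} (hc : Continuous g)
    {B : ℝ} (hg : ∀ x, ‖g x‖ ≤ B * wt (D + (n + 1)) x) :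
    ∫ z, smear φ s g (-z) ∂ν = ∫ y, conv ν φ s y • g (-y) := by
  simp_rw [smear_eq φ hs]
  obtain ⟨C, hC0, hC⟩ := exists_norm_le_wt φ (D + 1)
  rw [integral_integral_swap]
  · congr 1; ext y
    rw [integral_smul_const]
    rfl
  · have hmeas : Continuous (Function.uncurry fun (z y : Rn n) =>
        ((s ^ n)⁻¹ * φ (s⁻¹ • (y - z))) • g (-y)) := by
      refine Continuous.smul (continuous_const.mul (φ.continuous.comp ?_)) (hc.comp ?_) <;> fun_prop
    rw [integrable_prod_iff' hmeas.aestronglyMeasurable]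
    constructor
    · refine ae_of_all _ fun y => ?_
      exact ((h.integrable_conv φ hs y).const_mul (s ^ n)⁻¹).smul_const (g (-y))
    · have e : ∀ y, ∫ z, ‖Function.uncurry (fun (z y : Rn n) =>
          ((s ^ n)⁻¹ * φ (s⁻¹ • (y - z))) • g (-y)) (z, y)‖ ∂ν =
          conv ν (fun x => ‖φ x‖) s y * ‖g (-y)‖ := by
        intro y
        simp only [Function.uncurry, norm_smul, norm_mul, integral_mul_const, conv, smul_eq_mul,
          norm_inv, norm_pow, Real.norm_of_nonneg hs.le]
      simp_rw [e]
      refine ((integrable_wt_volume (n := n) le_rfl).const_mul (C * 2 ^ (D + 1 + 1) * 2 ^ D * (s ^ n)⁻¹ *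
        ν.real (Metric.ball 0 1) * B)).mono' ?_ (ae_of_all _ fun y => ?_)
      · refine AEStronglyMeasurable.mul ?_ (hc.comp continuous_neg).norm.aestronglyMeasurable
        exact ((stronglyMeasurable_conv ν φ.continuous.norm).comp_measurable
          (measurable_id.prodMk measurable_const)).aestronglyMeasurable
      · have h1 := h.norm_conv_le_of_le_one hD (f := fun x => ‖φ x‖) hC0
          (fun x => by simpa using hC x) hs hs1 y
        rw [norm_mul, norm_norm]
        have h2 : ‖g (-y)‖ ≤ B * wt (D + (n + 1)) y := by simpa [wt_neg] using hg (-y)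
        rw [← pow_mul_wt D (n + 1)]
        refine (mul_le_mul h1 h2 (norm_nonneg _) (by positivity)).trans_eq ?_
        ring

/-- After the previous duality, integration by parts takes the derivative off `g` and puts it on the
smooth function `ν ∗ φ_s`. The two minus signs, from the reflection and from the parts formula,
cancel. -/
lemma IsDoublingWith.integral_smear_fderiv_eq (h : IsDoublingWith ν K) {D : ℕ}
    (hD : (K : ℝ) ≤ 2 ^ D) (φ : 𝓢(Rn n, ℝ)) {s : ℝ} (hs : 0 < s) (hs1 : s ≤ 1) {g : Rn n → ℝ}
    {g' : Rn n → Rn n →L[ℝ] ℝ} (hg : ∀ x, HasFDerivAt g (g' x) x) (hc' : Continuous g')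
    {B : ℝ} (hB : 0 ≤ B) (hgB : ∀ x, ‖g x‖ ≤ B * wt (D + (n + 1)) x)
    (hgB' : ∀ x, ‖g' x‖ ≤ B * wt (D + (n + 1)) x) :
    ∫ z, smear φ s g' (-z) ∂ν = ∫ y, g (-y) • (s⁻¹ • conv ν (fderiv ℝ φ) s y) := by
  rw [h.integral_smear_eq hD φ hs hs1 hc' hgB']
  obtain ⟨C, hC0, hC⟩ := exists_norm_le_wt φ (D + 1)
  obtain ⟨C', hC0', hC'⟩ := exists_norm_le_wt (SchwartzMap.fderivCLM ℝ (Rn n) ℝ φ) (D + 1)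
  have hc : Continuous g := continuous_iff_continuousAt.2 fun x => (hg x).continuousAt
  have hP : ∀ y, HasFDerivAt (conv ν φ s) (s⁻¹ • conv ν (fderiv ℝ φ) s y) y :=
    fun y => h.hasFDerivAt_conv φ hs y
  have hPc : Continuous (conv ν φ s) := continuous_iff_continuousAt.2 fun x => (hP x).continuousAt
  have hPc' : Continuous (conv ν (fderiv ℝ φ) s) := continuous_iff_continuousAt.2 fun x =>
    (h.hasFDerivAt_conv (SchwartzMap.fderivCLM ℝ (Rn n) ℝ φ) hs x).continuousAt
  set T := ν.real (Metric.ball (0 : Rn n) 1)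
  have hPb := h.norm_conv_le_of_le_one hD hC0 hC hs hs1
  have hPb' := h.norm_conv_le_of_le_one hD hC0' hC' hs hs1
  set C₁ := C * 2 ^ (D + 1 + 1) * 2 ^ D * (s ^ n)⁻¹ * T
  set C₂ := C' * 2 ^ (D + 1 + 1) * 2 ^ D * (s ^ n)⁻¹ * T
  have hC₁ : 0 ≤ C₁ := by positivity
  have hC₂ : 0 ≤ C₂ := by positivity
  have b1 : ∀ y, ‖g (-y)‖ ≤ B * wt (D + (n + 1)) y := fun y => by simpa [wt_neg] using hgB (-y)
  have b2 : ∀ y, ‖g' (-y)‖ ≤ B * wt (D + (n + 1)) y := fun y => by simpa [wt_neg] using hgB' (-y)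
  have i1 : Integrable fun y => conv ν φ s y • g' (-y) :=
    integrable_smul_of_le_wt hPc (hc'.comp continuous_neg) (C := C₁ * B) fun y => by
      rw [← pow_mul_wt D (n + 1)]
      refine (mul_le_mul (hPb y) (b2 y) (norm_nonneg _) (by positivity)).trans_eq (by ring)
  have i2 : Integrable fun y => g (-y) • (s⁻¹ • conv ν (fderiv ℝ φ) s y) :=
    integrable_smul_of_le_wt (hc.comp continuous_neg) (hPc'.const_smul s⁻¹) (C := B * (s⁻¹ * C₂))
      fun y => by
        have : ‖s⁻¹ • conv ν (fderiv ℝ φ) s y‖ ≤ s⁻¹ * (C₂ * (1 + ‖y‖) ^ D) := by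
          rw [norm_smul, norm_inv, Real.norm_of_nonneg hs.le]
          exact mul_le_mul_of_nonneg_left (hPb' y) (by positivity)
        rw [← pow_mul_wt D (n + 1)]
        refine (mul_le_mul (b1 y) this (norm_nonneg _)
          (mul_nonneg hB (wt_nonneg _ _))).trans_eq (by ring)
  have i3 : Integrable fun y => conv ν φ s y • g (-y) :=
    integrable_smul_of_le_wt hPc (hc.comp continuous_neg) (C := C₁ * B) fun y => by
      rw [← pow_mul_wt D (n + 1)]
      refine (mul_le_mul (hPb y) (b1 y) (norm_nonneg _) (by positivity)).trans_eq (by ring)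
  have hG : ∀ y, HasFDerivAt (fun y => g (-y)) (-g' (-y)) y := fun y => by
    have := (hg (-y)).comp y (hasFDerivAt_id y).neg
    rw [ContinuousLinearMap.comp_neg, ContinuousLinearMap.comp_id] at this
    exact this
  ext v
  rw [ContinuousLinearMap.integral_apply i1, ContinuousLinearMap.integral_apply i2]
  have parts := integral_mul_fderiv_eq_neg_fderiv_mul_of_integrable (μ := volume)
    (f := conv ν φ s) (g := fun y => g (-y)) (v := v) ?_ ?_ i3
    (fun y _ => (hP y).differentiableAt) (fun y _ => (hG y).differentiableAt)
  · simp_rw [(hP _).fderiv, (hG _).fderiv] at parts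
    simp only [neg_apply, mul_neg, integral_neg, neg_inj] at parts
    simp only [smul_apply, smul_eq_mul] at parts ⊢
    rw [parts]
    congr 1; ext y; ring
  · refine (i2.apply_continuousLinearMap v).congr (ae_of_all _ fun y => ?_)
    simp only [(hP y).fderiv, smul_apply, smul_eq_mul]
    ring
  · refine (i1.apply_continuousLinearMap v).neg.congr (ae_of_all _ fun y => ?_)
    simp only [(hG y).fderiv, smul_apply, smul_eq_mul,
      neg_apply, Pi.neg_apply, mul_neg]

end Pairing

end

section

/-! ### Pointwise comparison of logarithmic gradients -/

variable {n : ℕ} {ν : Measure (Rn n)} {K : ℝ≥0} [IsLocallyFiniteMeasure ν]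

/-- Telescoping: consecutive remainders of `fderiv ℝ ψ` differ by a smear, and the integral of that
smear against `ν` is, by duality, a pairing with the gradient of `ν ∗ φ_{σ(m)}`. -/
lemma IsDoublingWith.conv_fderiv_eq_sum (h : IsDoublingWith ν K) (φ ψ : 𝓢(Rn n, ℝ))
    {σ : ℕ → ℝ} (hσ : ∀ m, 0 < σ m) (hσ1 : ∀ m, σ m ≤ 1) (J : ℕ) :
    conv ν (fderiv ℝ ψ) 1 0 =
      (∑ m ∈ Finset.range J,
        ∫ y, resid φ σ ψ m (-y) • ((σ m)⁻¹ • conv ν (fderiv ℝ φ) (σ m) y)) +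
      ∫ z, resid φ σ (fderiv ℝ ψ) J (-z) ∂ν := by
  obtain ⟨D, hD⟩ := exists_le_two_pow K
  have h0 : ∀ m, 0 ≤ σ m := fun m => (hσ m).le
  set ψ' := SchwartzMap.fderivCLM ℝ (Rn n) ℝ ψ with hψ'
  obtain ⟨C, hC0, hC⟩ := exists_norm_le_wt ψ (D + (n + 1))
  obtain ⟨C', hC0', hC'⟩ := exists_norm_le_wt ψ' (D + (n + 1))
  have hA := moment_nonneg φ (D + (n + 1))
  have hint : ∀ J, Integrable (fun z => resid φ σ ψ' J (-z)) ν := fun J =>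
    h.integrable_of_le_wt hD (M := D + (n + 1)) (by omega)
      ((continuous_resid φ h0 hσ1 ψ' J).comp continuous_neg)
      (fun x => (norm_resid_le φ h0 hσ1 hC0' hC' J (-x)).trans_eq (by rw [wt_neg]))
  induction J with
  | zero => simp [resid, conv]
  | succ J ih =>
    rw [Finset.sum_range_succ, ih, add_assoc]
    congr 1
    set B := max C C' * (1 + moment φ (D + (n + 1))) ^ J
    have hB : 0 ≤ B := by positivity
    have key := h.integral_smear_fderiv_eq hD φ (hσ J) (hσ1 J)
      (g := resid φ σ ψ J) (g' := resid φ σ ψ' J)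
      (fun x => hasFDerivAt_resid φ h0 hσ1 J ℝ ψ x) (continuous_resid φ h0 hσ1 ψ' J) hB
      (norm_resid_le φ h0 hσ1 (by positivity) (fun x => (hC x).trans
        (mul_le_mul_of_nonneg_right (le_max_left _ _) (wt_nonneg _ _))) J)
      (norm_resid_le φ h0 hσ1 (by positivity) (fun x => (hC' x).trans
        (mul_le_mul_of_nonneg_right (le_max_right _ _) (wt_nonneg _ _))) J)
    rw [← key]
    have e : ∀ z, smear φ (σ J) (resid φ σ ψ' J) (-z) =
        resid φ σ ψ' J (-z) - resid φ σ ψ' (J + 1) (-z) := fun z => by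
      simp only [resid]; abel
    simp_rw [e]
    rw [integral_sub (hint J) (hint (J + 1))]
    change _ = _ - _ + ∫ z, resid φ σ ψ' (J + 1) (-z) ∂ν
    rw [sub_add_cancel]
    rfl

omit [IsLocallyFiniteMeasure ν] in
/-- Pointwise bound of the logarithmic gradient for one kernel by those for another one at smaller
scales, at the unit scale. -/
lemma exists_logGrad_unit_le (K : ℝ≥0) {φ ψ : 𝓢(Rn n, ℝ)} (hφ : IsGood φ) (hψ : IsGood ψ)
    (p L : ℕ) :
    ∃ ε C : ℝ, 0 < ε ∧ ε ≤ 1 / 2 ∧ 0 ≤ C ∧ ∀ (ν : Measure (Rn n)) [IsLocallyFiniteMeasure ν],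
      IsDoublingWith ν K → ∀ t ∈ Icc (1 / 2 : ℝ) 1,
      ENNReal.ofReal (logGrad ν ψ 0 1) ≤ ENNReal.ofReal C * ∑' m : ℕ, ENNReal.ofReal ((ε ^ p) ^ m) *
        ∫⁻ y, ENNReal.ofReal (wt L y) * ENNReal.ofReal (logGrad ν φ y (t * ε ^ m)) := by
  obtain ⟨D, hD⟩ := exists_le_two_pow K
  -- Of the spatial decay, `D` orders pay for the growth of `ν ∗ φ_s` and `L` remain as the weight
  -- in the conclusion; the additional order makes the last remainder integrable against `ν`.
  set M := D + (L + 1) with hM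
  -- Of the decay in `m`, the factor `ε^{nm}` pays for `s^{-n}` at `s = σ(m)`, and `ε^{pm}` remains.
  set q := n + p + 1 with hq
  set A := moment φ (M + 1) with hA
  have hA0 : 0 ≤ A := moment_nonneg _ _
  -- With this choice `(1 + A) ε = 1/2`, so one extra power of `ε` cancels the geometric growth `(1
  -- + A)^m` of the remainders.
  set ε : ℝ := 1 / (2 * (1 + A)) with hε
  have hε0 : 0 < ε := by positivity
  have hε1 : ε ≤ 1 / 2 := by
    rw [hε]
    exact one_div_le_one_div_of_le two_pos (by linarith)
  have hAε : (1 + A) * ε ^ (q + 1) ≤ ε ^ q := by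
    have : (1 + A) * ε = 1 / 2 := by rw [hε]; field_simp
    rw [pow_succ', ← mul_assoc, this]
    linarith [pow_pos hε0 q]
  obtain ⟨C₁, hC₁0, hC₁⟩ := exists_norm_resid_le φ hφ.integral_eq_one hε0 (hε1.trans (by norm_num))
    M (q + 1) ℝ ψ
  obtain ⟨C₂, hC₂0, hC₂⟩ := exists_norm_resid_le φ hφ.integral_eq_one hε0 (hε1.trans (by norm_num))
    M (q + 1) _ (SchwartzMap.fderivCLM ℝ (Rn n) ℝ ψ)
  obtain ⟨C₃, hC₃0, hC₃⟩ := exists_norm_le_wt φ (D + 1)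
  obtain ⟨c, hc0, hc⟩ := hψ.exists_le
  set C₄ := C₁ * (C₃ * 2 ^ (D + 1 + 1) * 2 ^ D * 2 ^ n) with hC₄
  have hC₄0 : 0 ≤ C₄ := by positivity
  refine ⟨ε, c⁻¹ * C₄, hε0, hε1, by positivity, fun ν _ h t ht => ?_⟩
  set T := ν.real (Metric.ball (0 : Rn n) 1) with hT
  have hT0 : 0 < T := h.real_ball_pos 0 one_pos
  set σ : ℕ → ℝ := fun m => t * ε ^ m with hσdef
  have ht0 : 0 < t := lt_of_lt_of_le (by norm_num) ht.1
  have hσ : ∀ m, 0 < σ m := fun m => by positivity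
  have hσε : ∀ m, σ m ≤ ε ^ m := fun m => mul_le_of_le_one_left (by positivity) ht.2
  have hσ1 : ∀ m, σ m ≤ 1 := fun m => (hσε m).trans (pow_le_one₀ hε0.le (hε1.trans (by norm_num)))
  have hres : ∀ m x, ‖resid φ σ ψ m x‖ ≤ C₁ * (ε ^ q) ^ m * wt M x := fun m x =>
    (hC₁ σ (fun m => (hσ m).le) hσε m x).trans (by
      have := wt_nonneg M x
      gcongr)
  have hres' : ∀ m x, ‖resid φ σ (fderiv ℝ ψ) m x‖ ≤ C₂ * (ε ^ q) ^ m * wt M x := fun m x =>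
    (hC₂ σ (fun m => (hσ m).le) hσε m x).trans (by
      have := wt_nonneg M x
      gcongr)
  set S : ℕ → ℝ≥0∞ := fun m => ENNReal.ofReal ((ε ^ p) ^ m) *
        ∫⁻ y, ENNReal.ofReal (wt L y) * ENNReal.ofReal (logGrad ν φ y (t * ε ^ m)) with hS
  have hterm : ∀ m, ‖∫ y, resid φ σ ψ m (-y) • ((σ m)⁻¹ • conv ν (fderiv ℝ φ) (σ m) y)‖ₑ ≤
      ENNReal.ofReal (C₄ * T) * S m := by
    intro m
    refine (enorm_integral_le_lintegral_enorm _).trans ?_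
    rw [hS, ← mul_assoc, ← lintegral_const_mul' _ _
      (ENNReal.mul_ne_top ENNReal.ofReal_ne_top ENNReal.ofReal_ne_top)]
    refine lintegral_mono fun y => ?_
    rw [← ENNReal.ofReal_mul (by positivity), ← ENNReal.ofReal_mul (wt_nonneg _ _),
      ← ENNReal.ofReal_mul (by positivity), ← ofReal_norm]
    apply ENNReal.ofReal_le_ofReal
    have hpos := hφ.conv_pos h (hσ m) y
    -- The gradient is the function times its logarithmic gradient; doubling then bounds the
    -- function by the mass of the unit ball.
    have e1 : (σ m)⁻¹ * ‖conv ν (fderiv ℝ φ) (σ m) y‖ = conv ν φ (σ m) y * logGrad ν φ y (σ m) := by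
      unfold logGrad
      field_simp
    have hlg : 0 ≤ logGrad ν φ y (σ m) := by
      rw [← hφ.norm_fderiv_log h (hσ m)]; exact norm_nonneg _
    have h2 : conv ν φ (σ m) y ≤ C₃ * 2 ^ (D + 1 + 1) * 2 ^ D * (2 ^ n * (ε ^ n)⁻¹ ^ m) * T *
        (1 + ‖y‖) ^ D := by
      refine (le_abs_self _).trans ((h.norm_conv_le_of_le_one hD hC₃0 hC₃ (hσ m) (hσ1 m) y).trans ?_)
      have : ((σ m) ^ n)⁻¹ ≤ 2 ^ n * (ε ^ n)⁻¹ ^ m := by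
        rw [hσdef, mul_pow, mul_inv, ← pow_mul, mul_comm m n, pow_mul, inv_pow]
        gcongr
        rw [← inv_pow]
        refine pow_le_pow_left₀ (by positivity) ?_ _
        rw [inv_le_comm₀ ht0 two_pos]
        linarith [ht.1]
      gcongr
    rw [norm_smul, norm_smul, norm_inv, Real.norm_of_nonneg (hσ m).le, e1]
    have h3 := hres m (-y)
    rw [wt_neg] at h3
    have e2 : (ε ^ q) ^ m * (ε ^ n)⁻¹ ^ m = (ε ^ (p + 1)) ^ m := by
      rw [← mul_pow]
      congr 1
      rw [hq, add_assoc, pow_add]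
      field_simp
    have e3 : wt M y * (1 + ‖y‖) ^ D = wt (L + 1) y := by
      rw [mul_comm, hM, pow_mul_wt]
    calc _ ≤ (C₁ * (ε ^ q) ^ m * wt M y) * ((C₃ * 2 ^ (D + 1 + 1) * 2 ^ D *
            (2 ^ n * (ε ^ n)⁻¹ ^ m) * T * (1 + ‖y‖) ^ D) * logGrad ν φ y (σ m)) := by
          have := wt_nonneg M y
          gcongr
      _ = C₄ * T * (((ε ^ q) ^ m * (ε ^ n)⁻¹ ^ m) * (wt M y * (1 + ‖y‖) ^ D) *
            logGrad ν φ y (σ m)) := by rw [hC₄]; ring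
      _ ≤ C₄ * T * ((ε ^ p) ^ m * wt L y * logGrad ν φ y (σ m)) := by
          rw [e2, e3]
          have w1 := wt_antitone (Nat.le_succ L) y
          have w2 := wt_nonneg (L + 1) y
          have h4 : ε ^ (p + 1) ≤ ε ^ p := pow_le_pow_of_le_one hε0.le (by linarith) (Nat.le_succ p)
          gcongr
      _ = _ := by ring
  have hJ : ∀ J : ℕ, ENNReal.ofReal ‖conv ν (fderiv ℝ ψ) 1 0‖ ≤
      ENNReal.ofReal (C₄ * T) * ∑' m, S m + ENNReal.ofReal (C₂ * (ε ^ q) ^ J * 2 ^ (M + 1) * T) := by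
    intro J
    rw [h.conv_fderiv_eq_sum φ ψ hσ hσ1 J, ofReal_norm]
    refine (enorm_add_le (E := Rn n →L[ℝ] ℝ) _ _).trans (add_le_add ?_ ?_)
    · refine (enorm_sum_le (ε := Rn n →L[ℝ] ℝ) _ _).trans ?_
      refine (Finset.sum_le_sum fun m _ => hterm m).trans ?_
      rw [← Finset.mul_sum]
      gcongr
      exact ENNReal.sum_le_tsum _
    · rw [← ofReal_norm]
      apply ENNReal.ofReal_le_ofReal
      refine h.norm_integral_le_of_le_wt hD (M := M) (by omega) (by positivity) fun x => ?_
      simpa [wt_neg] using hres' J (-x)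
  -- The remainder is of size `(ε^q)^J` and disappears as `J → ∞`.
  have hlim : ENNReal.ofReal ‖conv ν (fderiv ℝ ψ) 1 0‖ ≤ ENNReal.ofReal (C₄ * T) * ∑' m, S m := by
    have h1 : Filter.Tendsto (fun J : ℕ => ENNReal.ofReal (C₄ * T) * ∑' m, S m +
        ENNReal.ofReal (C₂ * (ε ^ q) ^ J * 2 ^ (M + 1) * T)) Filter.atTop
        (nhds (ENNReal.ofReal (C₄ * T) * ∑' m, S m + ENNReal.ofReal (C₂ * 0 * 2 ^ (M + 1) * T))) := by
      refine tendsto_const_nhds.add (ENNReal.tendsto_ofReal ?_)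
      refine ((tendsto_const_nhds.mul (tendsto_pow_atTop_nhds_zero_of_lt_one (by positivity) ?_)).mul
        tendsto_const_nhds).mul tendsto_const_nhds
      exact pow_lt_one₀ hε0.le (by linarith) (by omega)
    have h2 := ge_of_tendsto' h1 hJ
    simpa using h2
  have hcT : c * T ≤ conv ν ψ 1 0 := by
    have := h.le_conv hψ.nonneg hc one_pos 0
    simpa using this
  calc ENNReal.ofReal (logGrad ν ψ 0 1)
      ≤ ENNReal.ofReal ((c * T)⁻¹ * ‖conv ν (fderiv ℝ ψ) 1 0‖) := by
        apply ENNReal.ofReal_le_ofReal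
        rw [logGrad, inv_one, one_mul]
        gcongr
    _ = ENNReal.ofReal (c * T)⁻¹ * ENNReal.ofReal ‖conv ν (fderiv ℝ ψ) 1 0‖ :=
        ENNReal.ofReal_mul (by positivity)
    _ ≤ ENNReal.ofReal (c * T)⁻¹ * (ENNReal.ofReal (C₄ * T) * ∑' m, S m) := by gcongr
    _ = _ := by
        rw [← mul_assoc, ← ENNReal.ofReal_mul (by positivity)]
        congr 2
        field_simp

omit [IsLocallyFiniteMeasure ν] in
lemma logGrad_nonneg {ψ : 𝓢(Rn n, ℝ)} (hψ : IsGood ψ) [IsLocallyFiniteMeasure ν]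
    (h : IsDoublingWith ν K) {s : ℝ} (hs : 0 < s) (x : Rn n) : 0 ≤ logGrad ν ψ x s := by
  rw [← hψ.norm_fderiv_log h hs]; exact norm_nonneg _

/-- Cauchy–Schwarz for a finite measure with density. -/
lemma sq_lintegral_mul_le {α : Type*} [MeasurableSpace α] (μ : Measure α) {a f : α → ℝ≥0∞}
    (ha : AEMeasurable a μ) (hf : AEMeasurable f μ) :
    (∫⁻ x, a x * f x ∂μ) ^ 2 ≤ (∫⁻ x, a x ∂μ) * ∫⁻ x, a x * f x ^ 2 ∂μ := by
  have hp : (2 : ℝ).HolderConjugate 2 := Real.HolderConjugate.two_two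
  have key := ENNReal.lintegral_mul_le_Lp_mul_Lq μ hp (f := fun x => a x ^ (1 / 2 : ℝ))
    (g := fun x => a x ^ (1 / 2 : ℝ) * f x) (ha.pow_const _) ((ha.pow_const _).mul hf)
  have e1 : ∀ x, a x ^ (1 / 2 : ℝ) * a x ^ (1 / 2 : ℝ) = a x := fun x => by
    rw [← ENNReal.rpow_add_of_nonneg _ _ (by norm_num) (by norm_num)]; norm_num
  have e2 : ∀ x, (a x ^ (1 / 2 : ℝ)) ^ (2 : ℝ) = a x := fun x => by
    rw [← ENNReal.rpow_mul]; norm_num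
  simp only [Pi.mul_apply, ← mul_assoc, e1, e2, ENNReal.mul_rpow_of_nonneg _ _ zero_le_two,
    ENNReal.rpow_two] at key
  calc _ ≤ ((∫⁻ x, a x ∂μ) ^ (1 / 2 : ℝ) * (∫⁻ x, a x * f x ^ 2 ∂μ) ^ (1 / 2 : ℝ)) ^ 2 := by
        gcongr
    _ = _ := by
        rw [mul_pow, ← ENNReal.rpow_two, ← ENNReal.rpow_two, ← ENNReal.rpow_mul,
          ← ENNReal.rpow_mul]
        norm_num

lemma sq_tsum_mul_le (a b : ℕ → ℝ≥0∞) :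
    (∑' m, a m * b m) ^ 2 ≤ (∑' m, a m) * ∑' m, a m * b m ^ 2 := by
  have := sq_lintegral_mul_le (Measure.count : Measure ℕ) (a := a) (f := b)
    (measurable_of_countable _).aemeasurable (measurable_of_countable _).aemeasurable
  simpa only [lintegral_count] using this

lemma tsum_ofReal_pow_le {a : ℝ} (h0 : 0 ≤ a) (h1 : a ≤ 1 / 2) :
    ∑' m : ℕ, ENNReal.ofReal (a ^ m) ≤ 2 := by
  calc _ ≤ ∑' m : ℕ, (2⁻¹ : ℝ≥0∞) ^ m := by
        refine ENNReal.tsum_le_tsum fun m => ?_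
        rw [ENNReal.ofReal_pow h0]
        refine pow_le_pow_left' ?_ _
        rw [← ENNReal.ofReal_ofNat, ← ENNReal.ofReal_inv_of_pos two_pos]
        exact ENNReal.ofReal_le_ofReal (by linarith)
    _ = 2 := by rw [ENNReal.tsum_geometric, ENNReal.one_sub_inv_two, inv_inv]

lemma lintegral_wt_ne_top {L : ℕ} (hL : n + 1 ≤ L) :
    ∫⁻ y : Rn n, ENNReal.ofReal (wt L y) ≠ ⊤ := by
  have := isDoublingWith_volume.lintegral_wt_le (n := n) (D := n) (M := L) (by simp) hL
  exact (this.trans_lt (ENNReal.mul_lt_top (by simp) measure_ball_lt_top)).ne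

lemma measurable_logGrad_affine (ν : Measure (Rn n)) [SFinite ν] (f : 𝓢(Rn n, ℝ)) (x : Rn n)
    (r s : ℝ) : Measurable fun y : Rn n => ENNReal.ofReal (logGrad ν f (x + r • y) s) := by
  refine ((measurable_logGrad ν f).comp (g := fun p : Rn n × ℝ => logGrad ν f p.1 p.2)
    (f := fun y : Rn n => (x + r • y, s)) ?_).ennreal_ofReal
  fun_prop

/-- Pointwise bound of the square of the logarithmic gradient for one kernel by averages of those
for another one at smaller scales. -/
lemma exists_logGrad_sq_le (K : ℝ≥0) {φ ψ : 𝓢(Rn n, ℝ)} (hφ : IsGood φ) (hψ : IsGood ψ)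
    {L : ℕ} (hL : n + 1 ≤ L) :
    ∃ (ε : ℝ) (C : ℝ≥0∞), 0 < ε ∧ ε ≤ 1 / 2 ∧ C ≠ ⊤ ∧
      ∀ (ν : Measure (Rn n)) [IsLocallyFiniteMeasure ν],
      IsDoublingWith ν K → ∀ (x : Rn n) (r : ℝ), 0 < r → ∀ t ∈ Icc (1 / 2 : ℝ) 1,
      ENNReal.ofReal (logGrad ν ψ x r) ^ 2 ≤ C * ∑' m : ℕ, ENNReal.ofReal ((ε ^ 3) ^ m) *
        ∫⁻ y, ENNReal.ofReal (wt L y) *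
          ENNReal.ofReal (logGrad ν φ (x + r • y) (r * (t * ε ^ m))) ^ 2 := by
  -- The exponent `3` is chosen for later use: changing the scale `s` to `ε^m s` in a Carleson
  -- integral costs `ε^{-2m}`, which leaves a summable `ε^m`.
  obtain ⟨ε, C, hε0, hε1, hC0, hC⟩ := exists_logGrad_unit_le K hφ hψ 3 L
  set I := ∫⁻ y : Rn n, ENNReal.ofReal (wt L y) with hI
  refine ⟨ε, ENNReal.ofReal C ^ 2 * (2 * I), hε0, hε1,
    ENNReal.mul_ne_top (by simp) (ENNReal.mul_ne_top (by simp) (lintegral_wt_ne_top hL)),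
    fun ν _ h x r hr t ht => ?_⟩
  have := isLocallyFiniteMeasure_rescale ν hr x
  have h1 := hC (rescale ν r x) (h.rescale_measure hr x) t ht
  simp_rw [logGrad_rescale ν _ hr, ENNReal.ofReal_mul hr.le, smul_zero, add_zero, mul_one] at h1
  set ρ := ENNReal.ofReal r
  have hρ0 : ρ ≠ 0 := by simpa [ρ] using hr
  have hρt : ρ ≠ ⊤ := ENNReal.ofReal_ne_top
  set V : ℕ → Rn n → ℝ≥0∞ := fun m y =>
    ENNReal.ofReal (logGrad ν φ (x + r • y) (r * (t * ε ^ m))) with hV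
  have hVm : ∀ m, Measurable (V m) := fun m => measurable_logGrad_affine ν φ x r _
  set a : ℕ → ℝ≥0∞ := fun m => ENNReal.ofReal ((ε ^ 3) ^ m) with ha
  have h2 : ENNReal.ofReal (logGrad ν ψ x r) ≤
      ENNReal.ofReal C * ∑' m, a m * ∫⁻ y, ENNReal.ofReal (wt L y) * V m y := by
    have e : ENNReal.ofReal C * ∑' m, a m * ∫⁻ y, ENNReal.ofReal (wt L y) * (ρ * V m y) =
        ρ * (ENNReal.ofReal C * ∑' m, a m * ∫⁻ y, ENNReal.ofReal (wt L y) * V m y) := by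
      simp_rw [mul_left_comm _ ρ, lintegral_const_mul' ρ _ hρt, mul_left_comm _ ρ,
        ENNReal.tsum_mul_left, mul_left_comm _ ρ]
    change ρ * _ ≤ ENNReal.ofReal C * ∑' m, a m * ∫⁻ y, ENNReal.ofReal (wt L y) * (ρ * V m y) at h1
    rw [e] at h1
    exact (ENNReal.mul_le_mul_iff_right hρ0 hρt).1 h1
  calc ENNReal.ofReal (logGrad ν ψ x r) ^ 2
      ≤ (ENNReal.ofReal C * ∑' m, a m * ∫⁻ y, ENNReal.ofReal (wt L y) * V m y) ^ 2 := by gcongr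
    _ = ENNReal.ofReal C ^ 2 * (∑' m, a m * ∫⁻ y, ENNReal.ofReal (wt L y) * V m y) ^ 2 := mul_pow ..
    _ ≤ ENNReal.ofReal C ^ 2 * (2 * ∑' m, a m * (I * ∫⁻ y, ENNReal.ofReal (wt L y) * V m y ^ 2)) := by
        gcongr
        refine (sq_tsum_mul_le _ _).trans ?_
        gcongr with m
        · refine tsum_ofReal_pow_le (by positivity) ?_
          calc ε ^ 3 ≤ (1 / 2) ^ 3 := by gcongr
            _ ≤ 1 / 2 := by norm_num
        · exact sq_lintegral_mul_le _ (continuous_wt L).measurable.ennreal_ofReal.aemeasurable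
            (hVm m).aemeasurable
    _ = _ := by
        simp_rw [mul_left_comm _ I, ENNReal.tsum_mul_left]
        ring

end

section

/-! ### Comparison of Carleson norms -/

variable {n : ℕ}

/-- The mass of the Carleson box over `Δ(x,R)`. -/
def boxMass (ν : Measure (Rn n)) (f : Rn n → ℝ) (x : Rn n) (R : ℝ) : ℝ≥0∞ :=
  ∫⁻ s in Ioo 0 R, ∫⁻ y in Metric.ball x R,
    ENNReal.ofReal (logGrad ν f y s) ^ 2 * ENNReal.ofReal s

lemma logGradMeasure_box {w : Rn n → ℝ} (hw : IsWeight w) [IsLocallyFiniteMeasure (weightMeasure w)]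
    {K : ℝ≥0} (h : IsDoublingWith (weightMeasure w) K) {f : 𝓢(Rn n, ℝ)} (hf : IsGood f)
    (x : Rn n) (R : ℝ) :
    logGradMeasure w f (Metric.ball x R ×ˢ Ioo 0 R) = boxMass (weightMeasure w) f x R := by
  have hm : Measurable fun p : Rn n × ℝ =>
      ENNReal.ofReal (logGrad (weightMeasure w) f p.1 p.2) ^ 2 * ENNReal.ofReal p.2 :=
    ((measurable_logGrad _ f).ennreal_ofReal.pow_const 2).mul measurable_snd.ennreal_ofReal
  have hms : MeasurableSet (Metric.ball x R ×ˢ Ioo 0 R) := measurableSet_ball.prod measurableSet_Ioo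
  have hsub : Ioo 0 R ∩ Ioi (0 : ℝ) = Ioo 0 R := inter_eq_left.2 fun s hs => hs.1
  rw [logGradMeasure, withDensity_apply _ hms, boxMass]
  have e : ∫⁻ p in Metric.ball x R ×ˢ Ioo 0 R, ENNReal.ofReal
      (‖gradient (fun z => Real.log (convDilate w f p.2 z)) p.1‖ ^ 2 * p.2)
        ∂((volume : Measure (Rn n)).prod (volume.restrict (Ioi (0 : ℝ)))) =
      ∫⁻ p in Metric.ball x R ×ˢ Ioo 0 R,
        ENNReal.ofReal (logGrad (weightMeasure w) f p.1 p.2) ^ 2 * ENNReal.ofReal p.2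
        ∂((volume : Measure (Rn n)).prod (volume.restrict (Ioi (0 : ℝ)))) := by
    refine setLIntegral_congr_fun hms fun p hp => ?_
    have hs : 0 < p.2 := hp.2.1
    simp_rw [convDilate_eq_conv hw]
    rw [hf.norm_gradient_log h hs, ENNReal.ofReal_mul (by positivity),
      ENNReal.ofReal_pow (logGrad_nonneg hf h hs _)]
  rw [e, ← Measure.prod_restrict, Measure.restrict_restrict measurableSet_Ioo, hsub,
    lintegral_prod_symm' _ hm]

lemma carlesonNorm_logGradMeasure {w : Rn n → ℝ} (hw : IsWeight w)
    [IsLocallyFiniteMeasure (weightMeasure w)]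
    {K : ℝ≥0} (h : IsDoublingWith (weightMeasure w) K) {f : 𝓢(Rn n, ℝ)} (hf : IsGood f) :
    carlesonNorm (logGradMeasure w f) = ⨆ (x : Rn n) (R : ℝ) (_ : 0 < R),
      boxMass (weightMeasure w) f x R / volume (Metric.ball x R) := by
  simp_rw [carlesonNorm, logGradMeasure_box hw h hf]

lemma setLIntegral_comp_mul_left {H : ℝ → ℝ≥0∞} (hH : Measurable H) {c : ℝ} (hc : 0 < c) (a b : ℝ) :
    ∫⁻ s in Ioo a b, H (c * s) = ENNReal.ofReal c⁻¹ * ∫⁻ s in Ioo (c * a) (c * b), H s := by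
  have h1 : ENNReal.ofReal c⁻¹ • (volume : Measure ℝ) = volume.map (c * ·) := by
    rw [Real.map_volume_mul_left hc.ne', abs_of_pos (inv_pos.2 hc)]
  have hpre : Ioo a b = (c * ·) ⁻¹' Ioo (c * a) (c * b) := by
    ext s
    simp only [mem_Ioo, mem_preimage, mul_lt_mul_iff_right₀ hc]
  rw [hpre, ← setLIntegral_map measurableSet_Ioo hH (measurable_const_mul c), ← h1,
    Measure.restrict_smul, lintegral_smul_measure, smul_eq_mul]

/-- A translation by `s y` with `s ≤ R` stays in the box if the radius is enlarged by the factor `1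
+ ‖y‖`. -/
lemma setLIntegral_ball_add_smul_le (H : Rn n → ℝ≥0∞) (x y : Rn n) {s R : ℝ}
    (hs : 0 ≤ s) (hsR : s ≤ R) :
    ∫⁻ z in Metric.ball x R, H (z + s • y) ≤ ∫⁻ z in Metric.ball x ((1 + ‖y‖) * R), H z := by
  rw [← lintegral_indicator measurableSet_ball, ← lintegral_indicator measurableSet_ball,
    ← lintegral_add_right_eq_self ((Metric.ball x ((1 + ‖y‖) * R)).indicator H) (s • y)]
  refine lintegral_mono fun z => ?_
  by_cases hz : z ∈ Metric.ball x R
  · have hz' : z + s • y ∈ Metric.ball x ((1 + ‖y‖) * R) := by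
      rw [Metric.mem_ball, dist_eq_norm] at hz ⊢
      calc ‖z + s • y - x‖ = ‖(z - x) + s • y‖ := by congr 1; abel
        _ ≤ ‖z - x‖ + s * ‖y‖ := by
          refine (norm_add_le _ _).trans_eq ?_
          rw [norm_smul, Real.norm_of_nonneg hs]
        _ < (1 + ‖y‖) * R := by nlinarith [norm_nonneg y]
    rw [indicator_of_mem hz, indicator_of_mem hz']
  · rw [indicator_of_notMem hz]; exact bot_le

lemma boxMass_eq (ν : Measure (Rn n)) (f : Rn n → ℝ) (x : Rn n) (R : ℝ) :
    boxMass ν f x R = ∫⁻ s in Ioo 0 R,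
      (∫⁻ y in Metric.ball x R, ENNReal.ofReal (logGrad ν f y s) ^ 2) * ENNReal.ofReal s := by
  unfold boxMass
  congr 1; ext s
  rw [lintegral_mul_const' _ _ ENNReal.ofReal_ne_top]

section Box

variable (ν : Measure (Rn n)) [SFinite ν] (f : 𝓢(Rn n, ℝ))

lemma measurable_sq_logGrad : Measurable fun p : Rn n × ℝ =>
    ENNReal.ofReal (logGrad ν f p.1 p.2) ^ 2 :=
  (measurable_logGrad ν f).ennreal_ofReal.pow_const 2

/-- Integrals over dilated scales are controlled by the box. -/
lemma lintegral_scaled_le_boxMass (x : Rn n) {c : ℝ} (hc : 0 < c) {R R' : ℝ} (hR : c * R ≤ R') :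
    ∫⁻ s in Ioo 0 R, (∫⁻ y in Metric.ball x R', ENNReal.ofReal (logGrad ν f y (c * s)) ^ 2) *
      ENNReal.ofReal s ≤ ENNReal.ofReal (c ^ 2)⁻¹ * boxMass ν f x R' := by
  set Φ : ℝ → ℝ≥0∞ := fun s =>
    (∫⁻ y in Metric.ball x R', ENNReal.ofReal (logGrad ν f y s) ^ 2) * ENNReal.ofReal s
  have hΦ : Measurable Φ :=
    ((measurable_sq_logGrad ν f).lintegral_prod_left').mul measurable_id.ennreal_ofReal
  calc _ = ∫⁻ s in Ioo 0 R, ENNReal.ofReal c⁻¹ * Φ (c * s) := by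
        congr 1; ext s
        simp only [Φ]
        rw [ENNReal.ofReal_mul hc.le, mul_left_comm _ (ENNReal.ofReal c), ← mul_assoc,
          ← ENNReal.ofReal_mul (by positivity), inv_mul_cancel₀ hc.ne', ENNReal.ofReal_one, one_mul]
    _ = ENNReal.ofReal (c ^ 2)⁻¹ * ∫⁻ s in Ioo (c * 0) (c * R), Φ s := by
        rw [lintegral_const_mul' _ _ ENNReal.ofReal_ne_top, setLIntegral_comp_mul_left hΦ hc,
          ← mul_assoc, ← ENNReal.ofReal_mul (by positivity), sq, mul_inv]
    _ ≤ _ := by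
        rw [boxMass_eq, mul_zero]
        gcongr

end Box

/-- The supremum of normalized box masses. -/
def boxNorm (ν : Measure (Rn n)) (f : Rn n → ℝ) : ℝ≥0∞ :=
  ⨆ (x : Rn n) (R : ℝ) (_ : 0 < R), boxMass ν f x R / volume (Metric.ball x R)

lemma boxMass_le_boxNorm (ν : Measure (Rn n)) (f : Rn n → ℝ) (x : Rn n) {R : ℝ} (hR : 0 < R) :
    boxMass ν f x R ≤ boxNorm ν f * volume (Metric.ball x R) := by
  rw [← ENNReal.div_le_iff (Metric.measure_ball_pos _ _ hR).ne' measure_ball_lt_top.ne]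
  exact le_iSup₂_of_le x R (le_iSup_of_le hR le_rfl)

/-- The enlarged ball has volume larger by `(1 + ‖y‖) ^ n`, which the first `n` orders of decay
absorb. -/
lemma lintegral_wt_mul_boxMass_le (ν : Measure (Rn n)) (f : Rn n → ℝ) (x : Rn n) {R : ℝ}
    (hR : 0 < R) {L : ℕ} :
    ∫⁻ y : Rn n, ENNReal.ofReal (wt (n + L) y) * boxMass ν f x ((1 + ‖y‖) * R) ≤
      (∫⁻ y : Rn n, ENNReal.ofReal (wt L y)) * (boxNorm ν f * volume (Metric.ball x R)) := by
  rw [← lintegral_mul_const _ (continuous_wt _).measurable.ennreal_ofReal]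
  refine lintegral_mono fun y => ?_
  have h1 : 0 < 1 + ‖y‖ := by positivity
  calc _ ≤ ENNReal.ofReal (wt (n + L) y) * (boxNorm ν f * volume (Metric.ball x ((1 + ‖y‖) * R))) := by
        gcongr
        exact boxMass_le_boxNorm ν f x (by positivity)
    _ = ENNReal.ofReal ((1 + ‖y‖) ^ n * wt (n + L) y) * (boxNorm ν f * volume (Metric.ball x R)) := by
        rw [volume_ball_scale x h1, ENNReal.ofReal_mul (by positivity)]
        ring
    _ = _ := by rw [pow_mul_wt]

lemma lintegral_const_mul_tsum_swap {H : ℕ → ℝ → Rn n → Rn n → ℝ≥0∞}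
    (hm : ∀ m, Measurable fun q : (ℝ × Rn n) × Rn n => H m q.1.1 q.1.2 q.2) {C : ℝ≥0∞}
    (hC : C ≠ ⊤) (a : ℕ → ℝ≥0∞) (S : Set ℝ) (B : Set (Rn n)) :
    ∫⁻ s in S, ∫⁻ z in B, C * ∑' m, a m * ∫⁻ y, H m s z y =
      C * ∑' m, a m * ∫⁻ y, ∫⁻ s in S, ∫⁻ z in B, H m s z y := by
  have hm' : ∀ m, Measurable fun q : ℝ × Rn n => ∫⁻ y, H m q.1 q.2 y := fun m =>
    (hm m).lintegral_prod_right'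
  have hmz : ∀ m s, Measurable fun z : Rn n => ∫⁻ y, H m s z y := fun m s =>
    (hm' m).comp (measurable_const.prodMk measurable_id)
  have hms : ∀ m, Measurable fun s : ℝ => ∫⁻ z in B, ∫⁻ y, H m s z y := fun m =>
    (hm' m).lintegral_prod_right'
  have h3 : ∀ m, ∫⁻ s in S, ∫⁻ z in B, ∫⁻ y, H m s z y =
      ∫⁻ y, ∫⁻ s in S, ∫⁻ z in B, H m s z y := by
    intro m
    have e : ∀ s, ∫⁻ z in B, ∫⁻ y, H m s z y = ∫⁻ y, ∫⁻ z in B, H m s z y := fun s =>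
      lintegral_lintegral_swap ((hm m).comp (f := fun q : Rn n × Rn n => ((s, q.1), q.2))
        (by fun_prop)).aemeasurable
    simp_rw [e]
    refine lintegral_lintegral_swap (Measurable.aemeasurable ?_)
    have := (hm m).comp (f := fun q : (ℝ × Rn n) × Rn n => ((q.1.1, q.2), q.1.2)) (by fun_prop)
    exact this.lintegral_prod_right'
  have e1 : ∀ s, ∫⁻ z in B, C * ∑' m, a m * ∫⁻ y, H m s z y =
      C * ∑' m, a m * ∫⁻ z in B, ∫⁻ y, H m s z y := fun s => by
    rw [lintegral_const_mul' _ _ hC,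
      lintegral_tsum fun m => ((hmz m s).const_mul _).aemeasurable]
    congr 2; ext m
    rw [lintegral_const_mul _ (hmz m s)]
  simp_rw [e1]
  rw [lintegral_const_mul' _ _ hC,
    lintegral_tsum fun m => ((hms m).const_mul _).aemeasurable]
  congr 2; ext m
  rw [lintegral_const_mul _ (hms m), h3]

/-- The squared pointwise bound is integrated over a Carleson box. For fixed `y` and `m`, the
translate by `s y` and the scale `ε^m s` both lie in the box of radius `(1 + ‖y‖) R`; the losses `(1
+ ‖y‖)^n` and `ε^{-2m}` are outweighed by the decay. -/
theorem exists_boxNorm_le (K : ℝ≥0) {φ ψ : 𝓢(Rn n, ℝ)} (hφ : IsGood φ) (hψ : IsGood ψ) :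
    ∃ C : ℝ≥0∞, C ≠ ⊤ ∧ ∀ (ν : Measure (Rn n)) [IsLocallyFiniteMeasure ν],
      IsDoublingWith ν K → boxNorm ν ψ ≤ C * boxNorm ν φ := by
  obtain ⟨ε, C, hε0, hε1, hCt, hC⟩ := exists_logGrad_sq_le K hφ hψ (L := n + (n + 1)) (by omega)
  set L := n + (n + 1)
  set I := ∫⁻ y : Rn n, ENNReal.ofReal (wt (n + 1) y) with hI
  refine ⟨C * (2 * I), ENNReal.mul_ne_top hCt (ENNReal.mul_ne_top (by simp)
    (lintegral_wt_ne_top le_rfl)), fun ν _ h => ?_⟩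
  refine iSup₂_le fun x R => iSup_le fun hR => ?_
  rw [ENNReal.div_le_iff (Metric.measure_ball_pos _ _ hR).ne' measure_ball_lt_top.ne]
  set a : ℕ → ℝ≥0∞ := fun m => ENNReal.ofReal ((ε ^ 3) ^ m) with ha
  have hm : ∀ m, Measurable fun q : (ℝ × Rn n) × Rn n => ENNReal.ofReal (wt L q.2) *
      (ENNReal.ofReal (logGrad ν φ (q.1.2 + q.1.1 • q.2) (ε ^ m * q.1.1)) ^ 2 *
        ENNReal.ofReal q.1.1) := fun m => by
    refine Measurable.mul ((continuous_wt L).measurable.comp measurable_snd).ennreal_ofReal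
      (Measurable.mul ?_ measurable_fst.fst.ennreal_ofReal)
    refine (measurable_sq_logGrad ν φ).comp (f := fun q : (ℝ × Rn n) × Rn n =>
      (q.1.2 + q.1.1 • q.2, ε ^ m * q.1.1)) ?_
    fun_prop
  set H : ℕ → ℝ → Rn n → Rn n → ℝ≥0∞ := fun m s z y => ENNReal.ofReal (wt L y) *
      (ENNReal.ofReal (logGrad ν φ (z + s • y) (ε ^ m * s)) ^ 2 * ENNReal.ofReal s) with hH
  have h1 : boxMass ν ψ x R ≤ ∫⁻ s in Ioo 0 R, ∫⁻ z in Metric.ball x R,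
      C * ∑' m, a m * ∫⁻ y, H m s z y := by
    refine setLIntegral_mono' measurableSet_Ioo fun s hs => lintegral_mono fun z => ?_
    -- The integral over `s` already averages over scales, so the free parameter `t` is set to one.
    have h2 := hC ν h z s hs.1 1 ⟨by norm_num, le_rfl⟩
    refine (mul_le_mul_left h2 (ENNReal.ofReal s)).trans_eq ?_
    rw [mul_assoc, ← ENNReal.tsum_mul_right]
    congr 2; ext m
    rw [mul_assoc, ← lintegral_mul_const' _ _ ENNReal.ofReal_ne_top]
    congr 2; ext y
    rw [hH, mul_assoc, one_mul, mul_comm s]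
  have h4 : ∀ m, ∫⁻ y, ∫⁻ s in Ioo 0 R, ∫⁻ z in Metric.ball x R, H m s z y ≤
      ENNReal.ofReal ((ε ^ m) ^ 2)⁻¹ * (I * (boxNorm ν φ * volume (Metric.ball x R))) := by
    intro m
    refine le_trans ?_ (mul_le_mul_right (lintegral_wt_mul_boxMass_le ν φ x hR) _)
    rw [← lintegral_const_mul' _ _ ENNReal.ofReal_ne_top]
    refine lintegral_mono fun y => ?_
    have hy : 1 ≤ 1 + ‖y‖ := by linarith [norm_nonneg y]
    have hεm : ε ^ m ≤ 1 := pow_le_one₀ hε0.le (by linarith)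
    calc _ = ENNReal.ofReal (wt L y) * ∫⁻ s in Ioo 0 R, (∫⁻ z in Metric.ball x R,
          ENNReal.ofReal (logGrad ν φ (z + s • y) (ε ^ m * s)) ^ 2) * ENNReal.ofReal s := by
          rw [← lintegral_const_mul' _ _ ENNReal.ofReal_ne_top]
          congr 1; ext s
          rw [hH, lintegral_const_mul' _ _ ENNReal.ofReal_ne_top,
            lintegral_mul_const' _ _ ENNReal.ofReal_ne_top]
      _ ≤ ENNReal.ofReal (wt L y) * ∫⁻ s in Ioo 0 R, (∫⁻ z in Metric.ball x ((1 + ‖y‖) * R),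
          ENNReal.ofReal (logGrad ν φ z (ε ^ m * s)) ^ 2) * ENNReal.ofReal s := by
          refine mul_le_mul_right (setLIntegral_mono' measurableSet_Ioo fun s hs => ?_) _
          exact mul_le_mul_left (setLIntegral_ball_add_smul_le
            (fun z => ENNReal.ofReal (logGrad ν φ z (ε ^ m * s)) ^ 2) x y hs.1.le hs.2.le) _
      _ ≤ ENNReal.ofReal (wt L y) *
          (ENNReal.ofReal ((ε ^ m) ^ 2)⁻¹ * boxMass ν φ x ((1 + ‖y‖) * R)) := by
          gcongr
          exact lintegral_scaled_le_boxMass ν φ x (by positivity)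
            (by nlinarith [mul_le_mul hεm hy zero_le_one zero_le_one])
      _ = _ := by ring
  calc boxMass ν ψ x R ≤ _ := h1
    _ = C * ∑' m, a m * ∫⁻ y, ∫⁻ s in Ioo 0 R, ∫⁻ z in Metric.ball x R, H m s z y :=
        lintegral_const_mul_tsum_swap hm hCt a _ _
    _ ≤ C * ∑' m, a m * (ENNReal.ofReal ((ε ^ m) ^ 2)⁻¹ *
          (I * (boxNorm ν φ * volume (Metric.ball x R)))) := by
        gcongr with m
        exact h4 m
    _ = C * ((∑' m, ENNReal.ofReal (ε ^ m)) * (I * (boxNorm ν φ * volume (Metric.ball x R)))) := by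
        rw [← ENNReal.tsum_mul_right]
        congr 2; ext m
        rw [← mul_assoc, ha, ← ENNReal.ofReal_mul (by positivity)]
        congr 2
        have : ε ^ m ≠ 0 := by positivity
        rw [← pow_mul, mul_comm 3 m, pow_mul]
        field_simp
    _ ≤ C * (2 * (I * (boxNorm ν φ * volume (Metric.ball x R)))) := by
        gcongr
        exact tsum_ofReal_pow_le hε0.le hε1
    _ = _ := by ring

end

section

/-! ### The Gaussian and the reference bump as kernels -/

variable {n : ℕ}

lemma isLocallyFiniteMeasure_weightMeasure {w : Rn n → ℝ} (hw : IsWeight w) :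
    IsLocallyFiniteMeasure (weightMeasure w) := by
  refine ⟨fun x => ?_⟩
  obtain ⟨s, hs, hi⟩ := hw.locallyIntegrable x
  refine ⟨s, hs, ?_⟩
  rw [weightMeasure, withDensity_apply']
  exact hi.lintegral_lt_top

/-- The lower bound on the unit ball is `φ 0` itself, since a vanishing gradient makes `φ` constant
there. It is positive: `φ 0` is the maximum of `φ`, whose integral is one. -/
lemma exists_schwartz_bump {φ : Rn n → ℝ} (hφ : IsReferenceBump φ) :
    ∃ f : 𝓢(Rn n, ℝ), (⇑f = φ) ∧ IsGood f := by
  refine ⟨hφ.hasCompactSupport.toSchwartzMap hφ.smooth, rfl, hφ.nonneg, ⟨φ 0, ?_, ?_⟩,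
    hφ.integral_eq_one⟩
  · refine lt_of_le_of_ne (hφ.nonneg 0) fun h0 => ?_
    have : ∀ x, φ x = 0 := fun x =>
      le_antisymm ((hφ.radially_decreasing 0 x (by simp)).trans h0.symm.le) (hφ.nonneg x)
    have h1 := hφ.integral_eq_one
    simp [this] at h1
  · intro x hx
    have hd : Differentiable ℝ φ := hφ.smooth.differentiable (by simp)
    have := (Metric.isOpen_ball (x := (0 : Rn n)) (ε := 1)).is_const_of_fderiv_eq_zero
      (convex_ball (0 : Rn n) 1).isPreconnected hd.differentiableOn (fun y hy => by
        have h := hφ.gradient_eq_zero y hy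
        rw [gradient, LinearIsometryEquiv.map_eq_zero_iff] at h
        exact h) hx (Metric.mem_ball_self one_pos)
    exact this.symm.le

lemma norm_iteratedFDeriv_exp_neg (i : ℕ) (t : ℝ) :
    ‖iteratedFDeriv ℝ i (fun t : ℝ => Real.exp (-t)) t‖ = Real.exp (-t) := by
  rw [norm_iteratedFDeriv_eq_norm_iteratedDeriv]
  have : (fun t : ℝ => Real.exp (-t)) = fun t => Real.exp ((-1) * t) := by ext t; simp
  rw [this, iteratedDeriv_exp_const_mul]
  simp

/-- The Gaussian is `t ↦ exp (-t)` composed with `‖x‖ ^ 2`, a function of temperate growth. The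
composition bound for iterated derivatives gives a polynomial times `exp (-‖x‖ ^ 2)`. -/
lemma exists_gaussian_bound (k i : ℕ) : ∃ C : ℝ, ∀ x : Rn n,
    ‖x‖ ^ k * ‖iteratedFDeriv ℝ i (fun x : Rn n => Real.exp (-‖x‖ ^ 2)) x‖ ≤ C := by
  have hT : Function.HasTemperateGrowth (fun x : Rn n => ‖x‖ ^ 2) := by fun_prop
  obtain ⟨m, C, hC0, hC⟩ := hT.norm_iteratedFDeriv_le_uniform i
  have hb : ∃ B : ℝ, ∀ t : ℝ, 0 ≤ t → (1 + t) ^ (k + m * i) * Real.exp (-t ^ 2) ≤ B := by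
    refine ⟨(k + m * i).factorial * Real.exp 2, fun t ht => ?_⟩
    have h1 := Real.pow_div_factorial_le_exp (1 + t) (by linarith) (k + m * i)
    rw [div_le_iff₀' (by positivity)] at h1
    calc _ ≤ ((k + m * i).factorial * Real.exp (1 + t)) * Real.exp (-t ^ 2) := by gcongr
      _ = (k + m * i).factorial * Real.exp (1 + t + -t ^ 2) := by rw [mul_assoc, ← Real.exp_add]
      _ ≤ _ := by
        gcongr
        nlinarith [sq_nonneg (t - 1 / 2)]
  obtain ⟨B, hB⟩ := hb
  refine ⟨(i.factorial : ℝ) * (1 + C) ^ i * B, fun x => ?_⟩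
  have h1 := norm_iteratedFDeriv_comp_le (𝕜 := ℝ) (g := fun t : ℝ => Real.exp (-t))
    (f := fun x : Rn n => ‖x‖ ^ 2) (n := i) (N := ((⊤ : ℕ∞) : WithTop ℕ∞))
    (by fun_prop) hT.1 (by exact_mod_cast le_top) x (C := Real.exp (-‖x‖ ^ 2))
    (D := (1 + C) * (1 + ‖x‖) ^ m) (fun j _ => (norm_iteratedFDeriv_exp_neg j _).le)
    (fun j hj1 hj => ?_)
  · have h2 := hB ‖x‖ (norm_nonneg x)
    calc _ ≤ (1 + ‖x‖) ^ k * (i.factorial * Real.exp (-‖x‖ ^ 2) * ((1 + C) * (1 + ‖x‖) ^ m) ^ i) := by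
          gcongr
          · linarith
          · exact h1
      _ = (i.factorial : ℝ) * (1 + C) ^ i * ((1 + ‖x‖) ^ (k + m * i) * Real.exp (-‖x‖ ^ 2)) := by
          rw [mul_pow, ← pow_mul, pow_add]; ring
      _ ≤ _ := by gcongr
  · have h3 : 1 ≤ (1 + C) * (1 + ‖x‖) ^ m :=
      one_le_mul_of_one_le_of_one_le (by linarith)
        (one_le_pow₀ (by linarith [norm_nonneg x]))
    refine (hC j hj x).trans (le_trans ?_ (le_self_pow₀ h3 (by omega)))
    gcongr
    linarith

/-- The Gaussian as a Schwartz function. -/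
def gaussianS (n : ℕ) : 𝓢(Rn n, ℝ) :=
  (Real.pi ^ (-(n : ℝ) / 2) : ℝ) •
  { toFun := fun x => Real.exp (-‖x‖ ^ 2)
    smooth' := (contDiff_norm_sq ℝ).neg.exp
    decay' := fun k i => exists_gaussian_bound k i }

lemma coe_gaussianS (n : ℕ) : ⇑(gaussianS n) = gaussian n := rfl

lemma isGood_gaussianS (n : ℕ) : IsGood (gaussianS n) where
  nonneg x := by rw [coe_gaussianS, gaussian]; positivity
  exists_le := by
    refine ⟨Real.pi ^ (-(n : ℝ) / 2) * Real.exp (-1), by positivity, fun x hx => ?_⟩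
    rw [coe_gaussianS, gaussian]
    rw [mem_ball_zero_iff] at hx
    gcongr
    exact pow_le_one₀ (norm_nonneg x) hx.le
  integral_eq_one := by
    rw [coe_gaussianS]
    unfold gaussian
    rw [integral_const_mul]
    have := GaussianFourier.integral_rexp_neg_mul_sq_norm (V := Rn n) one_pos
    simp only [neg_mul, one_mul, div_one, finrank_euclideanSpace, Fintype.card_fin] at this
    rw [this, ← Real.rpow_add Real.pi_pos, neg_div, neg_add_cancel, Real.rpow_zero]

/-- Linear comparison of the Carleson norms for two kernels. -/
theorem exists_carlesonNorm_le (K : ℝ≥0) {φ ψ : 𝓢(Rn n, ℝ)} (hφ : IsGood φ) (hψ : IsGood ψ) :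
    ∃ C : ℝ, 1 < C ∧ ∀ w : Rn n → ℝ, IsWeight w → IsDoublingWith (weightMeasure w) K →
      carlesonNorm (logGradMeasure w ψ) ≤
        ENNReal.ofReal C * carlesonNorm (logGradMeasure w φ) := by
  obtain ⟨C, hC, h⟩ := exists_boxNorm_le K hφ hψ
  refine ⟨C.toReal + 2, by linarith [ENNReal.toReal_nonneg (a := C)], fun w hw hd => ?_⟩
  have := isLocallyFiniteMeasure_weightMeasure hw
  rw [carlesonNorm_logGradMeasure hw hd hψ, carlesonNorm_logGradMeasure hw hd hφ]
  refine (h _ hd).trans ?_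
  change C * boxNorm _ _ ≤ _ * boxNorm _ _
  gcongr
  rw [← ENNReal.ofReal_toReal hC]
  exact ENNReal.ofReal_le_ofReal (by simp)

end

section

/-! ### Pointwise bound of the logarithmic gradient by the Carleson norm -/

variable {n : ℕ}

lemma rescale_volume {r : ℝ} (hr : 0 < r) (x : Rn n) :
    rescale (volume : Measure (Rn n)) r x = ENNReal.ofReal (r ^ n) • volume := by
  have e : (fun z : Rn n => r⁻¹ • (z - x)) = (fun z => r⁻¹ • z) ∘ (fun z => z - x) := rfl
  rw [rescale, e, ← Measure.map_map (measurable_const_smul _) (measurable_sub_const x),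
    (measurePreserving_sub_right volume x).map_eq, Measure.map_addHaar_smul _ (inv_ne_zero hr.ne')]
  congr 2
  simp [abs_of_pos hr]

lemma setLIntegral_ball_affine (H : Rn n → ℝ≥0∞) {r : ℝ} (hr : 0 < r) (x y : Rn n) (R : ℝ) :
    ENNReal.ofReal (r ^ n) * ∫⁻ z in Metric.ball y R, H (x + r • z) =
      ∫⁻ z in Metric.ball (x + r • y) (r * R), H z := by
  have hb := isClosedEmbedding_rescale hr x
  rw [← smul_eq_mul, ← lintegral_smul_measure, ← Measure.restrict_smul, ← rescale_volume hr x, rescale,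
    hb.restrict_map, hb.lintegral_map]
  have e1 : (fun z : Rn n => r⁻¹ • (z - x)) ⁻¹' Metric.ball y R = Metric.ball (x + r • y) (r * R) := by
    ext z
    rw [mem_preimage, Metric.mem_ball, Metric.mem_ball, dist_eq_norm, dist_eq_norm]
    have : z - (x + r • y) = r • (r⁻¹ • (z - x) - y) := by
      rw [smul_sub, smul_inv_smul₀ hr.ne']; abel
    rw [this, norm_smul, Real.norm_of_nonneg hr.le, mul_lt_mul_iff_right₀ hr]
  rw [e1]
  congr 1; ext z
  rw [smul_inv_smul₀ hr.ne', add_sub_cancel]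

/-- The factor `r ^ 2` from the squared logarithmic gradient compensates the scaling of `s ds`, so
only the volume factor `r ^ n` is left and normalized box masses are invariant. -/
lemma boxMass_rescale (ν : Measure (Rn n)) [SFinite ν] (f : 𝓢(Rn n, ℝ)) {r : ℝ} (hr : 0 < r)
    (x y : Rn n) (R : ℝ) :
    ENNReal.ofReal (r ^ n) * boxMass (rescale ν r x) f y R = boxMass ν f (x + r • y) (r * R) := by
  set Φ : ℝ → ℝ≥0∞ := fun s => (∫⁻ z in Metric.ball (x + r • y) (r * R),
    ENNReal.ofReal (logGrad ν f z s) ^ 2) * ENNReal.ofReal s with hΦ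
  have hΦm : Measurable Φ :=
    ((measurable_sq_logGrad ν f).lintegral_prod_left').mul measurable_id.ennreal_ofReal
  rw [boxMass_eq, boxMass_eq, ← lintegral_const_mul' _ _ ENNReal.ofReal_ne_top]
  have e : ∀ s, ENNReal.ofReal (r ^ n) * ((∫⁻ z in Metric.ball y R,
      ENNReal.ofReal (logGrad (rescale ν r x) f z s) ^ 2) * ENNReal.ofReal s) =
      ENNReal.ofReal r * Φ (r * s) := by
    intro s
    simp_rw [hΦ, logGrad_rescale ν _ hr, ENNReal.ofReal_mul hr.le, mul_pow]
    rw [lintegral_const_mul' _ _ (by simp), ← setLIntegral_ball_affine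
      (fun z => ENNReal.ofReal (logGrad ν f z (r * s)) ^ 2) hr x y R]
    ring
  simp_rw [e]
  rw [lintegral_const_mul' _ _ ENNReal.ofReal_ne_top, setLIntegral_comp_mul_left hΦm hr, ← mul_assoc,
    ← ENNReal.ofReal_mul hr.le, mul_inv_cancel₀ hr.ne', ENNReal.ofReal_one, one_mul, mul_zero]

lemma boxNorm_rescale_le (ν : Measure (Rn n)) [SFinite ν] (f : 𝓢(Rn n, ℝ)) {r : ℝ} (hr : 0 < r)
    (x : Rn n) : boxNorm (rescale ν r x) f ≤ boxNorm ν f := by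
  refine iSup₂_le fun y R => iSup_le fun hR => ?_
  have hrn : ENNReal.ofReal (r ^ n) ≠ 0 := by simpa using pow_pos hr n
  rw [ENNReal.div_le_iff (Metric.measure_ball_pos _ _ hR).ne' measure_ball_lt_top.ne,
    ← ENNReal.mul_le_mul_iff_right hrn ENNReal.ofReal_ne_top, boxMass_rescale ν f hr]
  refine (boxMass_le_boxNorm ν f (x + r • y) (by positivity)).trans_eq ?_
  rw [volume_ball_scale _ hr, Measure.addHaar_ball_center _ (x + r • y),
    Measure.addHaar_ball_center _ y]
  ring

/-- The weight varies by a factor at most `2 ^ L` within a unit ball, so Tonelli replaces values of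
`H` by integrals over unit balls. Such integrals are the spatial sections of Carleson boxes. -/
lemma lintegral_wt_mul_le (L : ℕ) {H : Rn n → ℝ≥0∞} (hH : Measurable H) :
    volume (Metric.ball (0 : Rn n) 1) * ∫⁻ y, ENNReal.ofReal (wt L y) * H y ≤
      2 ^ L * ∫⁻ z, ENNReal.ofReal (wt L z) * ∫⁻ y in Metric.ball z 1, H y := by
  have hwm : Measurable fun z : Rn n => ENNReal.ofReal (wt L z) :=
    (continuous_wt L).measurable.ennreal_ofReal
  have h1 : ∀ y : Rn n, volume (Metric.ball (0 : Rn n) 1) * ENNReal.ofReal (wt L y) ≤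
      2 ^ L * ∫⁻ z in Metric.ball y 1, ENNReal.ofReal (wt L z) := by
    intro y
    rw [← Measure.addHaar_ball_center _ y, mul_comm, ← setLIntegral_const,
      ← lintegral_const_mul' _ _ (by simp)]
    refine setLIntegral_mono (hwm.const_mul _) fun z hz => ?_
    have : (2 : ℝ≥0∞) ^ L = ENNReal.ofReal (2 ^ L) := by rw [ENNReal.ofReal_pow zero_le_two]; simp
    rw [this, ← ENNReal.ofReal_mul (by positivity)]
    apply ENNReal.ofReal_le_ofReal
    have h2 := wt_sub_le L z (z - y)
    rw [sub_sub_cancel] at h2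
    refine h2.trans (mul_le_mul_of_nonneg_right ?_ (wt_nonneg _ _))
    rw [Metric.mem_ball, dist_eq_norm] at hz
    exact pow_le_pow_left₀ (by positivity) (by linarith) _
  have hS : MeasurableSet {p : Rn n × Rn n | dist p.2 p.1 < 1} :=
    measurableSet_lt (by fun_prop) measurable_const
  have hm : Measurable fun p : Rn n × Rn n =>
      {p : Rn n × Rn n | dist p.2 p.1 < 1}.indicator (fun p => ENNReal.ofReal (wt L p.2) * H p.1) p :=
    ((hwm.comp measurable_snd).mul (hH.comp measurable_fst)).indicator hS
  calc _ = ∫⁻ y, volume (Metric.ball (0 : Rn n) 1) * ENNReal.ofReal (wt L y) * H y := by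
        rw [← lintegral_const_mul' _ _ measure_ball_lt_top.ne]
        simp_rw [mul_assoc]
    _ ≤ ∫⁻ y, 2 ^ L * ∫⁻ z, {p : Rn n × Rn n | dist p.2 p.1 < 1}.indicator
          (fun p => ENNReal.ofReal (wt L p.2) * H p.1) (y, z) := by
        refine lintegral_mono fun y => (mul_le_mul_left (h1 y) (H y)).trans_eq ?_
        rw [mul_assoc, ← lintegral_mul_const _ hwm, ← lintegral_indicator measurableSet_ball]
        rfl
    _ = 2 ^ L * ∫⁻ z, ∫⁻ y, {p : Rn n × Rn n | dist p.2 p.1 < 1}.indicator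
          (fun p => ENNReal.ofReal (wt L p.2) * H p.1) (y, z) := by
        rw [lintegral_const_mul' _ _ (by simp), lintegral_lintegral_swap hm.aemeasurable]
    _ = _ := by
        congr 2; ext z
        rw [← lintegral_const_mul _ hH, ← lintegral_indicator measurableSet_ball]
        congr 1; ext y
        simp only [indicator, mem_ofPred_eq, Metric.mem_ball, dist_comm z y]

lemma measurable_setLIntegral_ball {F : ℝ × Rn n → ℝ≥0∞} (hF : Measurable F) (R : ℝ) :
    Measurable fun p : ℝ × Rn n => ∫⁻ y in Metric.ball p.2 R, F (p.1, y) := by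
  have hS : MeasurableSet {q : (ℝ × Rn n) × Rn n | dist q.2 q.1.2 < R} :=
    measurableSet_lt (by fun_prop) measurable_const
  have h0 := ((hF.comp (f := fun q : (ℝ × Rn n) × Rn n => (q.1.1, q.2))
    (by fun_prop)).indicator hS).lintegral_prod_right' (ν := (volume : Measure (Rn n)))
  convert h0 using 2 with p
  rw [← lintegral_indicator measurableSet_ball]
  rfl

lemma setLIntegral_const_mul_tsum_swap {G : ℕ → ℝ × Rn n → ℝ≥0∞} (hG : ∀ m, Measurable (G m))
    {C d : ℝ≥0∞} (hC : C ≠ ⊤) (hd : d ≠ ⊤) {a : ℕ → ℝ≥0∞} (ha : ∀ m, a m ≠ ⊤) (S : Set ℝ) :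
    ∫⁻ t in S, C * ∑' m, a m * (d * ∫⁻ z, G m (t, z)) =
      C * ∑' m, a m * (d * ∫⁻ z, ∫⁻ t in S, G m (t, z)) := by
  rw [lintegral_const_mul' _ _ hC, lintegral_tsum fun m =>
    (((hG m).lintegral_prod_right'.const_mul _).const_mul _).aemeasurable]
  congr 2; ext m
  rw [lintegral_const_mul' _ _ (ha m), lintegral_const_mul' _ _ hd,
    lintegral_lintegral_swap (f := fun t z => G m (t, z)) (hG m).aemeasurable]

/-- Here the free parameter `t` matters: the left side does not depend on it, so integrating over `t
∈ (1/2, 1)` turns each term on the right into a part of a Carleson integral. -/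
lemma exists_logGrad_unit_le_boxNorm (K : ℝ≥0) {φ ψ : 𝓢(Rn n, ℝ)} (hφ : IsGood φ)
    (hψ : IsGood ψ) :
    ∃ C : ℝ≥0∞, C ≠ ⊤ ∧ ∀ (ν : Measure (Rn n)) [IsLocallyFiniteMeasure ν],
      IsDoublingWith ν K → ENNReal.ofReal (logGrad ν ψ 0 1) ^ 2 ≤ C * boxNorm ν φ := by
  obtain ⟨ε, C, hε0, hε1, hCt, hC⟩ := exists_logGrad_sq_le K hφ hψ (L := n + 1) le_rfl
  set L := n + 1
  set I := ∫⁻ y : Rn n, ENNReal.ofReal (wt L y) with hI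
  have hwm : Measurable fun z : Rn n => ENNReal.ofReal (wt L z) :=
    (continuous_wt L).measurable.ennreal_ofReal
  -- The `4` undoes the length `1/2` of the interval and the lower bound `t ≥ 1/2` for the factor
  -- `t` in the Carleson density; the inner `2` bounds `∑ ε^m`.
  refine ⟨4 * (C * (2 * (2 ^ L * I))), ?_, fun ν _ h => ?_⟩
  · exact ENNReal.mul_ne_top (by simp) (ENNReal.mul_ne_top hCt (ENNReal.mul_ne_top (by simp)
      (ENNReal.mul_ne_top (by simp) (lintegral_wt_ne_top le_rfl))))
  set a : ℕ → ℝ≥0∞ := fun m => ENNReal.ofReal ((ε ^ 3) ^ m) with ha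
  obtain ⟨F, hF⟩ : ∃ F : ℝ → Rn n → ℝ≥0∞,
      F = fun s y => ENNReal.ofReal (logGrad ν φ y s) ^ 2 := ⟨_, rfl⟩
  set b := volume (Metric.ball (0 : Rn n) 1) with hb
  set X := ENNReal.ofReal (logGrad ν ψ 0 1) ^ 2 with hX
  have hb0 : b ≠ 0 := (Metric.measure_ball_pos _ _ one_pos).ne'
  have hbt : b ≠ ⊤ := measure_ball_lt_top.ne
  have hFm : Measurable fun p : ℝ × Rn n => F p.1 p.2 :=
    hF ▸ (measurable_sq_logGrad ν φ).comp measurable_swap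
  have hFm' : ∀ s, Measurable (F s) := fun s => hFm.comp (measurable_const.prodMk measurable_id)
  have hG : ∀ m, Measurable fun p : ℝ × Rn n =>
      ENNReal.ofReal (wt L p.2) *
        ((∫⁻ y in Metric.ball p.2 1, F (ε ^ m * p.1) y) * ENNReal.ofReal p.1) := by
    intro m
    have h1 := measurable_setLIntegral_ball (F := fun p : ℝ × Rn n => F (ε ^ m * p.1) p.2)
      (hFm.comp (f := fun p : ℝ × Rn n => (ε ^ m * p.1, p.2)) (by fun_prop)) 1
    exact (hwm.comp measurable_snd).mul (h1.mul measurable_fst.ennreal_ofReal)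
  have h1 : ∀ t ∈ Ioo (1 / 2 : ℝ) 1, b * X * ENNReal.ofReal (1 / 2) ≤
      C * ∑' m, a m * (2 ^ L * ∫⁻ z, ENNReal.ofReal (wt L z) *
        ((∫⁻ y in Metric.ball z 1, F (ε ^ m * t) y) * ENNReal.ofReal t)) := by
    intro t ht
    have h2 := hC ν h 0 1 one_pos t ⟨ht.1.le, ht.2.le⟩
    simp only [zero_add, one_smul, one_mul] at h2
    calc b * X * ENNReal.ofReal (1 / 2)
        ≤ b * (C * ∑' m, a m * ∫⁻ y, ENNReal.ofReal (wt L y) * F (ε ^ m * t) y) *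
          ENNReal.ofReal t := by
          simp_rw [hF, mul_comm (ε ^ _) t]
          exact mul_le_mul' (mul_le_mul_right h2 b) (ENNReal.ofReal_le_ofReal ht.1.le)
      _ = (C * ∑' m, a m * (b * ∫⁻ y, ENNReal.ofReal (wt L y) * F (ε ^ m * t) y)) *
          ENNReal.ofReal t := by
          simp_rw [mul_left_comm _ b, ENNReal.tsum_mul_left, mul_left_comm _ b]
      _ ≤ (C * ∑' m, a m * (2 ^ L * ∫⁻ z, ENNReal.ofReal (wt L z) *
          ∫⁻ y in Metric.ball z 1, F (ε ^ m * t) y)) * ENNReal.ofReal t := by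
          refine mul_le_mul_left (mul_le_mul_right (ENNReal.tsum_le_tsum fun m => ?_) C) _
          exact mul_le_mul_right (lintegral_wt_mul_le L (hFm' _)) _
      _ = _ := by
          simp_rw [← mul_assoc (ENNReal.ofReal (wt L _)),
            lintegral_mul_const' _ _ ENNReal.ofReal_ne_top, ← mul_assoc, ENNReal.tsum_mul_right,
            mul_assoc]
  have h2 : b * X * ENNReal.ofReal (1 / 2) * ENNReal.ofReal (1 / 2) ≤
      C * ∑' m, a m * (2 ^ L * ∫⁻ z, ∫⁻ t in Ioo (1 / 2 : ℝ) 1, ENNReal.ofReal (wt L z) *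
        ((∫⁻ y in Metric.ball z 1, F (ε ^ m * t) y) * ENNReal.ofReal t)) := by
    calc _ = ∫⁻ t in Ioo (1 / 2 : ℝ) 1, b * X * ENNReal.ofReal (1 / 2) := by
          rw [setLIntegral_const, Real.volume_Ioo]; norm_num
      _ ≤ _ := setLIntegral_mono' measurableSet_Ioo h1
      _ = _ :=
          setLIntegral_const_mul_tsum_swap hG hCt (by simp)
            (fun m => ENNReal.ofReal_ne_top) _
  have h3 : ∀ m z, ∫⁻ t in Ioo (1 / 2 : ℝ) 1, ENNReal.ofReal (wt L z) *
        ((∫⁻ y in Metric.ball z 1, F (ε ^ m * t) y) * ENNReal.ofReal t) ≤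
      ENNReal.ofReal (wt L z) * (ENNReal.ofReal ((ε ^ m) ^ 2)⁻¹ * (boxNorm ν φ * b)) := by
    intro m z
    rw [lintegral_const_mul' _ _ ENNReal.ofReal_ne_top, hF]
    gcongr
    refine (lintegral_mono_set (Ioo_subset_Ioo_left (by norm_num : (0 : ℝ) ≤ 1 / 2))).trans ?_
    have hεm : ε ^ m ≤ 1 := pow_le_one₀ hε0.le (by linarith)
    refine (lintegral_scaled_le_boxMass ν φ z (c := ε ^ m) (by positivity) (R := 1) (R' := 1)
      (by linarith)).trans ?_
    gcongr
    rw [hb, ← Measure.addHaar_ball_center _ z]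
    exact boxMass_le_boxNorm ν φ z one_pos
  have h4 : b * X * ENNReal.ofReal (1 / 2) * ENNReal.ofReal (1 / 2) ≤
      b * (C * (2 * (2 ^ L * I)) * boxNorm ν φ) := by
    refine h2.trans ?_
    calc _ ≤ C * ∑' m, a m * (2 ^ L * ∫⁻ z, ENNReal.ofReal (wt L z) *
          (ENNReal.ofReal ((ε ^ m) ^ 2)⁻¹ * (boxNorm ν φ * b))) := by
          gcongr with m z
          exact h3 m z
      _ = C * ((∑' m, ENNReal.ofReal (ε ^ m)) * (2 ^ L * (I * (boxNorm ν φ * b)))) := by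
          rw [← ENNReal.tsum_mul_right]
          congr 2; ext m
          rw [lintegral_mul_const _ hwm]
          have : a m * ENNReal.ofReal ((ε ^ m) ^ 2)⁻¹ = ENNReal.ofReal (ε ^ m) := by
            rw [ha, ← ENNReal.ofReal_mul (by positivity)]
            congr 1
            have : ε ^ m ≠ 0 := by positivity
            rw [← pow_mul, mul_comm 3 m, pow_mul]
            field_simp
          rw [← this]
          ring
      _ ≤ C * (2 * (2 ^ L * (I * (boxNorm ν φ * b)))) := by
          gcongr
          exact tsum_ofReal_pow_le hε0.le hε1
      _ = _ := by ring
  have h5 : X * ENNReal.ofReal (1 / 4) ≤ C * (2 * (2 ^ L * I)) * boxNorm ν φ := by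
    rw [← ENNReal.mul_le_mul_iff_right hb0 hbt]
    refine le_trans (le_of_eq ?_) h4
    rw [mul_assoc (b * X), ← ENNReal.ofReal_mul (by norm_num), mul_assoc]
    norm_num
  calc X = 4 * (X * ENNReal.ofReal (1 / 4)) := by
        have : (4 : ℝ≥0∞) = ENNReal.ofReal 4 := by simp
        rw [mul_left_comm, this, ← ENNReal.ofReal_mul (by norm_num)]
        norm_num
    _ ≤ _ := by
        rw [mul_assoc]
        gcongr

/-- The logarithmic gradient is pointwise controlled by the Carleson norm. -/
theorem exists_logGrad_le_boxNorm (K : ℝ≥0) {φ ψ : 𝓢(Rn n, ℝ)} (hφ : IsGood φ) (hψ : IsGood ψ) :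
    ∃ C : ℝ≥0∞, C ≠ ⊤ ∧ ∀ (ν : Measure (Rn n)) [IsLocallyFiniteMeasure ν],
      IsDoublingWith ν K → ∀ (x : Rn n) (r : ℝ), 0 < r →
        ENNReal.ofReal (r * logGrad ν ψ x r) ^ 2 ≤ C * boxNorm ν φ := by
  obtain ⟨C, hC, H⟩ := exists_logGrad_unit_le_boxNorm K hφ hψ
  refine ⟨C, hC, fun ν _ h x r hr => ?_⟩
  have := isLocallyFiniteMeasure_rescale ν hr x
  have h1 := H (rescale ν r x) (h.rescale_measure hr x)
  rw [logGrad_rescale ν _ hr, smul_zero, add_zero, mul_one] at h1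
  refine h1.trans ?_
  gcongr
  exact boxNorm_rescale_le ν φ hr x

end

section

/-! ### The Gaussian semigroup and one step of the telescoping argument -/

variable {n : ℕ}

/-- Completing the square: `‖z‖² + ‖v - √3 z‖² = ‖v/2‖² + 4 ‖z - (√3/4) v‖²`. -/
lemma integral_gaussian_mul_gaussian (v : Rn n) :
    ∫ z, gaussian n z * gaussian n (v - √3 • z) = (2 ^ n)⁻¹ * gaussian n ((2 : ℝ)⁻¹ • v) := by
  have h3 : √3 * √3 = (3 : ℝ) := Real.mul_self_sqrt (by norm_num)
  have e : ∀ z, gaussian n z * gaussian n (v - √3 • z) =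
      (Real.pi ^ (-(n : ℝ) / 2) * gaussian n ((2 : ℝ)⁻¹ • v)) *
        Real.exp (-4 * ‖z - (√3 / 4) • v‖ ^ 2) := by
    intro z
    unfold gaussian
    have e1 : -‖z‖ ^ 2 + -‖v - √3 • z‖ ^ 2 =
        -‖(2 : ℝ)⁻¹ • v‖ ^ 2 + -4 * ‖z - (√3 / 4) • v‖ ^ 2 := by
      rw [norm_sub_sq_real, norm_sub_sq_real, norm_smul, norm_smul, norm_smul, inner_smul_right,
        inner_smul_right, real_inner_comm v z]
      simp only [Real.norm_eq_abs, mul_pow, sq_abs]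
      rw [div_pow, Real.sq_sqrt (by norm_num : (0 : ℝ) ≤ 3)]
      ring
    calc _ = Real.pi ^ (-(n : ℝ) / 2) * Real.pi ^ (-(n : ℝ) / 2) *
          (Real.exp (-‖z‖ ^ 2) * Real.exp (-‖v - √3 • z‖ ^ 2)) := by ring
      _ = _ := by rw [← Real.exp_add, e1, Real.exp_add]; ring
  simp_rw [e]
  rw [integral_const_mul, integral_sub_right_eq_self (fun z : Rn n => Real.exp (-4 * ‖z‖ ^ 2)),
    GaussianFourier.integral_rexp_neg_mul_sq_norm (V := Rn n) (by norm_num : (0 : ℝ) < 4),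
    finrank_euclideanSpace, Fintype.card_fin, Real.div_rpow Real.pi_pos.le (by norm_num)]
  have e4 : (4 : ℝ) ^ ((n : ℝ) / 2) = 2 ^ n := by
    rw [show (4 : ℝ) = 2 ^ (2 : ℝ) by norm_num, ← Real.rpow_mul (by norm_num),
      mul_div_cancel₀ _ (two_ne_zero), Real.rpow_natCast]
  have e5 : Real.pi ^ (-(n : ℝ) / 2) * Real.pi ^ ((n : ℝ) / 2) = 1 := by
    rw [← Real.rpow_add Real.pi_pos, neg_div, neg_add_cancel, Real.rpow_zero]
  rw [e4]
  calc _ = (Real.pi ^ (-(n : ℝ) / 2) * Real.pi ^ ((n : ℝ) / 2)) *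
        ((2 ^ n)⁻¹ * gaussian n ((2 : ℝ)⁻¹ • v)) := by ring
    _ = _ := by rw [e5, one_mul]

lemma gaussian_pos (x : Rn n) : 0 < gaussian n x := by
  unfold gaussian
  have := Real.pi_pos
  positivity

lemma lintegral_gaussian_mul_gaussian (v : Rn n) :
    ∫⁻ z, ENNReal.ofReal (gaussian n z * gaussian n (v - √3 • z)) =
      ENNReal.ofReal ((2 ^ n)⁻¹ * gaussian n ((2 : ℝ)⁻¹ • v)) := by
  rw [← integral_gaussian_mul_gaussian, ofReal_integral_eq_lintegral_ofReal]
  -- A non-integrable function would have integral zero by convention, whereas the value computed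
  -- above is positive.
  · by_contra hn
    have h1 := integral_undef hn
    rw [integral_gaussian_mul_gaussian] at h1
    have := gaussian_pos ((2 : ℝ)⁻¹ • v)
    exact (by positivity : (0 : ℝ) < (2 ^ n)⁻¹ * gaussian n ((2 : ℝ)⁻¹ • v)).ne' h1
  · exact ae_of_all _ fun z => (mul_pos (gaussian_pos _) (gaussian_pos _)).le

/-! ### Semigroup law and the one-step inequality. -/

section Step

variable {ν : Measure (Rn n)} {K : ℝ≥0} [IsLocallyFiniteMeasure ν]

lemma IsDoublingWith.ofReal_conv (h : IsDoublingWith ν K) {f : 𝓢(Rn n, ℝ)} (hf : ∀ x, 0 ≤ f x)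
    {s : ℝ} (hs : 0 < s) (x : Rn n) :
    ENNReal.ofReal (conv ν f s x) = ∫⁻ z, ENNReal.ofReal ((s ^ n)⁻¹ * f (s⁻¹ • (x - z))) ∂ν :=
  ofReal_integral_eq_lintegral_ofReal ((h.integrable_conv f hs x).smul (s ^ n)⁻¹)
    (ae_of_all _ fun _ => smul_nonneg (by positivity) (hf _))

lemma IsDoublingWith.continuous_conv (h : IsDoublingWith ν K) {F : Type} [NormedAddCommGroup F]
    [NormedSpace ℝ F] (f : 𝓢(Rn n, F)) {s : ℝ} (hs : 0 < s) : Continuous (conv ν f s) :=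
  continuous_iff_continuousAt.2 fun x => (h.hasFDerivAt_conv f hs x).continuousAt

/-- Variances add: `(2ρ)² = ρ² + (√3 ρ)²`. The interchange of integrals is done with non-negative
integrals, where Tonelli needs only measurability. -/
lemma IsDoublingWith.conv_gaussian_two_mul (h : IsDoublingWith ν K) {ρ : ℝ} (hρ : 0 < ρ)
    (x : Rn n) :
    conv ν (gaussianS n) (2 * ρ) x = smear (gaussianS n) (√3 * ρ) (conv ν (gaussianS n) ρ) x := by
  have hg := isGood_gaussianS n
  have hsm : 0 ≤ smear (gaussianS n) (√3 * ρ) (conv ν (gaussianS n) ρ) x :=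
    integral_nonneg fun z => smul_nonneg (hg.nonneg _) (hg.conv_pos h hρ _).le
  have hcont : Continuous fun z => gaussianS n z • conv ν (gaussianS n) ρ (x - (√3 * ρ) • z) :=
    (gaussianS n).continuous.smul ((h.continuous_conv _ hρ).comp (by fun_prop))
  have key : ∫⁻ z, ENNReal.ofReal (gaussianS n z • conv ν (gaussianS n) ρ (x - (√3 * ρ) • z)) =
      ENNReal.ofReal (conv ν (gaussianS n) (2 * ρ) x) := by
    rw [h.ofReal_conv hg.nonneg (by positivity)]
    have e1 : ∀ z, ENNReal.ofReal (gaussianS n z • conv ν (gaussianS n) ρ (x - (√3 * ρ) • z)) =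
        ∫⁻ t, ENNReal.ofReal (gaussianS n z) * ENNReal.ofReal
          ((ρ ^ n)⁻¹ * gaussianS n (ρ⁻¹ • (x - (√3 * ρ) • z - t))) ∂ν := fun z => by
      rw [smul_eq_mul, ENNReal.ofReal_mul (hg.nonneg _), h.ofReal_conv hg.nonneg hρ,
        lintegral_const_mul' _ _ ENNReal.ofReal_ne_top]
    simp_rw [e1]
    rw [lintegral_lintegral_swap]
    · congr 1; ext t
      have e2 : ∀ z, ENNReal.ofReal (gaussianS n z) * ENNReal.ofReal
          ((ρ ^ n)⁻¹ * gaussianS n (ρ⁻¹ • (x - (√3 * ρ) • z - t))) =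
          ENNReal.ofReal (ρ ^ n)⁻¹ *
            ENNReal.ofReal (gaussian n z * gaussian n (ρ⁻¹ • (x - t) - √3 • z)) := fun z => by
        rw [← ENNReal.ofReal_mul (hg.nonneg _), ← ENNReal.ofReal_mul (by positivity), coe_gaussianS]
        congr 1
        have : ρ⁻¹ • (x - (√3 * ρ) • z - t) = ρ⁻¹ • (x - t) - √3 • z := by
          rw [sub_right_comm, smul_sub, smul_smul]
          congr 2
          field_simp
        rw [this]; ring
      simp_rw [e2]
      rw [lintegral_const_mul' _ _ ENNReal.ofReal_ne_top, lintegral_gaussian_mul_gaussian,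
        ← ENNReal.ofReal_mul (by positivity), coe_gaussianS, smul_smul, mul_pow, mul_inv, mul_inv]
      congr 1; ring
    · refine Measurable.aemeasurable ?_
      have c1 : Continuous fun p : Rn n × Rn n => gaussianS n p.1 :=
        (gaussianS n).continuous.comp continuous_fst
      have c2 : Continuous fun p : Rn n × Rn n => gaussianS n (ρ⁻¹ • (x - (√3 * ρ) • p.1 - p.2)) :=
        (gaussianS n).continuous.comp (by fun_prop)
      exact c1.measurable.ennreal_ofReal.mul (c2.measurable.const_mul _).ennreal_ofReal
  unfold smear at hsm ⊢
  rw [integral_eq_lintegral_of_nonneg_ae (ae_of_all _ fun z =>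
    smul_nonneg (hg.nonneg _) (hg.conv_pos h hρ _).le) hcont.aestronglyMeasurable, key,
    ENNReal.toReal_ofReal (hg.conv_pos h (by positivity) x).le]

/-- The logarithm of the Gaussian extension. -/
def logConv (ν : Measure (Rn n)) (s : ℝ) (x : Rn n) : ℝ := Real.log (conv ν (gaussianS n) s x)

lemma IsDoublingWith.continuous_logConv (h : IsDoublingWith ν K) {s : ℝ} (hs : 0 < s) :
    Continuous (logConv ν s) :=
  (h.continuous_conv _ hs).log fun x => ((isGood_gaussianS n).conv_pos h hs x).ne'

lemma IsDoublingWith.abs_logConv_sub_le (h : IsDoublingWith ν K) {s l : ℝ} (hs : 0 < s)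
    (hl : ∀ x, logGrad ν (gaussianS n) x s ≤ l) (x y : Rn n) :
    |logConv ν s x - logConv ν s y| ≤ l * ‖x - y‖ :=
  convex_univ.norm_image_sub_le_of_norm_hasFDerivWithin_le
    (fun z _ => ((isGood_gaussianS n).hasFDerivAt_log h hs z).hasFDerivWithinAt)
    (fun z _ => by rw [(isGood_gaussianS n).norm_fderiv_log h hs]; exact hl z)
    (mem_univ y) (mem_univ x)

lemma exists_gaussian_mul_exp_le (M : ℕ) : ∃ C : ℝ, 0 ≤ C ∧ ∀ z : Rn n,
    gaussianS n z * Real.exp ‖z‖ ≤ C * wt M z := by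
  refine ⟨Real.pi ^ (-(n : ℝ) / 2) * (M.factorial * Real.exp 2), by positivity, fun z => ?_⟩
  rw [coe_gaussianS, gaussian, mul_assoc, mul_assoc]
  refine mul_le_mul_of_nonneg_left ?_ (by positivity)
  rw [wt, ← div_eq_mul_inv, le_div_iff₀ (by positivity)]
  set t := ‖z‖
  have ht : 0 ≤ t := norm_nonneg z
  have h1 := Real.pow_div_factorial_le_exp (1 + t) (by linarith) M
  rw [div_le_iff₀' (by positivity)] at h1
  calc _ ≤ Real.exp (-t ^ 2) * Real.exp t * (M.factorial * Real.exp (1 + t)) := by gcongr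
    _ = M.factorial * Real.exp (-t ^ 2 + t + (1 + t)) := by
        rw [Real.exp_add (-t ^ 2 + t) (1 + t), Real.exp_add (-t ^ 2) t]; ring
    _ ≤ _ := by
        gcongr
        nlinarith [sq_nonneg (t - 1)]

lemma exp_le_one_add_add_sq (t : ℝ) : Real.exp t ≤ 1 + t + t ^ 2 * Real.exp |t| := by
  rcases le_total 0 t with ht | ht
  · rw [abs_of_nonneg ht]
    have h1 : Real.exp t ≤ 1 + t * Real.exp t := by
      have h2 := Real.add_one_le_exp (-t)
      have h3 : Real.exp (-t) * Real.exp t = 1 := by rw [← Real.exp_add]; simp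
      nlinarith [Real.exp_pos t]
    nlinarith [mul_le_mul_of_nonneg_left h1 ht]
  · rw [abs_of_nonpos ht]
    have h1 : Real.exp t * (1 - t) ≤ 1 := by
      have h2 := Real.add_one_le_exp (-t)
      have h3 : Real.exp t * Real.exp (-t) = 1 := by rw [← Real.exp_add]; simp
      nlinarith [Real.exp_pos t]
    have h2 : 1 ≤ Real.exp (-t) := Real.one_le_exp (by linarith)
    have h3 : Real.exp t ≤ 1 + t + t ^ 2 := by
      by_contra hcon
      push Not at hcon
      nlinarith [mul_lt_mul_of_pos_right hcon (by linarith : 0 < 1 - t), sq_nonneg t,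
        mul_nonneg (sq_nonneg t) (neg_nonneg.2 ht)]
    nlinarith [sq_nonneg t]

lemma integrable_gaussian_mul {q : Rn n → ℝ} (hq : Continuous q) {C : ℝ} {k : ℕ} (hC : 0 ≤ C)
    (h : ∀ z, |q z| ≤ C * (1 + ‖z‖) ^ k * Real.exp ‖z‖) :
    Integrable fun z => gaussianS n z * q z := by
  obtain ⟨C', hC'0, hC'⟩ := exists_gaussian_mul_exp_le (n := n) (k + (n + 1))
  refine integrable_smul_of_le_wt (gaussianS n).continuous hq (C := C * C') fun z => ?_
  rw [Real.norm_of_nonneg ((isGood_gaussianS n).nonneg z), ← pow_mul_wt k (n + 1), Real.norm_eq_abs]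
  calc _ ≤ gaussianS n z * (C * (1 + ‖z‖) ^ k * Real.exp ‖z‖) := by
        gcongr
        · exact (isGood_gaussianS n).nonneg z
        · exact h z
    _ = C * (1 + ‖z‖) ^ k * (gaussianS n z * Real.exp ‖z‖) := by ring
    _ ≤ C * (1 + ‖z‖) ^ k * (C' * wt (k + (n + 1)) z) := by
        exact mul_le_mul_of_nonneg_left (hC' z) (by positivity)
    _ = _ := by ring

/-- With `q z = log u_ρ(x - cz) - log u_ρ(x)`, the semigroup law gives `u_{2ρ}/u_ρ` as the Gaussian
average of `exp q`. Then `log I ≤ I - 1` and the second-order bound for `exp` apply. The assumption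
on `l` ensures `|q z| ≤ ‖z‖`, so the error factor `exp |q|` is integrable against the Gaussian. -/
lemma IsDoublingWith.logConv_two_mul_sub_le (h : IsDoublingWith ν K) {ρ l : ℝ} (hρ : 0 < ρ)
    (hl : ∀ x, logGrad ν (gaussianS n) x ρ ≤ l) (hl2 : l * (√3 * ρ) ≤ 1) (x : Rn n) :
    logConv ν (2 * ρ) x - logConv ν ρ x ≤
      (∫ z, gaussianS n z * (logConv ν ρ (x - (√3 * ρ) • z) - logConv ν ρ x)) +
      ∫ z, gaussianS n z * (Real.exp ‖z‖ *
        (logConv ν ρ (x - (√3 * ρ) • z) - logConv ν ρ x) ^ 2) := by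
  have hg := isGood_gaussianS n
  set c := √3 * ρ with hc
  have hc0 : 0 < c := by positivity
  obtain ⟨q, hq⟩ : ∃ q : Rn n → ℝ, q = fun z => logConv ν ρ (x - c • z) - logConv ν ρ x := ⟨_, rfl⟩
  have hqz : ∀ z, logConv ν ρ (x - c • z) - logConv ν ρ x = q z := fun z => by rw [hq]
  have hqc : Continuous q := by
    rw [hq]
    exact ((h.continuous_logConv hρ).comp (by fun_prop)).sub continuous_const
  have hq1 : ∀ z, |q z| ≤ ‖z‖ := fun z => by
    rw [hq]
    refine (h.abs_logConv_sub_le hρ hl _ _).trans ?_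
    rw [sub_sub_cancel_left, norm_neg, norm_smul, Real.norm_of_nonneg hc0.le, ← mul_assoc]
    exact mul_le_of_le_one_left (norm_nonneg _) hl2
  simp_rw [hqz]
  have i1 : Integrable fun z => gaussianS n z * q z :=
    integrable_gaussian_mul hqc (C := 1) (k := 1) zero_le_one fun z => by
      have h1 := Real.one_le_exp (norm_nonneg z)
      nlinarith [hq1 z, norm_nonneg z]
  have i2 : Integrable fun z => gaussianS n z * (Real.exp ‖z‖ * q z ^ 2) :=
    integrable_gaussian_mul (by fun_prop) (C := 1) (k := 2) zero_le_one fun z => by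
      rw [abs_mul, abs_of_pos (Real.exp_pos _), one_mul, mul_comm, abs_pow]
      gcongr
      linarith [hq1 z]
  have i3 : Integrable fun z => gaussianS n z * Real.exp (q z) :=
    integrable_gaussian_mul (by fun_prop) (C := 1) (k := 0) zero_le_one fun z => by
      rw [abs_of_pos (Real.exp_pos _), pow_zero, one_mul, one_mul]
      exact Real.exp_le_exp.2 ((le_abs_self _).trans (hq1 z))
  have i12 : Integrable fun z => gaussianS n z + gaussianS n z * q z :=
    (gaussianS n).integrable.add i1
  have i123 : Integrable fun z => gaussianS n z + gaussianS n z * q z +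
      gaussianS n z * (Real.exp ‖z‖ * q z ^ 2) := i12.add i2
  have hu := hg.conv_pos h hρ x
  have hu2 := hg.conv_pos h (by positivity : 0 < 2 * ρ) x
  have e1 : conv ν (gaussianS n) (2 * ρ) x =
      conv ν (gaussianS n) ρ x * ∫ z, gaussianS n z * Real.exp (q z) := by
    rw [h.conv_gaussian_two_mul hρ, smear, ← hc, ← integral_const_mul]
    congr 1; ext z
    rw [← hqz, logConv, logConv, Real.exp_sub, Real.exp_log (hg.conv_pos h hρ _),
      Real.exp_log hu, smul_eq_mul]
    field_simp
  have hI : 0 < ∫ z, gaussianS n z * Real.exp (q z) := by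
    rw [e1] at hu2
    exact pos_of_mul_pos_right hu2 hu.le
  calc logConv ν (2 * ρ) x - logConv ν ρ x = Real.log (∫ z, gaussianS n z * Real.exp (q z)) := by
        rw [logConv, logConv, e1, Real.log_mul hu.ne' hI.ne']; ring
    _ ≤ (∫ z, gaussianS n z * Real.exp (q z)) - 1 := Real.log_le_sub_one_of_pos hI
    _ ≤ (∫ z, (gaussianS n z + gaussianS n z * q z +
          gaussianS n z * (Real.exp ‖z‖ * q z ^ 2))) - 1 := by
        refine sub_le_sub_right (integral_mono i3 i123 fun z => ?_) _
        have h1 := exp_le_one_add_add_sq (q z)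
        have h2 : Real.exp |q z| ≤ Real.exp ‖z‖ := Real.exp_le_exp.2 (hq1 z)
        have h3 : Real.exp (q z) ≤ 1 + q z + Real.exp ‖z‖ * q z ^ 2 := by
          nlinarith [sq_nonneg (q z)]
        calc _ ≤ gaussianS n z * (1 + q z + Real.exp ‖z‖ * q z ^ 2) :=
              mul_le_mul_of_nonneg_left h3 (hg.nonneg z)
          _ = _ := by ring
    _ = _ := by
        rw [integral_add i12 i2,
          integral_add (gaussianS n).integrable i1, hg.integral_eq_one]
        ring

end Step

end

section

/-! ### Testing the one-step inequality against a cutoff -/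

variable {n : ℕ}

/-- A Lipschitz cutoff function supported in `Δ(x₀,S)`. -/
structure IsCutoff (η : Rn n → ℝ) (x₀ : Rn n) (S m : ℝ) : Prop where
  nonneg : ∀ x, 0 ≤ η x
  le_one : ∀ x, η x ≤ 1
  eq_zero : ∀ x, x ∉ Metric.ball x₀ S → η x = 0
  lipschitz : ∀ x y, |η x - η y| ≤ m * ‖x - y‖

lemma continuous_of_abs_sub_le {g : Rn n → ℝ} {l : ℝ} (h : ∀ x y, |g x - g y| ≤ l * ‖x - y‖) :
    Continuous g :=
  (LipschitzWith.of_dist_le_mul (K := l.toNNReal) fun x y => by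
    rw [Real.dist_eq, dist_eq_norm]
    exact (h x y).trans (by gcongr; exact Real.le_coe_toNNReal l)).continuous

namespace IsCutoff

variable {η : Rn n → ℝ} {x₀ : Rn n} {S m : ℝ}

lemma continuous (hη : IsCutoff η x₀ S m) : Continuous η := continuous_of_abs_sub_le hη.lipschitz

lemma hasCompactSupport (hη : IsCutoff η x₀ S m) : HasCompactSupport η :=
  HasCompactSupport.intro (isCompact_closedBall x₀ S) fun x hx =>
    hη.eq_zero x fun h => hx (Metric.ball_subset_closedBall h)

lemma integrable_mul (hη : IsCutoff η x₀ S m) {g : Rn n → ℝ} (hg : Continuous g) :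
    Integrable fun x => η x * g x :=
  (hη.continuous.mul hg).integrable_of_hasCompactSupport hη.hasCompactSupport.mul_right

lemma integrable (hη : IsCutoff η x₀ S m) : Integrable η :=
  hη.continuous.integrable_of_hasCompactSupport hη.hasCompactSupport

lemma integrable_prod (hη : IsCutoff η x₀ S m) {g : Rn n → ℝ} {l c : ℝ} (hc : 0 ≤ c)
    (hg : ∀ x y, |g x - g y| ≤ l * ‖x - y‖) :
    Integrable (fun p : Rn n × Rn n => gaussianS n p.2 * (η p.1 * (g (p.1 - c • p.2) - g p.1)))
      ((volume : Measure (Rn n)).prod volume) := by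
  have hgc := continuous_of_abs_sub_le hg
  have h2 : Integrable fun z : Rn n => (l * c) * (‖z‖ ^ 1 * ‖gaussianS n z‖) :=
    ((gaussianS n).integrable_pow_mul volume 1).const_mul _
  have hψ : Continuous fun p : Rn n × Rn n => gaussianS n p.2 :=
    (gaussianS n).continuous.comp continuous_snd
  have hη1 := hη.continuous
  refine (hη.integrable.mul_prod h2).mono' (Continuous.aestronglyMeasurable (by fun_prop))
    (ae_of_all _ fun p => ?_)
  rw [norm_mul, norm_mul, Real.norm_of_nonneg (hη.nonneg _), Real.norm_eq_abs (g _ - g _)]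
  have h1 := hg (p.1 - c • p.2) p.1
  rw [sub_sub_cancel_left, norm_neg, norm_smul, Real.norm_of_nonneg hc] at h1
  calc _ ≤ ‖gaussianS n p.2‖ * (η p.1 * (l * (c * ‖p.2‖))) := by
        gcongr
        exact hη.nonneg _
    _ = _ := by ring

/-- Discrete integration by parts: translating the second integral by `v` turns the sum into the
integral of `(η x - η (x - v)) (g (x - v) - g x)`. Both factors are `O(‖v‖)`, and the integrand
lives on two balls, which explains the factor `2`. -/
lemma abs_integral_add_le (hη : IsCutoff η x₀ S m) (hm : 0 ≤ m) {g : Rn n → ℝ} {l : ℝ}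
    (hl : 0 ≤ l) (hg : ∀ x y, |g x - g y| ≤ l * ‖x - y‖) (v : Rn n) :
    |(∫ x, η x * (g (x - v) - g x)) + ∫ x, η x * (g (x + v) - g x)| ≤
      2 * (l * m * ‖v‖ ^ 2 * volume.real (Metric.ball x₀ S)) := by
  have hgc := continuous_of_abs_sub_le hg
  have i1 : Integrable fun x => η x * (g (x - v) - g x) := hη.integrable_mul (by fun_prop)
  have i2 : Integrable fun x => η x * (g (x + v) - g x) := hη.integrable_mul (by fun_prop)
  have i2' : Integrable fun x => η (x - v) * (g (x - v + v) - g (x - v)) := i2.comp_sub_right v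
  set B := Metric.ball x₀ S
  have iB : Integrable (B.indicator fun _ => (1 : ℝ)) :=
    (integrable_indicator_iff measurableSet_ball).2 (integrableOn_const measure_ball_lt_top.ne)
  have iB' : Integrable fun x => B.indicator (fun _ => (1 : ℝ)) (x - v) := iB.comp_sub_right v
  have eB : ∫ x, B.indicator (fun _ => (1 : ℝ)) x = volume.real B := by
    rw [integral_indicator measurableSet_ball]; simp [B]
  rw [← integral_sub_right_eq_self (fun x => η x * (g (x + v) - g x)) v, ← integral_add i1 i2',
    ← Real.norm_eq_abs]
  refine (norm_integral_le_of_norm_le (g := fun x => (m * ‖v‖ * (l * ‖v‖)) *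
    (B.indicator (fun _ => (1 : ℝ)) x + B.indicator (fun _ => (1 : ℝ)) (x - v)))
    ((iB.add iB').const_mul _) (ae_of_all _ fun x => ?_)).trans_eq ?_
  · have h0 : η x * (g (x - v) - g x) + η (x - v) * (g (x - v + v) - g (x - v)) =
        (η x - η (x - v)) * (g (x - v) - g x) := by rw [sub_add_cancel]; ring
    rw [h0, norm_mul, Real.norm_eq_abs, Real.norm_eq_abs]
    have h1 := hη.lipschitz x (x - v)
    have h2 := hg (x - v) x
    rw [sub_sub_cancel] at h1
    rw [sub_sub_cancel_left, norm_neg] at h2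
    have hI : ∀ y, 0 ≤ B.indicator (fun _ => (1 : ℝ)) y := fun y =>
      indicator_nonneg (fun _ _ => zero_le_one) y
    have hmain : |η x - η (x - v)| * |g (x - v) - g x| ≤ m * ‖v‖ * (l * ‖v‖) := by gcongr
    have hpos : 0 ≤ m * ‖v‖ * (l * ‖v‖) := by positivity
    by_cases hx : x ∈ B
    · refine hmain.trans (le_mul_of_one_le_right hpos ?_)
      rw [indicator_of_mem hx]
      linarith [hI (x - v)]
    · by_cases hx' : x - v ∈ B
      · refine hmain.trans (le_mul_of_one_le_right hpos ?_)
        rw [indicator_of_mem hx']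
        linarith [hI x]
      · rw [hη.eq_zero x hx, hη.eq_zero _ hx']
        simp only [sub_zero, abs_zero, zero_mul]
        have := hI x
        have := hI (x - v)
        positivity
  · rw [integral_const_mul, integral_add iB iB',
      integral_sub_right_eq_self (B.indicator fun _ => (1 : ℝ)), eB]
    ring

/-- The Gaussian is even, so `z` and `-z` may be averaged; the first-order term cancels and a gain
of `c ^ 2` remains. -/
lemma abs_integral_mul_integral_le (hη : IsCutoff η x₀ S m) (hm : 0 ≤ m) {g : Rn n → ℝ} {l c : ℝ}
    (hl : 0 ≤ l) (hc : 0 ≤ c) (hg : ∀ x y, |g x - g y| ≤ l * ‖x - y‖) :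
    |∫ x, η x * ∫ z, gaussianS n z * (g (x - c • z) - g x)| ≤
      l * m * c ^ 2 * (∫ z, ‖z‖ ^ 2 * ‖gaussianS n z‖) * volume.real (Metric.ball x₀ S) := by
  have hi := hη.integrable_prod hc hg
  obtain ⟨A, hA⟩ : ∃ A : Rn n → ℝ, A = fun z => ∫ x, η x * (g (x - c • z) - g x) := ⟨_, rfl⟩
  have e0 : ∀ x, η x * ∫ z, gaussianS n z * (g (x - c • z) - g x) =
      ∫ z, gaussianS n z * (η x * (g (x - c • z) - g x)) := fun x => by
    rw [← integral_const_mul]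
    congr 1; ext z; ring
  have e1 : ∀ z, ∫ x, gaussianS n z * (η x * (g (x - c • z) - g x)) = gaussianS n z * A z :=
    fun z => by rw [integral_const_mul, hA]
  have hiA : Integrable fun z => gaussianS n z * A z := by
    have := hi.integral_prod_right
    simp only [e1] at this
    exact this
  have e2 : ∫ x, η x * ∫ z, gaussianS n z * (g (x - c • z) - g x) = ∫ z, gaussianS n z * A z := by
    simp_rw [e0]
    rw [integral_integral_swap hi]
    simp_rw [e1]
  have hev : ∀ z, gaussianS n (-z) = gaussianS n z := fun z => by
    rw [coe_gaussianS]; simp [gaussian]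
  have hiA' : Integrable fun z => gaussianS n z * A (-z) := by
    have := hiA.comp_neg
    simpa only [hev] using this
  have e3 : ∫ z, gaussianS n z * A (-z) = ∫ z, gaussianS n z * A z := by
    rw [← integral_neg_eq_self fun z => gaussianS n z * A z]
    simp_rw [hev]
  rw [e2]
  have e4 : 2 * ∫ z, gaussianS n z * A z = ∫ z, gaussianS n z * (A z + A (-z)) := by
    simp_rw [mul_add]
    rw [integral_add hiA hiA', e3, two_mul]
  have h5 : |2 * ∫ z, gaussianS n z * A z| ≤ ∫ z, (2 * (l * m * c ^ 2 *
      volume.real (Metric.ball x₀ S))) * (‖z‖ ^ 2 * ‖gaussianS n z‖) := by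
    have h8 : Integrable fun z : Rn n => (2 * (l * m * c ^ 2 *
        volume.real (Metric.ball x₀ S))) * (‖z‖ ^ 2 * ‖gaussianS n z‖) :=
      ((gaussianS n).integrable_pow_mul volume 2).const_mul _
    rw [e4, ← Real.norm_eq_abs]
    refine norm_integral_le_of_norm_le h8 (ae_of_all _ fun z => ?_)
    have h6 := hη.abs_integral_add_le hm hl hg (c • z)
    have h7 : A z + A (-z) = (∫ x, η x * (g (x - c • z) - g x)) +
        ∫ x, η x * (g (x + c • z) - g x) := by
      rw [hA]; simp only [smul_neg, sub_neg_eq_add]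
    rw [norm_mul, h7, Real.norm_eq_abs (_ + _)]
    refine (mul_le_mul_of_nonneg_left h6 (norm_nonneg _)).trans_eq ?_
    rw [norm_smul, Real.norm_of_nonneg hc]; ring
  rw [integral_const_mul, abs_mul, abs_two] at h5
  nlinarith [h5]

end IsCutoff

lemma ofReal_integral_le {α : Type*} [MeasurableSpace α] {μ : Measure α} (f : α → ℝ) :
    ENNReal.ofReal (∫ x, f x ∂μ) ≤ ∫⁻ x, ENNReal.ofReal (f x) ∂μ := by
  by_cases hf : Integrable f μ
  · rw [integral_eq_lintegral_pos_part_sub_lintegral_neg_part hf]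
    refine (ENNReal.ofReal_le_ofReal (sub_le_self _ ENNReal.toReal_nonneg)).trans
      ENNReal.ofReal_toReal_le
  · rw [integral_undef hf]; simp

/-! ### The quadratic term and the gradient energy. -/

section Quadratic

variable {ν : Measure (Rn n)} {K : ℝ≥0} [IsLocallyFiniteMeasure ν]

/-- The fundamental theorem of calculus along the segment, then Cauchy–Schwarz in the parameter. -/
lemma IsDoublingWith.sq_logConv_sub_le (h : IsDoublingWith ν K) {ρ : ℝ} (hρ : 0 < ρ) (x v : Rn n) :
    ENNReal.ofReal ((logConv ν ρ (x - v) - logConv ν ρ x) ^ 2) ≤ ENNReal.ofReal (‖v‖ ^ 2) *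
      ∫⁻ τ in Ioo (0 : ℝ) 1, ENNReal.ofReal (logGrad ν (gaussianS n) (x + τ • (-v)) ρ) ^ 2 := by
  have hg := isGood_gaussianS n
  obtain ⟨D, hD⟩ : ∃ D : Rn n → (Rn n →L[ℝ] ℝ), D = fun y => (conv ν (gaussianS n) ρ y)⁻¹ • ρ⁻¹ •
    conv ν (fderiv ℝ (gaussianS n)) ρ y := ⟨_, rfl⟩
  have hDc : Continuous D := by
    rw [hD]
    exact ((h.continuous_conv _ hρ).inv₀ fun y => (hg.conv_pos h hρ y).ne').smul
      ((h.continuous_conv (SchwartzMap.fderivCLM ℝ (Rn n) ℝ (gaussianS n)) hρ).const_smul ρ⁻¹)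
  have hDn : ∀ y, ‖D y‖ = logGrad ν (gaussianS n) y ρ := fun y => by
    rw [hD]; exact hg.norm_fderiv_log h hρ y
  have hder : ∀ τ : ℝ, HasDerivAt (fun τ : ℝ => logConv ν ρ (x + τ • (-v)))
      (D (x + τ • (-v)) (-v)) τ := fun τ => by
    have h1 : HasFDerivAt (logConv ν ρ) (D (x + τ • (-v))) (x + τ • (-v)) := by
      rw [hD]; exact hg.hasFDerivAt_log h hρ _
    have h2 : HasDerivAt (fun τ : ℝ => x + τ • (-v)) (-v) τ := by
      simpa using ((hasDerivAt_id τ).smul_const (-v)).const_add x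
    exact h1.comp_hasDerivAt τ h2
  have hcont : Continuous fun τ : ℝ => D (x + τ • (-v)) (-v) :=
    (hDc.comp (by fun_prop)).clm_apply continuous_const
  have hftc := intervalIntegral.integral_eq_sub_of_hasDerivAt (a := 0) (b := 1)
    (fun τ _ => hder τ) (hcont.intervalIntegrable _ _)
  rw [one_smul, zero_smul, add_zero, ← sub_eq_add_neg, intervalIntegral.integral_of_le zero_le_one,
    integral_Ioc_eq_integral_Ioo] at hftc
  have hm : Measurable fun τ : ℝ => ENNReal.ofReal (logGrad ν (gaussianS n) (x + τ • (-v)) ρ) := by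
    simp_rw [← hDn]
    exact (hDc.comp (by fun_prop)).norm.measurable.ennreal_ofReal
  have h1 : ENNReal.ofReal |logConv ν ρ (x - v) - logConv ν ρ x| ≤ ENNReal.ofReal ‖v‖ *
      ∫⁻ τ in Ioo (0 : ℝ) 1, 1 * ENNReal.ofReal (logGrad ν (gaussianS n) (x + τ • (-v)) ρ) := by
    rw [← hftc, ← Real.norm_eq_abs, ofReal_norm, ← lintegral_const_mul' _ _ ENNReal.ofReal_ne_top]
    refine (enorm_integral_le_lintegral_enorm _).trans (lintegral_mono fun τ => ?_)
    rw [one_mul, ← hDn, ← ENNReal.ofReal_mul (norm_nonneg _), ← ofReal_norm, mul_comm]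
    refine ENNReal.ofReal_le_ofReal ?_
    simpa using (D (x + τ • (-v))).le_opNorm (-v)
  have h2 := sq_lintegral_mul_le (volume.restrict (Ioo (0 : ℝ) 1)) (a := fun _ => 1)
    aemeasurable_const hm.aemeasurable
  simp only [one_mul, lintegral_one, Measure.restrict_apply_univ, Real.volume_Ioo, sub_zero,
    ENNReal.ofReal_one] at h1 h2
  rw [← sq_abs, ENNReal.ofReal_pow (abs_nonneg _), ENNReal.ofReal_pow (norm_nonneg _)]
  refine (pow_le_pow_left' h1 2).trans ?_
  rw [mul_pow]
  gcongr

/-- Weighted average over dilated balls of the squared logarithmic gradient at scale `ρ`. -/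
def gradEnergy (ν : Measure (Rn n)) (x₀ : Rn n) (S ρ : ℝ) : ℝ≥0∞ :=
  ∫⁻ z : Rn n, ENNReal.ofReal (wt (n + (n + 1)) z) *
    ∫⁻ y in Metric.ball x₀ ((1 + ‖z‖) * S), ENNReal.ofReal (logGrad ν (gaussianS n) y ρ) ^ 2

lemma exists_lintegral_sq_logConv_sub_le (n : ℕ) : ∃ C : ℝ, 0 ≤ C ∧
    ∀ (ν : Measure (Rn n)) [IsLocallyFiniteMeasure ν] (K : ℝ≥0), IsDoublingWith ν K →
    ∀ (x₀ : Rn n) (S ρ : ℝ), 0 < ρ → √3 * ρ ≤ S →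
      ∫⁻ x in Metric.ball x₀ S, ∫⁻ z, ENNReal.ofReal (gaussianS n z * (Real.exp ‖z‖ *
        (logConv ν ρ (x - (√3 * ρ) • z) - logConv ν ρ x) ^ 2)) ≤
      ENNReal.ofReal (C * ρ ^ 2) * gradEnergy ν x₀ S ρ := by
  obtain ⟨C, hC0, hC⟩ := exists_gaussian_mul_exp_le (n := n) (n + (n + 1) + 2)
  refine ⟨C * 3, by positivity, fun ν _ K h x₀ S ρ hρ hS => ?_⟩
  set c := √3 * ρ with hc
  have hc0 : 0 < c := by positivity
  have hc2 : c ^ 2 = 3 * ρ ^ 2 := by rw [hc, mul_pow, Real.sq_sqrt (by norm_num)]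
  obtain ⟨H, hH⟩ : ∃ H : Rn n → ℝ≥0∞, H = fun y => ENNReal.ofReal (logGrad ν (gaussianS n) y ρ) ^ 2 :=
    ⟨_, rfl⟩
  have hHm : Measurable H := by
    rw [hH]
    exact (measurable_sq_logGrad ν (gaussianS n)).comp (measurable_id.prodMk measurable_const)
  have h1 : ∀ x z, ENNReal.ofReal (gaussianS n z * (Real.exp ‖z‖ *
      (logConv ν ρ (x - c • z) - logConv ν ρ x) ^ 2)) ≤
      ENNReal.ofReal (C * 3 * ρ ^ 2) * (ENNReal.ofReal (wt (n + (n + 1)) z) *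
        ∫⁻ τ in Ioo (0 : ℝ) 1, H (x + (τ * c) • (-z))) := by
    intro x z
    have h2 := h.sq_logConv_sub_le hρ x (c • z)
    have hψ := (isGood_gaussianS n).nonneg z
    rw [← mul_assoc, ENNReal.ofReal_mul (by positivity)]
    refine (mul_le_mul_right h2 _).trans ?_
    rw [← mul_assoc, ← mul_assoc, ← ENNReal.ofReal_mul (by positivity),
      ← ENNReal.ofReal_mul (by positivity)]
    have e : ∀ τ : ℝ, τ • -(c • z) = (τ * c) • (-z) := fun τ => by rw [smul_neg, smul_neg, smul_smul]
    simp_rw [e, hH]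
    gcongr ENNReal.ofReal ?_ * _
    rw [norm_smul, Real.norm_of_nonneg hc0.le, mul_pow, hc2]
    have h3 := hC z
    have h4 : ‖z‖ ^ 2 * wt (n + (n + 1) + 2) z ≤ wt (n + (n + 1)) z := by
      rw [← pow_mul_wt 2 (n + (n + 1)), add_comm 2]
      gcongr
      · exact wt_nonneg _ _
      · linarith
    calc _ = 3 * ρ ^ 2 * ((gaussianS n z * Real.exp ‖z‖) * ‖z‖ ^ 2) := by ring
      _ ≤ 3 * ρ ^ 2 * ((C * wt (n + (n + 1) + 2) z) * ‖z‖ ^ 2) := by gcongr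
      _ = C * 3 * ρ ^ 2 * (‖z‖ ^ 2 * wt (n + (n + 1) + 2) z) := by ring
      _ ≤ _ := by gcongr
  have hm3 : Measurable fun q : (Rn n × Rn n) × ℝ => H (q.1.1 + (q.2 * c) • (-q.1.2)) :=
    hHm.comp (by fun_prop)
  have hm2 : Measurable fun q : Rn n × Rn n => ∫⁻ τ in Ioo (0 : ℝ) 1, H (q.1 + (τ * c) • (-q.2)) :=
    hm3.lintegral_prod_right'
  have hwm : Measurable fun q : Rn n × Rn n => ENNReal.ofReal (wt (n + (n + 1)) q.2) :=
    (continuous_wt _).measurable.ennreal_ofReal.comp measurable_snd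
  calc _ ≤ ∫⁻ x in Metric.ball x₀ S, ∫⁻ z, ENNReal.ofReal (C * 3 * ρ ^ 2) *
        (ENNReal.ofReal (wt (n + (n + 1)) z) * ∫⁻ τ in Ioo (0 : ℝ) 1, H (x + (τ * c) • (-z))) :=
        lintegral_mono fun x => lintegral_mono fun z => h1 x z
    _ = ENNReal.ofReal (C * 3 * ρ ^ 2) * ∫⁻ z, ENNReal.ofReal (wt (n + (n + 1)) z) *
        ∫⁻ τ in Ioo (0 : ℝ) 1, ∫⁻ x in Metric.ball x₀ S, H (x + (τ * c) • (-z)) := by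
        simp_rw [lintegral_const_mul' _ _ ENNReal.ofReal_ne_top]
        rw [lintegral_lintegral_swap (hwm.mul hm2).aemeasurable]
        congr 2; ext z
        rw [lintegral_const_mul' _ _ ENNReal.ofReal_ne_top, lintegral_lintegral_swap]
        exact (hHm.comp (by fun_prop)).aemeasurable
    _ ≤ _ := by
        rw [gradEnergy]
        gcongr with z
        have h5 : ∀ τ ∈ Ioo (0 : ℝ) 1, ∫⁻ x in Metric.ball x₀ S, H (x + (τ * c) • (-z)) ≤
            ∫⁻ y in Metric.ball x₀ ((1 + ‖z‖) * S), H y := fun τ hτ => by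
          have := setLIntegral_ball_add_smul_le H x₀ (-z) (s := τ * c) (R := S)
            (mul_nonneg hτ.1.le hc0.le) ((mul_le_of_le_one_left hc0.le hτ.2.le).trans hS)
          rwa [norm_neg] at this
        refine (setLIntegral_mono measurable_const h5).trans_eq ?_
        rw [setLIntegral_const, Real.volume_Ioo, sub_zero, ENNReal.ofReal_one, mul_one, hH]

end Quadratic

end

section

/-! ### Telescoping over dyadic scales -/

variable {n : ℕ}

/-- At scale `ρ` the Lipschitz constant of `log u_ρ` is `Λ/ρ` and the step is `c = √3 ρ`, so the
linear term is of order `(Λ/ρ) m ρ² = Λ m ρ`, summable over dyadic `ρ`. The quadratic term is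
non-negative, so the cutoff is bounded there by one. -/
lemma exists_integral_logConv_two_mul_sub_le (n : ℕ) : ∃ C : ℝ, 0 ≤ C ∧
    ∀ (ν : Measure (Rn n)) [IsLocallyFiniteMeasure ν] (K : ℝ≥0), IsDoublingWith ν K →
    ∀ (Λ : ℝ), 0 ≤ Λ → √3 * Λ ≤ 1 → (∀ x r, 0 < r → r * logGrad ν (gaussianS n) x r ≤ Λ) →
    ∀ (η : Rn n → ℝ) (x₀ : Rn n) (S m : ℝ), 0 ≤ m → IsCutoff η x₀ S m →
    ∀ ρ : ℝ, 0 < ρ → √3 * ρ ≤ S →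
      ENNReal.ofReal ((∫ x, η x * logConv ν (2 * ρ) x) - ∫ x, η x * logConv ν ρ x) ≤
        ENNReal.ofReal (C * (Λ * m * volume.real (Metric.ball x₀ S)) * ρ) +
          ENNReal.ofReal C * (ENNReal.ofReal (ρ ^ 2) * gradEnergy ν x₀ S ρ) := by
  obtain ⟨C, hC0, hC⟩ := exists_lintegral_sq_logConv_sub_le n
  set M := ∫ z, ‖z‖ ^ 2 * ‖gaussianS n z‖ with hM
  have hM0 : 0 ≤ M := integral_nonneg fun z => by positivity
  refine ⟨C + 3 * M, by positivity, fun ν _ K h Λ hΛ hΛ1 hgrad η x₀ S m hm hη ρ hρ hS => ?_⟩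
  have hg := isGood_gaussianS n
  have hl : ∀ x, logGrad ν (gaussianS n) x ρ ≤ Λ / ρ := fun x => by
    rw [le_div_iff₀' hρ]; exact hgrad x ρ hρ
  have hl0 : 0 ≤ Λ / ρ := by positivity
  set c := √3 * ρ with hc
  have hc0 : 0 ≤ c := by positivity
  have hl2 : Λ / ρ * c ≤ 1 := by
    rw [hc]
    calc _ = √3 * Λ := by field_simp
      _ ≤ 1 := hΛ1
  obtain ⟨A, hA⟩ : ∃ A : Rn n → ℝ, A = fun x =>
    ∫ z, gaussianS n z * (logConv ν ρ (x - c • z) - logConv ν ρ x) := ⟨_, rfl⟩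
  have hlip := h.abs_logConv_sub_le hρ hl
  have iA : Integrable fun x => η x * A x := by
    have := (hη.integrable_prod hc0 hlip).integral_prod_left
    refine this.congr (ae_of_all _ fun x => ?_)
    simp only [hA]
    rw [← integral_const_mul]
    congr 1; ext z; ring
  have hA1 : |∫ x, η x * A x| ≤ 3 * M * (Λ * m * volume.real (Metric.ball x₀ S)) * ρ := by
    rw [hA]
    refine (hη.abs_integral_mul_integral_le hm hl0 hc0 hlip).trans_eq ?_
    rw [hc, mul_pow, Real.sq_sqrt (by norm_num), ← hM]
    field_simp
  have i2 : Integrable fun x => η x * logConv ν (2 * ρ) x :=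
    hη.integrable_mul (h.continuous_logConv (by positivity))
  have i1 : Integrable fun x => η x * logConv ν ρ x :=
    hη.integrable_mul (h.continuous_logConv hρ)
  have i21 : Integrable fun x => η x * logConv ν (2 * ρ) x - η x * logConv ν ρ x := i2.sub i1
  have e : (∫ x, η x * logConv ν (2 * ρ) x) - ∫ x, η x * logConv ν ρ x =
      (∫ x, η x * A x) + ∫ x, (η x * logConv ν (2 * ρ) x - η x * logConv ν ρ x - η x * A x) := by
    rw [integral_sub i21 iA, integral_sub i2 i1]; ring
  rw [e]
  refine ENNReal.ofReal_add_le.trans (add_le_add ?_ ?_)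
  · refine ENNReal.ofReal_le_ofReal ((le_abs_self _).trans (hA1.trans ?_))
    gcongr
    linarith
  · refine (ofReal_integral_le _).trans ?_
    have h1 : ∀ x, ENNReal.ofReal (η x * logConv ν (2 * ρ) x - η x * logConv ν ρ x - η x * A x) ≤
        (Metric.ball x₀ S).indicator (fun x => ∫⁻ z, ENNReal.ofReal (gaussianS n z *
          (Real.exp ‖z‖ * (logConv ν ρ (x - c • z) - logConv ν ρ x) ^ 2))) x := by
      intro x
      by_cases hx : x ∈ Metric.ball x₀ S
      · rw [indicator_of_mem hx]
        refine le_trans (ENNReal.ofReal_le_ofReal ?_) (ofReal_integral_le _)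
        have h2 := h.logConv_two_mul_sub_le hρ hl hl2 x
        have h3 : 0 ≤ ∫ z, gaussianS n z * (Real.exp ‖z‖ *
            (logConv ν ρ (x - c • z) - logConv ν ρ x) ^ 2) :=
          integral_nonneg fun z => mul_nonneg (hg.nonneg z) (by positivity)
        have h4 := congrFun hA x
        rw [← hc, ← h4] at h2
        have h5 := hη.nonneg x
        have h6 := hη.le_one x
        nlinarith [mul_le_mul_of_nonneg_left h2 h5, mul_le_mul_of_nonneg_right h6 h3]
      · rw [hη.eq_zero x hx]; simp
    refine (lintegral_mono h1).trans ?_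
    rw [lintegral_indicator measurableSet_ball]
    refine (hC ν K h x₀ S ρ hρ hS).trans ?_
    rw [← mul_assoc, ← ENNReal.ofReal_mul (by positivity)]
    gcongr
    linarith

/-! ### Summation of the energies over dyadic scales. -/

section Energy

variable (ν : Measure (Rn n)) [SFinite ν]

lemma measurable_sq_logGrad_ball (x₀ : Rn n) (S : ℝ) : Measurable fun p : ℝ × Rn n =>
    ∫⁻ y in Metric.ball x₀ ((1 + ‖p.2‖) * S), ENNReal.ofReal (logGrad ν (gaussianS n) y p.1) ^ 2 := by
  have hS : MeasurableSet {q : (ℝ × Rn n) × Rn n | dist q.2 x₀ < (1 + ‖q.1.2‖) * S} :=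
    measurableSet_lt (by fun_prop) (by fun_prop)
  have h0 := (((measurable_sq_logGrad ν (gaussianS n)).comp
    (f := fun q : (ℝ × Rn n) × Rn n => (q.2, q.1.1)) (by fun_prop)).indicator
      hS).lintegral_prod_right' (ν := (volume : Measure (Rn n)))
  convert h0 using 2 with p
  rw [← lintegral_indicator measurableSet_ball]
  rfl

lemma measurable_gradEnergy (x₀ : Rn n) (S : ℝ) : Measurable (gradEnergy ν x₀ S) :=
  (((continuous_wt (n := n) (n + (n + 1))).measurable.ennreal_ofReal.comp measurable_snd).mul
    (measurable_sq_logGrad_ball ν x₀ S)).lintegral_prod_right'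

lemma lintegral_gradEnergy_le (x₀ : Rn n) {S r : ℝ} (hr : 0 < r) (hrS : r ≤ S) :
    ∫⁻ s in Ioo 0 r, ENNReal.ofReal s * gradEnergy ν x₀ S s ≤
      (∫⁻ y : Rn n, ENNReal.ofReal (wt (n + 1) y)) *
        (boxNorm ν (gaussianS n) * volume (Metric.ball x₀ S)) := by
  refine le_trans ?_ (lintegral_wt_mul_boxMass_le ν (gaussianS n) x₀ (hr.trans_le hrS))
  have e : ∀ s, ENNReal.ofReal s * gradEnergy ν x₀ S s = ∫⁻ z : Rn n, ENNReal.ofReal s *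
      (ENNReal.ofReal (wt (n + (n + 1)) z) * ∫⁻ y in Metric.ball x₀ ((1 + ‖z‖) * S),
        ENNReal.ofReal (logGrad ν (gaussianS n) y s) ^ 2) := fun s => by
    rw [gradEnergy, lintegral_const_mul' _ _ ENNReal.ofReal_ne_top]
  simp_rw [e]
  have hm := measurable_sq_logGrad_ball ν x₀ S
  have hw := (continuous_wt (n := n) (n + (n + 1))).measurable.ennreal_ofReal
  rw [lintegral_lintegral_swap]
  · refine lintegral_mono fun z => ?_
    rw [boxMass_eq, ← lintegral_const_mul' _ _ ENNReal.ofReal_ne_top]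
    have h1 : r ≤ (1 + ‖z‖) * S := by nlinarith [norm_nonneg z]
    refine (lintegral_mono_set (Ioo_subset_Ioo_right h1)).trans_eq ?_
    congr 1; ext s; ring
  · exact (measurable_fst.ennreal_ofReal.mul ((hw.comp measurable_snd).mul hm)).aemeasurable

/-- As `t` runs over `(r/2, r)`, the scales `s = t / 2^(k+1)` sweep disjoint intervals in `(0, r)`.
The Jacobian is `2^(k+1)`, and `2^(k+1) s ≤ r` turns `s²` into `r s`. -/
lemma lintegral_tsum_gradEnergy_le (x₀ : Rn n) (S : ℝ) {r : ℝ} (hr : 0 < r) :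
    ∫⁻ t in Ioo (r / 2) r, ∑' k : ℕ,
      ENNReal.ofReal ((((2 : ℝ) ^ (k + 1))⁻¹ * t) ^ 2) * gradEnergy ν x₀ S ((2 ^ (k + 1))⁻¹ * t) ≤
      ENNReal.ofReal r * ∫⁻ s in Ioo 0 r, ENNReal.ofReal s * gradEnergy ν x₀ S s := by
  obtain ⟨H, hH⟩ : ∃ H : ℝ → ℝ≥0∞, H = fun s => ENNReal.ofReal (s ^ 2) * gradEnergy ν x₀ S s :=
    ⟨_, rfl⟩
  have hG := measurable_gradEnergy ν x₀ S
  have hHm : Measurable H := by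
    rw [hH]; exact (measurable_id.pow_const 2).ennreal_ofReal.mul hG
  have e : ∀ (k : ℕ) (t : ℝ), ENNReal.ofReal ((((2 : ℝ) ^ (k + 1))⁻¹ * t) ^ 2) *
      gradEnergy ν x₀ S ((2 ^ (k + 1))⁻¹ * t) = H ((2 ^ (k + 1))⁻¹ * t) := fun k t => by rw [hH]
  simp_rw [e]
  have hHk : ∀ k : ℕ, Measurable fun t : ℝ => H ((2 ^ (k + 1))⁻¹ * t) := fun k =>
    hHm.comp (measurable_const_mul _)
  rw [lintegral_tsum fun k => (hHk k).aemeasurable]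
  obtain ⟨a, ha⟩ : ∃ a : ℕ → ℝ, a = fun k => (2 ^ (k + 1))⁻¹ * r := ⟨_, rfl⟩
  have ha0 : ∀ k, 0 < a k := fun k => by rw [ha]; positivity
  have hanti : Antitone a := antitone_nat_of_succ_le fun k => by
    rw [ha]; simp only
    gcongr
    · norm_num
    · omega
  have hk : ∀ k : ℕ, ∫⁻ t in Ioo (r / 2) r, H ((2 ^ (k + 1))⁻¹ * t) ≤
      ENNReal.ofReal r * ∫⁻ s in Ioo (a (Order.succ k)) (a k),
        ENNReal.ofReal s * gradEnergy ν x₀ S s := by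
    intro k
    rw [setLIntegral_comp_mul_left hHm (by positivity), ← lintegral_const_mul' _ _
      ENNReal.ofReal_ne_top, ← lintegral_const_mul' _ _ ENNReal.ofReal_ne_top]
    have e1 : ((2 : ℝ) ^ (k + 1))⁻¹ * (r / 2) = a (Order.succ k) := by
      rw [ha]; simp only [Nat.succ_eq_succ, Nat.succ_eq_add_one]
      rw [pow_succ _ (k + 1), mul_inv]; ring
    have e2 : ((2 : ℝ) ^ (k + 1))⁻¹ * r = a k := by rw [ha]
    rw [e1, e2]
    refine setLIntegral_mono ((measurable_id.ennreal_ofReal.mul hG).const_mul _) fun s hs => ?_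
    have hs0 : 0 < s := (ha0 _).trans hs.1
    rw [hH]
    simp only
    rw [← mul_assoc, ← mul_assoc, ← ENNReal.ofReal_mul (by positivity), ← ENNReal.ofReal_mul hr.le]
    refine mul_le_mul_left (ENNReal.ofReal_le_ofReal ?_) _
    rw [inv_inv]
    have h1 : s ≤ (2 ^ (k + 1))⁻¹ * r := hs.2.le.trans_eq e2.symm
    rw [inv_mul_eq_div, le_div_iff₀' (by positivity)] at h1
    calc _ = 2 ^ (k + 1) * s * s := by ring
      _ ≤ _ := by gcongr
  refine (ENNReal.tsum_le_tsum hk).trans ?_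
  rw [ENNReal.tsum_mul_left, ← lintegral_iUnion (fun k => measurableSet_Ioo)
    hanti.pairwise_disjoint_on_Ioo_succ]
  gcongr
  refine iUnion_subset fun k s hs => ⟨(ha0 _).trans hs.1, hs.2.trans_le ?_⟩
  rw [ha]
  exact mul_le_of_le_one_left hr.le (inv_le_one_of_one_le₀ (one_le_pow₀ one_le_two))

end Energy

/-- Along a suitable dyadic sequence of scales, the average of the logarithm drops only a little. -/
theorem exists_integral_logConv_sub_le (n : ℕ) : ∃ C : ℝ, 0 ≤ C ∧
    ∀ (ν : Measure (Rn n)) [IsLocallyFiniteMeasure ν] (K : ℝ≥0), IsDoublingWith ν K →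
    ∀ (Λ N : ℝ), 0 ≤ Λ → √3 * Λ ≤ 1 → 0 ≤ N →
    (∀ x r, 0 < r → r * logGrad ν (gaussianS n) x r ≤ Λ) →
    boxNorm ν (gaussianS n) ≤ ENNReal.ofReal N →
    ∀ (η : Rn n → ℝ) (x₀ : Rn n) (S m : ℝ), 0 ≤ m → IsCutoff η x₀ S m →
    ∀ r : ℝ, 0 < r → √3 * r ≤ S → ∃ t ∈ Ioo (r / 2) r, ∀ k : ℕ,
      (∫ x, η x * logConv ν t x) - ∫ x, η x * logConv ν (t / 2 ^ k) x ≤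
        C * (Λ * m * r + N) * volume.real (Metric.ball x₀ S) := by
  obtain ⟨C, hC0, hC⟩ := exists_integral_logConv_two_mul_sub_le n
  set I := ∫⁻ y : Rn n, ENNReal.ofReal (wt (n + 1) y) with hI
  have hIt : I ≠ ⊤ := lintegral_wt_ne_top le_rfl
  have hI0 : 0 ≤ I.toReal := ENNReal.toReal_nonneg
  refine ⟨C + C * 2 * I.toReal, by positivity,
    fun ν _ K h Λ N hΛ hΛ1 hN hgrad hbox η x₀ S m hm hη r hr hS => ?_⟩
  have h3 : 1 ≤ √3 := Real.one_le_sqrt.2 (by norm_num)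
  have hrS : r ≤ S := by nlinarith
  set V := volume.real (Metric.ball x₀ S) with hV
  have hV0 : 0 ≤ V := measureReal_nonneg
  have hVe : volume (Metric.ball x₀ S) = ENNReal.ofReal V := by
    rw [hV, ofReal_measureReal measure_ball_lt_top.ne]
  obtain ⟨F, hF⟩ : ∃ F : ℝ → ℝ≥0∞, F = fun t => ∑' k : ℕ,
      ENNReal.ofReal ((((2 : ℝ) ^ (k + 1))⁻¹ * t) ^ 2) * gradEnergy ν x₀ S ((2 ^ (k + 1))⁻¹ * t) :=
    ⟨_, rfl⟩
  have hG := measurable_gradEnergy ν x₀ S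
  have hFm : Measurable F := by
    rw [hF]
    exact Measurable.tsum fun k => (((measurable_const_mul _).pow_const 2).ennreal_ofReal).mul
      (hG.comp (measurable_const_mul _))
  have hvol : volume (Ioo (r / 2) r) = ENNReal.ofReal (r / 2) := by
    rw [Real.volume_Ioo]; congr 1; ring
  -- The Carleson norm controls the energies only on average over scales, so `t` is chosen where
  -- their dyadic sum does not exceed its mean.
  obtain ⟨t, ht, hFt⟩ := exists_le_setLAverage (μ := volume) (s := Ioo (r / 2) r) (f := F)
    (by rw [hvol]; simpa using hr) (by rw [hvol]; simp) hFm.aemeasurable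
  have hFt2 : F t ≤ ENNReal.ofReal (2 * I.toReal * N * V) := by
    refine hFt.trans ?_
    rw [setLAverage_eq, hvol, ENNReal.div_le_iff (by simpa using hr) (by simp)]
    rw [hF]
    refine (lintegral_tsum_gradEnergy_le ν x₀ S hr).trans ?_
    refine (mul_le_mul_right (lintegral_gradEnergy_le ν x₀ hr hrS) _).trans ?_
    rw [← hI, ← ENNReal.ofReal_toReal hIt, hVe]
    refine (mul_le_mul_right (mul_le_mul_right (mul_le_mul_left hbox _) _) _).trans_eq ?_
    rw [← ENNReal.ofReal_mul hN, ← ENNReal.ofReal_mul hI0, ← ENNReal.ofReal_mul hr.le,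
      ← ENNReal.ofReal_mul (by positivity)]
    congr 1
    rw [ENNReal.toReal_ofReal hI0]; ring
  have ht0 : 0 < t := by linarith [ht.1]
  refine ⟨t, ht, fun k => ?_⟩
  -- The linear errors telescope exactly, because the scales `t / 2^(j+1)` for `j < k` add up to `t
  -- - t / 2^k`.
  have key : ∀ k : ℕ, ENNReal.ofReal ((∫ x, η x * logConv ν t x) - ∫ x, η x * logConv ν (t / 2 ^ k) x) ≤
      ENNReal.ofReal (C * (Λ * m * V) * (t - t / 2 ^ k)) + ENNReal.ofReal C * ∑ j ∈ Finset.range k,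
        ENNReal.ofReal ((((2 : ℝ) ^ (j + 1))⁻¹ * t) ^ 2) *
          gradEnergy ν x₀ S ((2 ^ (j + 1))⁻¹ * t) := by
    intro k
    induction k with
    | zero => simp
    | succ k ih =>
      have hρ : 0 < (2 ^ (k + 1))⁻¹ * t := by positivity
      have e1 : 2 * ((2 ^ (k + 1))⁻¹ * t) = t / 2 ^ k := by rw [pow_succ]; field_simp
      have e2 : t / 2 ^ (k + 1) = (2 ^ (k + 1))⁻¹ * t := by rw [inv_mul_eq_div]
      have h1 : (2 ^ (k + 1))⁻¹ * t ≤ r :=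
        (mul_le_of_le_one_left ht0.le (inv_le_one_of_one_le₀ (one_le_pow₀ one_le_two))).trans ht.2.le
      have h2 := hC ν K h Λ hΛ hΛ1 hgrad η x₀ S m hm hη _ hρ
        ((mul_le_mul_of_nonneg_left h1 (by positivity)).trans hS)
      rw [e1] at h2
      have e3 : (∫ x, η x * logConv ν t x) - ∫ x, η x * logConv ν (t / 2 ^ (k + 1)) x =
          ((∫ x, η x * logConv ν t x) - ∫ x, η x * logConv ν (t / 2 ^ k) x) +
          ((∫ x, η x * logConv ν (t / 2 ^ k) x) -
            ∫ x, η x * logConv ν ((2 ^ (k + 1))⁻¹ * t) x) := by rw [e2]; ring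
      rw [e3]
      refine (ENNReal.ofReal_add_le.trans (add_le_add ih h2)).trans_eq ?_
      have h4 : 0 ≤ t - t / 2 ^ k := sub_nonneg.2 (div_le_self ht0.le (one_le_pow₀ one_le_two))
      have e4 : C * (Λ * m * V) * (t - t / 2 ^ (k + 1)) = C * (Λ * m * V) * (t - t / 2 ^ k) +
          C * (Λ * m * V) * ((2 ^ (k + 1))⁻¹ * t) := by
        rw [← mul_add, e2, ← e1]; ring
      rw [e4, ENNReal.ofReal_add (by positivity) (by positivity), Finset.sum_range_succ]
      ring
  have h5 := (key k).trans (add_le_add_right (mul_le_mul_right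
    ((ENNReal.sum_le_tsum _).trans ((congrFun hF t).symm.le.trans hFt2)) _) _)
  have h4 : 0 ≤ t - t / 2 ^ k := sub_nonneg.2 (div_le_self ht0.le (one_le_pow₀ one_le_two))
  rw [← ENNReal.ofReal_mul hC0, ← ENNReal.ofReal_add (by positivity) (by positivity),
    ENNReal.ofReal_le_ofReal_iff (by positivity)] at h5
  refine h5.trans ?_
  have h6 : t - t / 2 ^ k ≤ r := by
    have : 0 < t / 2 ^ k := by positivity
    linarith [ht.2]
  have h7 : C * (Λ * m * V) * (t - t / 2 ^ k) ≤ C * (Λ * m * V) * r := by gcongr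
  have h8 : 0 ≤ C * N * V := by positivity
  have h9 : 0 ≤ C * 2 * I.toReal * (Λ * m * r) * V := by positivity
  calc _ ≤ C * (Λ * m * V) * r + C * (2 * I.toReal * N * V) := by gcongr
    _ ≤ C * (Λ * m * V) * r + C * (2 * I.toReal * N * V) + (C * N * V +
        C * 2 * I.toReal * (Λ * m * r) * V) := le_add_of_nonneg_right (by positivity)
    _ = _ := by ring

end

section

open Filter Topology

/-! ### Passage to the limit at small scales -/

variable {n : ℕ}

lemma tendsto_smear (φ : 𝓢(Rn n, ℝ)) (hφ : ∫ x, φ x = 1) {g : Rn n → ℝ} (hc : Continuous g) {B : ℝ}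
    (hB : ∀ x, ‖g x‖ ≤ B) {s : ℕ → ℝ} (hs : Tendsto s atTop (𝓝 0)) (x : Rn n) :
    Tendsto (fun k => smear φ (s k) g x) atTop (𝓝 (g x)) := by
  have e : g x = ∫ y, φ y • g x := by rw [integral_smul_const, hφ, one_smul]
  rw [e]
  refine tendsto_integral_of_dominated_convergence (fun y => ‖φ y‖ * B)
    (fun k => (integrable_smear φ (s k) hc hB x).aestronglyMeasurable)
    (φ.integrable.norm.mul_const B) (fun k => ae_of_all _ fun y => ?_) (ae_of_all _ fun y => ?_)
  · rw [norm_smul]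
    exact mul_le_mul_of_nonneg_left (hB _) (norm_nonneg _)
  · refine Tendsto.const_smul ?_ _
    refine (hc.tendsto x).comp ?_
    simpa using tendsto_const_nhds.sub (hs.smul_const y)

lemma exists_norm_le_wt_of_hasCompactSupport {g : Rn n → ℝ} (hc : Continuous g)
    (hs : HasCompactSupport g) (M : ℕ) : ∃ B : ℝ, 0 ≤ B ∧ ∀ x, ‖g x‖ ≤ B * wt M x := by
  obtain ⟨B, hB⟩ := (hs.mul_right (f' := fun x : Rn n => (1 + ‖x‖) ^ M)).exists_bound_of_continuous
    (hc.mul (by fun_prop))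
  refine ⟨B, (norm_nonneg _).trans (hB 0), fun x => ?_⟩
  have h1 : 0 < (1 + ‖x‖) ^ M := by positivity
  have h2 := hB x
  rw [Pi.mul_apply, norm_mul, Real.norm_of_nonneg h1.le] at h2
  rw [wt, ← div_eq_mul_inv, le_div_iff₀ h1]
  exact h2

/-! ### Weak limits and the tangent-line bound for the logarithm. -/

section Measure

variable {ν : Measure (Rn n)} {K : ℝ≥0} [IsLocallyFiniteMeasure ν]

/-- By duality the smoothing acts on the test function, which it approximates pointwise. Dominated
convergence needs decay beyond order `D` because `ν` may have infinite mass. -/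
lemma IsDoublingWith.tendsto_integral_mul_conv (h : IsDoublingWith ν K) (φ : 𝓢(Rn n, ℝ))
    (hφ : ∫ x, φ x = 1) {q : Rn n → ℝ} (hc : Continuous q) (hq : HasCompactSupport q) {s : ℕ → ℝ}
    (hs0 : ∀ k, 0 < s k) (hs : Tendsto s atTop (𝓝 0)) :
    Tendsto (fun k => ∫ y, q y * conv ν φ (s k) y) atTop (𝓝 (∫ y, q y ∂ν)) := by
  obtain ⟨D, hD⟩ := exists_le_two_pow K
  obtain ⟨B, hB0, hB⟩ := exists_norm_le_wt_of_hasCompactSupport hc hq (D + (n + 1))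
  have hB' : ∀ x, ‖q (-x)‖ ≤ B * wt (D + (n + 1)) x := fun x => by simpa [wt_neg] using hB (-x)
  have hc' : Continuous fun x => q (-x) := hc.comp continuous_neg
  have hs1 : ∀ᶠ k in atTop, s k ≤ 1 := hs.eventually_le_const one_pos
  have e : ∀ᶠ k in atTop, ∫ z, smear φ (s k) (fun x => q (-x)) (-z) ∂ν =
      ∫ y, q y * conv ν φ (s k) y := by
    filter_upwards [hs1] with k hk
    rw [h.integral_smear_eq hD φ (hs0 k) hk hc' hB']
    congr 1; ext y
    rw [neg_neg, smul_eq_mul, mul_comm]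
  refine Tendsto.congr' e ?_
  refine tendsto_integral_filter_of_dominated_convergence
    (fun z => B * moment φ (D + (n + 1)) * wt (D + (n + 1)) z) ?_ ?_ ?_ (ae_of_all _ fun z => ?_)
  · filter_upwards with k
    refine Continuous.aestronglyMeasurable ?_
    have h1 : Continuous (smear φ (s k) fun x => q (-x)) := by
      refine continuous_of_dominated (fun x => (integrable_smear φ (s k) hc'
        (bounded_of_le_wt hB0 hB') x).aestronglyMeasurable) (bound := fun y => ‖φ y‖ * B)
        (fun x => ae_of_all _ fun y => ?_) (φ.integrable.norm.mul_const B) (ae_of_all _ fun y => ?_)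
      · rw [norm_smul]
        exact mul_le_mul_of_nonneg_left (bounded_of_le_wt hB0 hB' _) (norm_nonneg _)
      · have h2 : Continuous fun x => φ y • q (-(x - s k • y)) :=
          (hc.comp (by fun_prop)).const_smul (φ y)
        exact h2
    exact h1.comp continuous_neg
  · filter_upwards [hs1] with k hk
    refine ae_of_all _ fun z => ?_
    have := norm_smear_le φ (hs0 k).le hk hB0 hB' (-z)
    rwa [wt_neg] at this
  · exact (h.integrable_wt hD (by omega)).const_mul _
  · have := tendsto_smear φ hφ hc' (bounded_of_le_wt hB0 hB') hs (-z)
    rwa [neg_neg] at this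

/-- Weak convergence does not pass through the logarithm, but concavity gives `log u ≤ log v - 1 + u
/ v` for every fixed continuous `v > 0`, and the right side is affine in `u`. -/
lemma IsDoublingWith.le_integral_log_add (h : IsDoublingWith ν K) {η : Rn n → ℝ} {x₀ : Rn n}
    {S m : ℝ} (hη : IsCutoff η x₀ S m) {s : ℕ → ℝ} (hs0 : ∀ k, 0 < s k)
    (hs : Tendsto s atTop (𝓝 0)) {c : ℝ} (hle : ∀ k, c ≤ ∫ x, η x * logConv ν (s k) x)
    {v : Rn n → ℝ} (hv : Continuous v) (hv0 : ∀ x, 0 < v x) :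
    c ≤ (∫ x, η x * (Real.log (v x) - 1)) + ∫ x, η x * (v x)⁻¹ ∂ν := by
  have hg := isGood_gaussianS n
  have hvi : Continuous fun x => (v x)⁻¹ := hv.inv₀ fun x => (hv0 x).ne'
  have hvl : Continuous fun x => Real.log (v x) - 1 := (hv.log fun x => (hv0 x).ne').sub continuous_const
  have hq : HasCompactSupport fun x => η x * (v x)⁻¹ := hη.hasCompactSupport.mul_right
  have h1 := h.tendsto_integral_mul_conv (gaussianS n) hg.integral_eq_one
    (q := fun x => η x * (v x)⁻¹) (hη.continuous.mul hvi) hq hs0 hs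
  refine ge_of_tendsto' (h1.const_add _) fun k => (hle k).trans ?_
  have i1 : Integrable fun x => η x * (Real.log (v x) - 1) := hη.integrable_mul hvl
  have i2 : Integrable fun x => η x * (v x)⁻¹ * conv ν (gaussianS n) (s k) x := by
    simp_rw [mul_assoc]
    exact hη.integrable_mul (hvi.mul (h.continuous_conv _ (hs0 k)))
  rw [← integral_add i1 i2]
  refine integral_mono (hη.integrable_mul (h.continuous_logConv (hs0 k))) (i1.add i2) fun x => ?_
  have hu := hg.conv_pos h (hs0 k) x
  have h2 := Real.log_le_sub_one_of_pos (mul_pos (inv_pos.2 (hv0 x)) hu)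
  rw [Real.log_mul (inv_pos.2 (hv0 x)).ne' hu.ne', Real.log_inv] at h2
  have h3 : logConv ν (s k) x ≤ Real.log (v x) - 1 + (v x)⁻¹ * conv ν (gaussianS n) (s k) x := by
    rw [logConv]; linarith
  calc _ ≤ η x * (Real.log (v x) - 1 + (v x)⁻¹ * conv ν (gaussianS n) (s k) x) :=
        mul_le_mul_of_nonneg_left h3 (hη.nonneg x)
    _ = _ := by ring

end Measure

/-! ### Replacing the limit measure by the weight. -/

section Weight

variable {w : Rn n → ℝ}

lemma IsWeight.integral_weightMeasure (hw : IsWeight w) (f : Rn n → ℝ) :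
    ∫ x, f x ∂(weightMeasure w) = ∫ x, f x * w x := by
  have h : AEMeasurable (fun x => (w x).toNNReal) (volume : Measure (Rn n)) :=
    hw.locallyIntegrable.aestronglyMeasurable.aemeasurable.real_toNNReal
  have := integral_withDensity_eq_integral_smul₀ h f
  refine Eq.trans this ?_
  congr 1; ext x
  rw [NNReal.smul_def, Real.coe_toNNReal _ (hw.nonneg x), smul_eq_mul, mul_comm]

lemma IsWeight.integrableOn_ball (hw : IsWeight w) (x : Rn n) (r : ℝ) :
    IntegrableOn w (Metric.ball x r) :=
  (hw.locallyIntegrable.integrableOn_isCompact (isCompact_closedBall x r)).mono_set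
    Metric.ball_subset_closedBall

lemma IsWeight.integrable_cutoff_mul (hw : IsWeight w) {η : Rn n → ℝ} {x₀ : Rn n} {S m : ℝ}
    (hη : IsCutoff η x₀ S m) {f : Rn n → ℝ} (hf : AEStronglyMeasurable f) {A : ℝ}
    (h : ∀ x, |f x| ≤ A * (w x + 1)) : Integrable fun x => η x * f x := by
  have h1 : IntegrableOn (fun x => A * (w x + 1)) (Metric.ball x₀ S) :=
    ((hw.integrableOn_ball x₀ S).add (integrableOn_const measure_ball_lt_top.ne)).const_mul A
  refine ((integrable_indicator_iff measurableSet_ball).2 h1).mono'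
    (hη.continuous.aestronglyMeasurable.mul hf) (ae_of_all _ fun x => ?_)
  by_cases hx : x ∈ Metric.ball x₀ S
  · rw [indicator_of_mem hx, norm_mul, Real.norm_of_nonneg (hη.nonneg x)]
    exact (mul_le_of_le_one_left (norm_nonneg _) (hη.le_one x)).trans (h x)
  · rw [indicator_of_notMem hx, hη.eq_zero x hx, zero_mul, norm_zero]

lemma abs_log_add_le {a ε : ℝ} (ha : 0 ≤ a) (hε : 0 < ε) :
    |Real.log (a + ε)| ≤ (1 + ε + |Real.log ε|) * (a + 1) := by
  have h1 := Real.log_le_sub_one_of_pos (by linarith : 0 < a + ε)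
  have h2 := Real.log_le_log hε (by linarith : ε ≤ a + ε)
  have h3 := neg_abs_le (Real.log ε)
  have h4 := abs_nonneg (Real.log ε)
  rw [abs_le]
  constructor <;> nlinarith [mul_nonneg h4 ha, mul_nonneg hε.le ha]

/-- The tangent at `b + ε` is nearly optimal when `b` is close to `a`. The shift by `ε` keeps the
loss Lipschitz in `a - b`. -/
lemma log_sub_one_add_le {a b ε : ℝ} (ha : 0 ≤ a) (hb : 0 ≤ b) (hε : 0 < ε) :
    Real.log (b + ε) - 1 + (b + ε)⁻¹ * a ≤ Real.log (a + ε) + 2 / ε * |a - b| := by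
  have hbε : 0 < b + ε := by linarith
  have haε : 0 < a + ε := by linarith
  have h1 := Real.log_le_sub_one_of_pos (div_pos hbε haε)
  rw [Real.log_div hbε.ne' haε.ne'] at h1
  have h2 : (b + ε) / (a + ε) - 1 ≤ |a - b| / ε := by
    rw [div_sub_one haε.ne', div_le_div_iff₀ haε hε]
    have := neg_abs_le (a - b)
    nlinarith [abs_nonneg (a - b), mul_nonneg (abs_nonneg (a - b)) ha]
  have h3 : (b + ε)⁻¹ * a - 1 ≤ |a - b| / ε := by
    have e : (b + ε)⁻¹ * a - 1 = (a - (b + ε)) / (b + ε) := by field_simp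
    rw [e, div_le_div_iff₀ hbε hε]
    have := le_abs_self (a - b)
    nlinarith [abs_nonneg (a - b), mul_nonneg (abs_nonneg (a - b)) hb]
  have e : 2 / ε * |a - b| = |a - b| / ε + |a - b| / ε := by ring
  rw [e]; linarith

/-- The best tangent would be taken at `w + ε`, which need not be continuous. It is replaced by `max
g 0 + ε` with `g` continuous and close to `w` in `L¹` of the ball; the error is at most `2/ε` times
that distance. -/
lemma IsWeight.le_integral_log_add (hw : IsWeight w) [IsLocallyFiniteMeasure (weightMeasure w)]
    {K : ℝ≥0} (h : IsDoublingWith (weightMeasure w) K) {η : Rn n → ℝ} {x₀ : Rn n} {S m : ℝ}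
    (hη : IsCutoff η x₀ S m) {s : ℕ → ℝ} (hs0 : ∀ k, 0 < s k) (hs : Tendsto s atTop (𝓝 0)) {c : ℝ}
    (hle : ∀ k, c ≤ ∫ x, η x * logConv (weightMeasure w) (s k) x) {ε : ℝ} (hε : 0 < ε) :
    c ≤ ∫ x, η x * Real.log (w x + ε) := by
  have hwm := hw.locallyIntegrable.aestronglyMeasurable
  have iL : Integrable fun x => η x * Real.log (w x + ε) :=
    hw.integrable_cutoff_mul hη (hwm.aemeasurable.add_const ε).log.aestronglyMeasurable
      fun x => abs_log_add_le (hw.nonneg x) hε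
  refine le_of_forall_pos_le_add fun δ hδ => ?_
  set B := Metric.ball x₀ S
  have iB : Integrable (B.indicator w) :=
    (integrable_indicator_iff measurableSet_ball).2 (hw.integrableOn_ball x₀ S)
  obtain ⟨g, -, hg, hgc, hgi⟩ := iB.exists_hasCompactSupport_integral_sub_le
    (show 0 < δ * (ε / 2) by positivity)
  have ig : Integrable fun x => ‖B.indicator w x - g x‖ := (iB.sub hgi).norm
  have hv : Continuous fun x => max (g x) 0 + ε := by fun_prop
  have hv0 : ∀ x, 0 < max (g x) 0 + ε := fun x => by positivity
  have h1 := h.le_integral_log_add hη hs0 hs hle hv hv0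
  rw [hw.integral_weightMeasure] at h1
  have hvi : Continuous fun x => (max (g x) 0 + ε)⁻¹ := hv.inv₀ fun x => (hv0 x).ne'
  have hvl : Continuous fun x => Real.log (max (g x) 0 + ε) - 1 :=
    (hv.log fun x => (hv0 x).ne').sub continuous_const
  have i1 : Integrable fun x => η x * (Real.log (max (g x) 0 + ε) - 1) := hη.integrable_mul hvl
  have i2 : Integrable fun x => η x * (max (g x) 0 + ε)⁻¹ * w x := by
    simp_rw [mul_assoc]
    refine hw.integrable_cutoff_mul hη (hvi.aestronglyMeasurable.mul hwm) (A := ε⁻¹) fun x => ?_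
    have h2 : (max (g x) 0 + ε)⁻¹ ≤ ε⁻¹ := inv_anti₀ hε (by linarith [le_max_right (g x) 0])
    have h3 := hw.nonneg x
    have h4 := inv_nonneg.2 (hv0 x).le
    rw [abs_of_nonneg (mul_nonneg h4 h3)]
    nlinarith [inv_pos.2 hε]
  rw [← integral_add i1 i2] at h1
  have i3 : Integrable fun x => η x * Real.log (w x + ε) + 2 / ε * ‖B.indicator w x - g x‖ :=
    iL.add (ig.const_mul _)
  refine h1.trans ((integral_mono (i1.add i2) i3 fun x => ?_).trans ?_)
  · simp only [Pi.add_apply]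
    by_cases hx : x ∈ B
    · have h5 := log_sub_one_add_le (hw.nonneg x) (le_max_right (g x) 0) hε
      have h6 : |w x - max (g x) 0| ≤ |w x - g x| := by
        have := abs_max_sub_max_le_abs (w x) (g x) 0
        rwa [max_eq_left (hw.nonneg x)] at this
      rw [indicator_of_mem hx, Real.norm_eq_abs]
      have h7 : 2 / ε * |w x - max (g x) 0| ≤ 2 / ε * |w x - g x| := by gcongr
      have h8 : 0 ≤ 2 / ε * |w x - g x| := by positivity
      nlinarith [mul_le_mul_of_nonneg_left h5 (hη.nonneg x),
        mul_le_mul_of_nonneg_left h7 (hη.nonneg x), mul_le_mul_of_nonneg_right (hη.le_one x) h8]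
    · rw [hη.eq_zero x hx]
      have : 0 ≤ 2 / ε * ‖B.indicator w x - g x‖ := by positivity
      simpa using this
  · rw [integral_add iL (ig.const_mul _), integral_const_mul]
    gcongr
    calc _ ≤ 2 / ε * (δ * (ε / 2)) := by gcongr
      _ = δ := by field_simp

/-- Monotone passage to the limit in the regularized logarithm. -/
lemma IsWeight.le_integral_log_of_le (hw : IsWeight w) {η : Rn n → ℝ} {x₀ : Rn n} {S m : ℝ}
    (hη : IsCutoff η x₀ S m) {c : ℝ} (h : ∀ ε, 0 < ε → c ≤ ∫ x, η x * Real.log (w x + ε)) :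
    (∀ᵐ x, η x ≠ 0 → 0 < w x) ∧ Integrable (fun x => η x * Real.log (w x)) ∧
      c ≤ ∫ x, η x * Real.log (w x) := by
  have hwm := hw.locallyIntegrable.aestronglyMeasurable
  have hη0 := hη.nonneg
  have iL : ∀ ε, 0 < ε → Integrable fun x => η x * Real.log (w x + ε) := fun ε hε =>
    hw.integrable_cutoff_mul hη (hwm.aemeasurable.add_const ε).log.aestronglyMeasurable
      fun x => abs_log_add_le (hw.nonneg x) hε
  have iW : Integrable fun x => η x * (w x + 1) :=
    hw.integrable_cutoff_mul hη (hwm.add aestronglyMeasurable_const) (A := 1) fun x => by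
      rw [one_mul, abs_of_nonneg (by linarith [hw.nonneg x])]
  set M := (∫ x, η x * (w x + 1)) - c
  obtain ⟨ε, hε⟩ : ∃ ε : ℕ → ℝ, ε = fun k : ℕ => 1 / ((k : ℝ) + 1) := ⟨_, rfl⟩
  have hε0 : ∀ k, 0 < ε k := fun k => by rw [hε]; positivity
  have hε1 : ∀ k, ε k ≤ 1 := fun k => by
    rw [hε]; simp only; rw [div_le_one (by positivity)]; linarith [(Nat.cast_nonneg k : (0 : ℝ) ≤ k)]
  have hεt : Tendsto ε atTop (𝓝 0) := by rw [hε]; exact tendsto_one_div_add_atTop_nhds_zero_nat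
  have hεa : Antitone ε := by
    rw [hε]; exact fun i j hij => one_div_le_one_div_of_le (by positivity) (by gcongr)
  obtain ⟨d, hd⟩ : ∃ d : ℕ → Rn n → ℝ, d = fun k x =>
    η x * (w x + 1) - η x * Real.log (w x + ε k) := ⟨_, rfl⟩
  have hd0 : ∀ k x, 0 ≤ d k x := fun k x => by
    rw [hd]; simp only
    rw [← mul_sub]
    refine mul_nonneg (hη0 x) ?_
    have := Real.log_le_sub_one_of_pos (by linarith [hw.nonneg x, hε0 k] : 0 < w x + ε k)
    linarith [hε1 k]
  have id : ∀ k, Integrable (d k) := fun k => by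
    rw [hd]; exact iW.sub (iL _ (hε0 k))
  have hdM : ∀ k, ∫⁻ x, ENNReal.ofReal (d k x) ≤ ENNReal.ofReal M := fun k => by
    rw [← ofReal_integral_eq_lintegral_ofReal (id k) (ae_of_all _ (hd0 k))]
    refine ENNReal.ofReal_le_ofReal ?_
    rw [hd]
    simp only
    rw [integral_sub iW (iL _ (hε0 k))]
    linarith [h (ε k) (hε0 k)]
  -- `Real.log 0 = 0`, so the true limit at zeros of `w` has to be prescribed as `⊤`. Finiteness of
  -- the integral of `F` then shows that these zeros form a null set where `η ≠ 0`.
  obtain ⟨F, hF⟩ : ∃ F : Rn n → ℝ≥0∞, F = fun x => if η x = 0 ∨ 0 < w x then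
    ENNReal.ofReal (η x * (w x + 1) - η x * Real.log (w x)) else ⊤ := ⟨_, rfl⟩
  have hFt : ∀ x, Tendsto (fun k => ENNReal.ofReal (d k x)) atTop (𝓝 (F x)) := by
    intro x
    rw [hF, hd]
    simp only
    by_cases hx : η x = 0
    · simp [hx]
    · by_cases hx' : 0 < w x
      · rw [if_pos (Or.inr hx')]
        refine (ENNReal.continuous_ofReal.tendsto _).comp (tendsto_const_nhds.sub
          (Tendsto.const_mul _ ((Real.continuousAt_log hx'.ne').tendsto.comp ?_)))
        simpa using hεt.const_add (w x)
      · rw [if_neg (by tauto)]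
        have hx0 : w x = 0 := le_antisymm (not_lt.1 hx') (hw.nonneg x)
        have hηx : 0 < η x := lt_of_le_of_ne (hη0 x) (Ne.symm hx)
        simp only [hx0, zero_add]
        have h1 : Tendsto (fun k => Real.log (ε k)) atTop atBot :=
          Real.tendsto_log_nhdsGT_zero.comp
            (tendsto_nhdsWithin_iff.2 ⟨hεt, Eventually.of_forall hε0⟩)
        refine ENNReal.tendsto_ofReal_atTop.comp ?_
        simp_rw [sub_eq_add_neg, ← mul_neg]
        exact tendsto_atTop_add_const_left _ _
          ((tendsto_neg_atBot_atTop.comp h1).const_mul_atTop hηx)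
  have hmono : ∀ x, Monotone fun k => ENNReal.ofReal (d k x) := fun x i j hij => by
    refine ENNReal.ofReal_le_ofReal ?_
    rw [hd]; simp only
    have h1 := hw.nonneg x
    have h2 := Real.log_le_log (by linarith [hε0 j] : 0 < w x + ε j)
      (by linarith [hεa hij] : w x + ε j ≤ w x + ε i)
    linarith [mul_le_mul_of_nonneg_left h2 (hη0 x)]
  have hlim := lintegral_tendsto_of_tendsto_of_monotone
    (fun k => (id k).aestronglyMeasurable.aemeasurable.ennreal_ofReal) (ae_of_all volume hmono)
    (ae_of_all _ hFt)
  have hFM : ∫⁻ x, F x ≤ ENNReal.ofReal M := le_of_tendsto' hlim hdM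
  have hFm : AEMeasurable F := aemeasurable_of_tendsto_metrizable_ae'
    (fun k => (id k).aestronglyMeasurable.aemeasurable.ennreal_ofReal) (ae_of_all _ hFt)
  have hFtop := ae_lt_top' hFm (hFM.trans_lt ENNReal.ofReal_lt_top).ne
  have hpos : ∀ᵐ x, η x ≠ 0 → 0 < w x := by
    filter_upwards [hFtop] with x hx hηx
    by_contra hcon
    rw [hF] at hx
    simp only at hx
    rw [if_neg (by tauto)] at hx
    exact lt_irrefl _ hx
  have hq0 : ∀ x, 0 ≤ η x * (w x + 1) - η x * Real.log (w x) := fun x => by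
    rw [← mul_sub]
    refine mul_nonneg (hη0 x) ?_
    rcases (hw.nonneg x).eq_or_lt with h0 | h0
    · rw [← h0]; simp
    · linarith [Real.log_le_sub_one_of_pos h0]
  have hqm : AEStronglyMeasurable fun x => η x * (w x + 1) - η x * Real.log (w x) :=
    iW.aestronglyMeasurable.sub
      (hη.continuous.aestronglyMeasurable.mul hwm.aemeasurable.log.aestronglyMeasurable)
  have hqM : ∫⁻ x, ENNReal.ofReal (η x * (w x + 1) - η x * Real.log (w x)) ≤ ENNReal.ofReal M := by
    refine (lintegral_mono_ae ?_).trans hFM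
    filter_upwards [hpos] with x hx
    rw [hF]; simp only
    rw [if_pos (by tauto)]
  have iq : Integrable fun x => η x * (w x + 1) - η x * Real.log (w x) :=
    ⟨hqm, (hasFiniteIntegral_iff_ofReal (ae_of_all _ hq0)).2 (hqM.trans_lt ENNReal.ofReal_lt_top)⟩
  have il : Integrable fun x => η x * Real.log (w x) := by
    refine (iW.sub iq).congr (ae_of_all _ fun x => ?_)
    simp only [Pi.sub_apply]; ring
  have hM0 : 0 ≤ M := by
    have h1 := integral_nonneg (μ := volume) (f := d 0) fun x => hd0 0 x
    rw [hd] at h1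
    simp only at h1
    rw [integral_sub iW (iL _ (hε0 0))] at h1
    linarith [h (ε 0) (hε0 0)]
  refine ⟨hpos, il, ?_⟩
  rw [← ofReal_integral_eq_lintegral_ofReal iq (ae_of_all _ hq0),
    ENNReal.ofReal_le_ofReal_iff hM0, integral_sub iW il] at hqM
  linarith

end Weight

end

section

open Filter Topology

/-! ### The reverse Jensen inequality on a ball -/

variable {n : ℕ}

/-- The Gaussian mass of `Δ(0,ρ)`. -/
def gaussianMass (n : ℕ) (ρ : ℝ) : ℝ := ∫ z in Metric.ball (0 : Rn n) ρ, gaussianS n z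

lemma gaussianMass_mono {ρ ρ' : ℝ} (h : ρ ≤ ρ') : gaussianMass n ρ ≤ gaussianMass n ρ' :=
  setIntegral_mono_set (gaussianS n).integrable.integrableOn
    (ae_of_all _ (isGood_gaussianS n).nonneg) (Metric.ball_subset_ball h).eventuallyLE

lemma tendsto_gaussianMass (n : ℕ) :
    Tendsto (fun k : ℕ => gaussianMass n k) atTop (𝓝 1) := by
  have h := tendsto_setIntegral_of_monotone (μ := (volume : Measure (Rn n))) (f := gaussianS n)
    (s := fun k : ℕ => Metric.ball (0 : Rn n) k) (fun k => measurableSet_ball)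
    (fun i j hij => Metric.ball_subset_ball (by exact_mod_cast hij))
    (gaussianS n).integrable.integrableOn
  rwa [Metric.iUnion_ball_nat, setIntegral_univ, (isGood_gaussianS n).integral_eq_one] at h

/-- Each point of `S` keeps at least the Gaussian mass of `Δ(0, σ/t)` inside `S'` after smoothing,
so the integral of `ν ∗ gaussian_t` over `S'` is at least that fraction of `ν S`. -/
lemma gaussianMass_mul_measure_le {ν : Measure (Rn n)} {K : ℝ≥0} [IsLocallyFiniteMeasure ν]
    (h : IsDoublingWith ν K) {t σ A : ℝ} (ht : 0 < t) {S S' : Set (Rn n)} (hS : MeasurableSet S)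
    (hS' : MeasurableSet S') (hSS : ∀ z ∈ S, Metric.ball z σ ⊆ S')
    (hA : ∀ x ∈ S', conv ν (gaussianS n) t x ≤ A) :
    ENNReal.ofReal (gaussianMass n (σ / t)) * ν S ≤ ENNReal.ofReal A * volume S' := by
  have hg := isGood_gaussianS n
  obtain ⟨H, hH⟩ : ∃ H : Rn n → Rn n → ℝ≥0∞, H = fun x z =>
    ENNReal.ofReal ((t ^ n)⁻¹ * gaussianS n (t⁻¹ • (x - z))) := ⟨_, rfl⟩
  have hHm : Measurable (Function.uncurry H) := by
    rw [hH]
    have : Continuous fun p : Rn n × Rn n => gaussianS n (t⁻¹ • (p.1 - p.2)) :=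
      (gaussianS n).continuous.comp (by fun_prop)
    exact (this.measurable.const_mul _).ennreal_ofReal
  have hin : ∀ z, ∫⁻ x in Metric.ball z σ, H x z = ENNReal.ofReal (gaussianMass n (σ / t)) := by
    intro z
    have h1 := setLIntegral_ball_affine (fun x => H x z) ht z 0 (σ / t)
    rw [smul_zero, add_zero, mul_div_cancel₀ _ ht.ne'] at h1
    rw [← h1, gaussianMass, ofReal_integral_eq_lintegral_ofReal
      (gaussianS n).integrable.integrableOn (ae_of_all _ hg.nonneg),
      ← lintegral_const_mul' _ _ ENNReal.ofReal_ne_top]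
    congr 1; ext y
    rw [hH]
    simp only
    rw [add_sub_cancel_left, inv_smul_smul₀ ht.ne', ← ENNReal.ofReal_mul (by positivity), ← mul_assoc,
      mul_inv_cancel₀ (by positivity), one_mul]
  calc _ = ∫⁻ z in S, (∫⁻ x in Metric.ball z σ, H x z) ∂ν := by
        simp_rw [hin, setLIntegral_const]
    _ ≤ ∫⁻ z in S, (∫⁻ x in S', H x z) ∂ν :=
        setLIntegral_mono' hS fun z hz => lintegral_mono_set (hSS z hz)
    _ = ∫⁻ x in S', ∫⁻ z in S, H x z ∂ν :=
        lintegral_lintegral_swap (f := fun z x => H x z) (hHm.comp measurable_swap).aemeasurable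
    _ ≤ ∫⁻ x in S', ENNReal.ofReal A := by
        refine setLIntegral_mono' hS' fun x hx => (setLIntegral_le_lintegral _ _).trans ?_
        rw [hH]
        simp only
        rw [← h.ofReal_conv hg.nonneg ht]
        exact ENNReal.ofReal_le_ofReal (hA x hx)
    _ = _ := by rw [setLIntegral_const]

lemma gaussianMass_mul_real_le {ν : Measure (Rn n)} {K : ℝ≥0} [IsLocallyFiniteMeasure ν]
    (h : IsDoublingWith ν K) {t σ A p : ℝ} (ht : 0 < t) {S S' : Set (Rn n)} (hS : MeasurableSet S)
    (hS' : MeasurableSet S') (hSS : ∀ z ∈ S, Metric.ball z σ ⊆ S') (hA0 : 0 ≤ A)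
    (hA : ∀ x ∈ S', conv ν (gaussianS n) t x ≤ A) (hp0 : 0 ≤ p) (hp : p ≤ gaussianMass n (σ / t))
    (hfin : volume S' ≠ ⊤) :
    p * ν.real S ≤ A * volume.real S' := by
  have h1 := (mul_le_mul_left (ENNReal.ofReal_le_ofReal hp) _).trans
    (gaussianMass_mul_measure_le h ht hS hS' hSS hA)
  have h2 := ENNReal.toReal_mono (ENNReal.mul_ne_top ENNReal.ofReal_ne_top hfin) h1
  rwa [ENNReal.toReal_mul, ENNReal.toReal_mul, ENNReal.toReal_ofReal hp0,
    ENNReal.toReal_ofReal hA0] at h2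

/-- The piecewise linear cutoff equal to one on `Δ(x₀,R)` and supported in `Δ(x₀,(1+τ)R)`. -/
def ramp (x₀ : Rn n) (R τ : ℝ) (x : Rn n) : ℝ :=
  max 0 (min 1 (((1 + τ) * R - ‖x - x₀‖) / (τ * R)))

lemma isCutoff_ramp (x₀ : Rn n) {R τ : ℝ} (hR : 0 < R) (hτ : 0 < τ) {S : ℝ} (hS : (1 + τ) * R ≤ S) :
    IsCutoff (ramp x₀ R τ) x₀ S (1 / (τ * R)) where
  nonneg x := le_max_left _ _
  le_one x := max_le zero_le_one (min_le_left _ _)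
  eq_zero x hx := by
    rw [Metric.mem_ball, dist_eq_norm, not_lt] at hx
    refine max_eq_left ((min_le_right _ _).trans ?_)
    exact div_nonpos_of_nonpos_of_nonneg (by linarith) (by positivity)
  lipschitz x y := by
    have h1 : |ramp x₀ R τ x - ramp x₀ R τ y| ≤
        |((1 + τ) * R - ‖x - x₀‖) / (τ * R) - ((1 + τ) * R - ‖y - x₀‖) / (τ * R)| := by
      unfold ramp
      refine (abs_max_sub_max_le_max _ _ _ _).trans ?_
      rw [sub_self, abs_zero, max_eq_right (abs_nonneg _)]
      refine (abs_min_sub_min_le_max _ _ _ _).trans ?_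
      rw [sub_self, abs_zero, max_eq_right (abs_nonneg _)]
    refine h1.trans ?_
    rw [← sub_div, abs_div, abs_of_pos (by positivity : 0 < τ * R), one_div, inv_mul_eq_div]
    gcongr
    have := abs_norm_sub_norm_le (y - x₀) (x - x₀)
    rw [sub_sub_sub_cancel_right, norm_sub_rev y x] at this
    rwa [sub_sub_sub_cancel_left]

lemma ramp_eq_one (x₀ : Rn n) {R τ : ℝ} (hR : 0 < R) (hτ : 0 < τ) {x : Rn n}
    (hx : x ∈ Metric.ball x₀ R) : ramp x₀ R τ x = 1 := by
  rw [Metric.mem_ball, dist_eq_norm] at hx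
  have : 1 ≤ ((1 + τ) * R - ‖x - x₀‖) / (τ * R) := by
    rw [le_div_iff₀ (by positivity)]; linarith
  rw [ramp, min_eq_left this, max_eq_right zero_le_one]

lemma real_ball_scale (x : Rn n) {t : ℝ} (ht : 0 < t) (r : ℝ) :
    volume.real (Metric.ball x (t * r)) = t ^ n * volume.real (Metric.ball x r) := by
  rw [measureReal_def, volume_ball_scale x ht, ENNReal.toReal_mul, ENNReal.toReal_ofReal (by positivity),
    measureReal_def]

/-- The cutoff is removed after subtracting `log a`: on the shell between the balls, `log (w/a) ≤
w/a`, so only the mass of `w` on the shell is lost. -/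
lemma integral_ball_log_ge {w η : Rn n → ℝ} (hw : IsWeight w) {x₀ : Rn n} {R T S m a : ℝ}
    (ha : 0 < a) (hη : IsCutoff η x₀ S m) (hηT : ∀ x, x ∉ Metric.ball x₀ T → η x = 0)
    (hη1 : ∀ x ∈ Metric.ball x₀ R, η x = 1) (hpos : ∀ᵐ x, η x ≠ 0 → 0 < w x)
    (hint : Integrable fun x => η x * Real.log (w x)) :
    IntegrableOn (fun x => Real.log (w x)) (Metric.ball x₀ R) ∧
    (∫ x, η x * Real.log (w x)) - Real.log a * (∫ x, η x) +
      Real.log a * volume.real (Metric.ball x₀ R) -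
      a⁻¹ * ∫ x in Metric.ball x₀ T \ Metric.ball x₀ R, w x ≤
      ∫ x in Metric.ball x₀ R, Real.log (w x) := by
  set B := Metric.ball x₀ R
  set D := Metric.ball x₀ T \ B
  have hBm : MeasurableSet B := measurableSet_ball
  have hDm : MeasurableSet D := measurableSet_ball.diff hBm
  have hlog : IntegrableOn (fun x => Real.log (w x)) B :=
    hint.integrableOn.congr_fun (fun x hx => by simp only [hη1 x hx, one_mul]) hBm
  refine ⟨hlog, ?_⟩
  have iD : Integrable (D.indicator fun x => a⁻¹ * w x) := by
    refine (integrable_indicator_iff hDm).2 (Integrable.const_mul ?_ _)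
    exact (hw.integrableOn_ball x₀ T).mono_set sdiff_subset
  have iB : Integrable (B.indicator fun x => Real.log (w x) - Real.log a) :=
    (integrable_indicator_iff hBm).2 (hlog.sub (integrableOn_const measure_ball_lt_top.ne))
  have i1 : Integrable fun x => η x * Real.log (w x) - Real.log a * η x :=
    hint.sub (hη.integrable.const_mul _)
  have h1 : ∫ x, (η x * Real.log (w x) - Real.log a * η x) ≤
      ∫ x, (B.indicator (fun x => Real.log (w x) - Real.log a) x +
        D.indicator (fun x => a⁻¹ * w x) x) := by
    refine integral_mono_ae i1 (iB.add iD) ?_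
    filter_upwards [hpos] with x hx
    have hw0 := hw.nonneg x
    have ha' := inv_pos.2 ha
    by_cases hxB : x ∈ B
    · rw [indicator_of_mem hxB, indicator_of_notMem (fun h => h.2 hxB), hη1 x hxB]
      linarith
    · rw [indicator_of_notMem hxB, zero_add]
      by_cases hxT : x ∈ Metric.ball x₀ T
      · rw [indicator_of_mem (show x ∈ D from ⟨hxT, hxB⟩)]
        have hnn : 0 ≤ a⁻¹ * w x := by positivity
        by_cases h0 : η x = 0
        · rw [h0]; simpa using hnn
        · have hwp := hx h0
          have h2 := Real.log_le_sub_one_of_pos (mul_pos ha' hwp)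
          rw [Real.log_mul ha'.ne' hwp.ne', Real.log_inv] at h2
          have h3 : Real.log (w x) - Real.log a ≤ a⁻¹ * w x := by linarith
          calc _ = η x * (Real.log (w x) - Real.log a) := by ring
            _ ≤ η x * (a⁻¹ * w x) := mul_le_mul_of_nonneg_left h3 (hη.nonneg x)
            _ ≤ _ := mul_le_of_le_one_left hnn (hη.le_one x)
      · rw [indicator_of_notMem (fun h => hxT h.1), hηT x hxT]; simp
  rw [integral_sub hint (hη.integrable.const_mul _), integral_const_mul, integral_add iB iD,
    integral_indicator hBm, integral_indicator hDm, integral_const_mul,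
    integral_sub hlog (integrableOn_const measure_ball_lt_top.ne), setIntegral_const,
    smul_eq_mul] at h1
  linarith

lemma IsWeight.real_weightMeasure {w : Rn n → ℝ} (hw : IsWeight w) {S : Set (Rn n)}
    (hS : MeasurableSet S) : (weightMeasure w).real S = ∫ x in S, w x := by
  rw [measureReal_def, weightMeasure, withDensity_apply _ hS, integral_eq_lintegral_of_nonneg_ae
    (ae_of_all _ hw.nonneg) hw.locallyIntegrable.aestronglyMeasurable.restrict]

lemma IsCutoff.integral_le {η : Rn n → ℝ} {x₀ : Rn n} {S m : ℝ} (hη : IsCutoff η x₀ S m) :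
    ∫ x, η x ≤ volume.real (Metric.ball x₀ S) := by
  have h1 : ∫ x, η x ≤ ∫ x, (Metric.ball x₀ S).indicator (fun _ => (1 : ℝ)) x := by
    refine integral_mono hη.integrable ((integrable_indicator_iff measurableSet_ball).2
      (integrableOn_const measure_ball_lt_top.ne)) fun x => ?_
    by_cases hx : x ∈ Metric.ball x₀ S
    · rw [indicator_of_mem hx]; exact hη.le_one x
    · rw [indicator_of_notMem hx, hη.eq_zero x hx]
  refine h1.trans_eq ?_
  rw [integral_indicator measurableSet_ball, setIntegral_const, smul_eq_mul, mul_one]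

lemma IsCutoff.mul_integral_le {η g : Rn n → ℝ} {x₀ : Rn n} {S m b : ℝ} (hη : IsCutoff η x₀ S m)
    (hg : Continuous g) (hb : ∀ x ∈ Metric.ball x₀ S, b ≤ g x) :
    b * ∫ x, η x ≤ ∫ x, η x * g x := by
  rw [← integral_const_mul]
  refine integral_mono (hη.integrable.const_mul _) (hη.integrable_mul hg) fun x => ?_
  rw [mul_comm]
  by_cases hx : x ∈ Metric.ball x₀ S
  · exact mul_le_mul_of_nonneg_left (hb x hx) (hη.nonneg x)
  · simp [hη.eq_zero x hx]

set_option maxHeartbeats 1000000 in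
/-- Quantitative comparison of the average of `w` and of `log w` on a ball. -/
theorem exists_average_bounds (n : ℕ) : ∃ C : ℝ, 0 ≤ C ∧
    ∀ (w : Rn n → ℝ) (K : ℝ≥0), IsWeight w → IsDoublingWith (weightMeasure w) K →
    ∀ (Λ N : ℝ), 0 ≤ Λ → √3 * Λ ≤ 1 → 0 ≤ N →
    (∀ x r, 0 < r → r * logGrad (weightMeasure w) (gaussianS n) x r ≤ Λ) →
    boxNorm (weightMeasure w) (gaussianS n) ≤ ENNReal.ofReal N →
    ∀ (x₀ : Rn n) (R τ : ℝ) (k : ℕ), 0 < R → 0 < τ → τ < 1 → 1 ≤ k → 0 < gaussianMass n k →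
    ∃ a : ℝ, 0 < a ∧ (∀ᵐ z ∂(volume.restrict (Metric.ball x₀ R)), 0 < w z) ∧
      IntegrableOn (fun z => Real.log (w z)) (Metric.ball x₀ R) ∧
      (weightMeasure w).real (Metric.ball x₀ R) ≤
        a * ((gaussianMass n k)⁻¹ * Real.exp (6 * Λ * k / τ) * (1 + τ) ^ n) *
          volume.real (Metric.ball x₀ R) ∧
      (Real.log a - (2 ^ n * (4 * Λ * k / τ + C * (Λ / k + N)) +
        (gaussianMass n k)⁻¹ * Real.exp (6 * Λ * k / τ) * ((1 + 2 * τ) ^ n - (1 - τ) ^ n))) *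
          volume.real (Metric.ball x₀ R) ≤
        ∫ z in Metric.ball x₀ R, Real.log (w z) := by
  obtain ⟨C, hC0, hC⟩ := exists_integral_logConv_sub_le n
  refine ⟨C, hC0, fun w K hw h Λ N hΛ hΛ1 hN hgrad hbox x₀ R τ k hR hτ hτ1 hk hp => ?_⟩
  have := isLocallyFiniteMeasure_weightMeasure hw
  have hg := isGood_gaussianS n
  have hk0 : (0 : ℝ) < k := by exact_mod_cast hk
  have hk1 : (1 : ℝ) ≤ k := by exact_mod_cast hk
  set ν := weightMeasure w with hν
  set p := gaussianMass n k with hpdef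
  set V := volume.real (Metric.ball x₀ R) with hV
  have hV0 : 0 ≤ V := measureReal_nonneg
  have hT2 : (1 + τ) * R ≤ 2 * R := by nlinarith
  have hη := isCutoff_ramp x₀ hR hτ hT2
  have hη' := isCutoff_ramp x₀ hR hτ le_rfl
  -- The scale `t` lies in `(r/2, r)`. From above, `τ R / t ≥ k`, so a Gaussian at scale `t` keeps
  -- mass `gaussianMass n k` within distance `τ R`. From below, `Λ / t ≤ y / R` bounds the
  -- oscillation of `log u_t`.
  obtain ⟨r, hr⟩ : ∃ r, r = τ / k * R := ⟨_, rfl⟩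
  have hr0 : 0 < r := by rw [hr]; positivity
  have hrR : r ≤ R := by
    rw [hr]
    exact mul_le_of_le_one_left hR.le ((div_le_one hk0).2 (by linarith))
  have hs3 : √3 ≤ 2 := by rw [Real.sqrt_le_left (by norm_num)]; norm_num
  have hrS : √3 * r ≤ 2 * R := by nlinarith [Real.sqrt_nonneg 3]
  obtain ⟨t, ⟨ht1, ht2⟩, hdrop⟩ := hC ν K h Λ N hΛ hΛ1 hN hgrad hbox _ x₀ (2 * R) (1 / (τ * R))
    (by positivity) hη r hr0 hrS
  have ht0 : 0 < t := by linarith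
  have hV2 : volume.real (Metric.ball x₀ (2 * R)) = 2 ^ n * V := real_ball_scale x₀ two_pos R
  have hmr : Λ * (1 / (τ * R)) * r = Λ / k := by rw [hr]; field_simp
  rw [hmr, hV2] at hdrop
  set η := ramp x₀ R τ with hηdef
  set c := (∫ x, η x * logConv ν t x) - C * (Λ / k + N) * (2 ^ n * V) with hc
  obtain ⟨hpos, hint, hle⟩ := hw.le_integral_log_of_le hη (c := c) fun ε hε =>
    hw.le_integral_log_add h hη (s := fun k => t / 2 ^ k) (fun k => by positivity)
      (by simpa [div_eq_mul_inv] using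
        (tendsto_pow_atTop_nhds_zero_of_lt_one (by norm_num : (0 : ℝ) ≤ 2⁻¹)
          (by norm_num)).const_mul t) (fun k => by linarith [hdrop k]) hε
  obtain ⟨a, ha⟩ : ∃ a, a = conv ν (gaussianS n) t x₀ := ⟨_, rfl⟩
  have ha0 : 0 < a := by rw [ha]; exact hg.conv_pos h ht0 x₀
  have hloga : logConv ν t x₀ = Real.log a := by rw [ha, logConv]
  set y := 2 * Λ * k / τ with hy
  have hy0 : 0 ≤ y := by positivity
  have hlip : ∀ x, |logConv ν t x - Real.log a| ≤ y / R * ‖x - x₀‖ := fun x => by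
    rw [← hloga]
    refine h.abs_logConv_sub_le ht0 (fun z => ?_) x x₀
    have h1 : logGrad ν (gaussianS n) z t ≤ Λ / t := by
      rw [le_div_iff₀' ht0]; exact hgrad z t ht0
    refine h1.trans ?_
    have h2 : y / R = Λ / (r / 2) := by rw [hy, hr]; field_simp
    rw [h2]
    gcongr
  have e6 : 6 * Λ * k / τ = y * 3 := by rw [hy]; ring
  have e4 : 4 * Λ * k / τ = y * 2 := by rw [hy]; ring
  rw [e6, e4]
  set A := a * Real.exp (y * 3) with hA
  have hA0 : 0 ≤ A := by positivity
  -- Radius `3R` covers every enlarged set below, since `1 + 2τ < 3`.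
  have hAle : ∀ x ∈ Metric.ball x₀ (3 * R), conv ν (gaussianS n) t x ≤ A := fun x hx => by
    rw [Metric.mem_ball, dist_eq_norm] at hx
    have h1 := (le_abs_self _).trans (hlip x)
    have h2 : y / R * ‖x - x₀‖ ≤ y * 3 := by
      calc _ ≤ y / R * (3 * R) := by gcongr
        _ = y * 3 := by field_simp
    rw [logConv] at h1
    rw [← Real.exp_log (hg.conv_pos h ht0 x), hA]
    calc _ ≤ Real.exp (Real.log a + y * 3) := Real.exp_le_exp.2 (by linarith)
      _ = _ := by rw [Real.exp_add, Real.exp_log ha0]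
  have hpt : p ≤ gaussianMass n (τ * R / t) := by
    refine gaussianMass_mono ?_
    rw [le_div_iff₀ ht0]
    calc (k : ℝ) * t ≤ k * r := by gcongr
      _ = τ * R := by rw [hr]; field_simp
  have hball : p * ν.real (Metric.ball x₀ R) ≤ A * volume.real (Metric.ball x₀ ((1 + τ) * R)) := by
    refine gaussianMass_mul_real_le h ht0 measurableSet_ball measurableSet_ball (fun z hz => ?_) hA0
      (fun x hx => hAle x (Metric.ball_subset_ball (by nlinarith) hx)) hp.le hpt
      measure_ball_lt_top.ne
    rw [Metric.mem_ball] at hz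
    exact Metric.ball_subset_ball' (by linarith)
  -- The `τ R`-neighbourhood of the shell lies between the radii `(1 - τ) R` and `(1 + 2τ) R`, so
  -- its volume is small with `τ`.
  have hshell : p * ν.real (Metric.ball x₀ ((1 + τ) * R) \ Metric.ball x₀ R) ≤
      A * volume.real (Metric.ball x₀ ((1 + 2 * τ) * R) \ Metric.ball x₀ ((1 - τ) * R)) := by
    refine gaussianMass_mul_real_le h ht0 (measurableSet_ball.diff measurableSet_ball)
      (measurableSet_ball.diff measurableSet_ball) (fun z hz x hx => ⟨?_, fun hx2 => hz.2 ?_⟩) hA0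
      (fun x hx => hAle x (Metric.ball_subset_ball (by nlinarith) hx.1)) hp.le hpt
      (measure_ne_top_of_subset sdiff_subset measure_ball_lt_top.ne)
    · have h1 := hz.1
      rw [Metric.mem_ball] at h1 hx ⊢
      linarith [dist_triangle x z x₀]
    · rw [Metric.mem_ball] at hx hx2 ⊢
      rw [dist_comm] at hx
      linarith [dist_triangle z x x₀]
  rw [real_ball_scale x₀ (by linarith), ← hV] at hball
  rw [measureReal_sdiff (s₁ := Metric.ball x₀ ((1 + 2 * τ) * R))
    (Metric.ball_subset_ball (by nlinarith)) measurableSet_ball measure_ball_lt_top.ne,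
    real_ball_scale x₀ (by linarith), real_ball_scale x₀ (by linarith),
    hw.real_weightMeasure (measurableSet_ball.diff measurableSet_ball), ← hV] at hshell
  obtain ⟨hlog, hlow⟩ := integral_ball_log_ge hw ha0 hη
    hη'.eq_zero (fun x hx => ramp_eq_one x₀ hR hτ hx) hpos hint
  refine ⟨a, ha0, ?_, hlog, ?_, ?_⟩
  · rw [ae_restrict_iff' measurableSet_ball]
    filter_upwards [hpos] with x hx hxB
    exact hx (by rw [hηdef, ramp_eq_one x₀ hR hτ hxB]; exact one_ne_zero)
  · rw [← mul_le_mul_iff_right₀ hp]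
    refine hball.trans_eq ?_
    rw [hA]; field_simp
  · set Q := ∫ x in Metric.ball x₀ ((1 + τ) * R) \ Metric.ball x₀ R, w x with hQ
    have hQle : a⁻¹ * Q ≤ p⁻¹ * Real.exp (y * 3) * ((1 + 2 * τ) ^ n - (1 - τ) ^ n) * V := by
      rw [← mul_le_mul_iff_right₀ (mul_pos ha0 hp)]
      calc _ = p * Q := by field_simp
        _ ≤ _ := hshell
        _ = _ := by rw [hA]; field_simp
    have hηV : ∫ x, η x ≤ 2 ^ n * V := hη.integral_le.trans_eq hV2
    have hηlow : (Real.log a - y * 2) * ∫ x, η x ≤ ∫ x, η x * logConv ν t x := by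
      refine hη.mul_integral_le (h.continuous_logConv ht0) fun x hx => ?_
      rw [Metric.mem_ball, dist_eq_norm] at hx
      have h1 := (abs_le.1 (hlip x)).1
      have h2 : y / R * ‖x - x₀‖ ≤ y * 2 := by
        calc _ ≤ y / R * (2 * R) := by gcongr
          _ = y * 2 := by field_simp
      linarith
    have h5 : y * 2 * ∫ x, η x ≤ y * 2 * (2 ^ n * V) := by gcongr
    rw [hc] at hle
    linarith [hlow, hle, hηlow, h5, hQle]

end

section

open Filter Topology

/-! ### Small Carleson norm implies an `A_∞` constant close to one -/

variable {n : ℕ}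

lemma logAverage_eq {w : Rn n → ℝ} {x : Rn n} {r : ℝ}
    (hpos : ∀ᵐ z ∂(volume.restrict (Metric.ball x r)), 0 < w z)
    (hint : IntegrableOn (fun z => Real.log (w z)) (Metric.ball x r)) :
    logAverage w x r = ((⨍ z in Metric.ball x r, Real.log (w z) : ℝ) : EReal) := by
  have h1 : ⨍⁻ z in Metric.ball x r, (ENNReal.log (ENNReal.ofReal (w z))).toENNReal ∂volume =
      ⨍⁻ z in Metric.ball x r, ENNReal.ofReal (Real.log (w z)) ∂volume := by
    refine laverage_congr ?_
    filter_upwards [hpos] with z hz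
    rw [ENNReal.log_ofReal_of_pos hz, EReal.real_coe_toENNReal]
  have h2 : ⨍⁻ z in Metric.ball x r, (-ENNReal.log (ENNReal.ofReal (w z))).toENNReal ∂volume =
      ⨍⁻ z in Metric.ball x r, ENNReal.ofReal (-Real.log (w z)) ∂volume := by
    refine laverage_congr ?_
    filter_upwards [hpos] with z hz
    rw [ENNReal.log_ofReal_of_pos hz, ← EReal.coe_neg, EReal.real_coe_toENNReal]
  have hi : Integrable (fun z => Real.log (w z))
      ((volume.restrict (Metric.ball x r) univ)⁻¹ • volume.restrict (Metric.ball x r)) :=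
    Integrable.to_average hint
  have hn : Integrable (fun z => -Real.log (w z))
      ((volume.restrict (Metric.ball x r) univ)⁻¹ • volume.restrict (Metric.ball x r)) := hi.neg
  rw [logAverage, h1, h2, average, integral_eq_lintegral_pos_part_sub_lintegral_neg_part hi,
    EReal.coe_sub, EReal.coe_ennreal_toReal hi.lintegral_lt_top.ne,
    EReal.coe_ennreal_toReal hn.lintegral_lt_top.ne]
  rfl

lemma aInftyConst_le {w : Rn n → ℝ} {c : ℝ} (hc : 0 ≤ c)
    (h : ∀ (x : Rn n) (r : ℝ), 0 < r →
      (∀ᵐ z ∂(volume.restrict (Metric.ball x r)), 0 < w z) ∧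
      IntegrableOn (fun z => Real.log (w z)) (Metric.ball x r) ∧
      (weightMeasure w).real (Metric.ball x r) ≤
        c * Real.exp (⨍ z in Metric.ball x r, Real.log (w z)) * volume.real (Metric.ball x r))
    (hfin : ∀ (x : Rn n) (r : ℝ), weightMeasure w (Metric.ball x r) ≠ ⊤) :
    aInftyConst w ≤ ENNReal.ofReal c := by
  refine sInf_le ⟨c.toNNReal, rfl, fun x r hr => ?_⟩
  obtain ⟨h1, h2, h3⟩ := h x r hr
  rw [logAverage_eq h1 h2, EReal.exp_coe, setLAverage_eq,
    ENNReal.div_le_iff (Metric.measure_ball_pos _ _ hr).ne' measure_ball_lt_top.ne]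
  have e : ∫⁻ z in Metric.ball x r, ENNReal.ofReal (w z) = weightMeasure w (Metric.ball x r) := by
    rw [weightMeasure, withDensity_apply _ measurableSet_ball]
  have e2 : ((c.toNNReal : ℝ≥0) : ℝ≥0∞) = ENNReal.ofReal c := rfl
  rw [e, e2, ← ENNReal.ofReal_mul hc, ← ofReal_measureReal (hfin x r),
    ← ofReal_measureReal (μ := volume) (measure_ball_lt_top (x := x) (r := r)).ne,
    ← ENNReal.ofReal_mul (by positivity)]
  exact ENNReal.ofReal_le_ofReal h3

/-- The bound on the `A_∞` characteristic as a function of the parameters of the proof. -/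
def jensenBound (n : ℕ) (p τ y e : ℝ) : ℝ :=
  p⁻¹ * Real.exp y * (1 + τ) ^ n *
    Real.exp (e + p⁻¹ * Real.exp y * ((1 + 2 * τ) ^ n - (1 - τ) ^ n))

/-- The order of choice matters, because `k / τ` multiplies the oscillation. First `τ` is taken
small in the limiting case of full Gaussian mass and no oscillation, then `k` large so that the
Gaussian mass is close to one, and last `δ` small in terms of both. -/
lemma exists_jensenBound_lt (n : ℕ) (C C' : ℝ) {ε : ℝ} (hε : 0 < ε) :
    ∃ (τ : ℝ) (k : ℕ) (δ : ℝ), 0 < τ ∧ τ < 1 ∧ 1 ≤ k ∧ 0 < gaussianMass n k ∧ 0 < δ ∧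
      √3 * √(C' * δ) ≤ 1 ∧
      jensenBound n (gaussianMass n k) τ (6 * √(C' * δ) * k / τ)
        (2 ^ n * (4 * √(C' * δ) * k / τ + C * (√(C' * δ) / k + δ))) < 1 + ε := by
  have hτ : ∀ᶠ τ in 𝓝[>] (0 : ℝ), jensenBound n 1 τ 0 0 < 1 + ε := by
    have hc : Continuous fun τ => jensenBound n 1 τ 0 0 := by unfold jensenBound; fun_prop
    have h1 := hc.tendsto 0
    have e : jensenBound n 1 0 0 0 = 1 := by simp [jensenBound]
    rw [e] at h1
    exact (h1.mono_left nhdsWithin_le_nhds).eventually_lt_const (by linarith)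
  have hτ1 : ∀ᶠ τ in 𝓝[>] (0 : ℝ), τ ∈ Ioo (0 : ℝ) 1 := Ioo_mem_nhdsGT one_pos
  obtain ⟨τ, hτ, hτ0, hτ1⟩ := (hτ.and hτ1).exists
  have hk : ∀ᶠ k : ℕ in atTop, jensenBound n (gaussianMass n k) τ 0 0 < 1 + ε := by
    have hc : ContinuousAt (fun p => jensenBound n p τ 0 0) 1 := by
      unfold jensenBound
      have : ContinuousAt (fun p : ℝ => p⁻¹) 1 := continuousAt_inv₀ one_ne_zero
      fun_prop
    exact (hc.tendsto.comp (tendsto_gaussianMass n)).eventually_lt_const hτ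
  obtain ⟨k, ⟨hk, hk1⟩, hkp⟩ := ((hk.and (eventually_ge_atTop 1)).and
    ((tendsto_gaussianMass n).eventually_const_lt one_pos)).exists
  have hd : ∀ᶠ δ in 𝓝[>] (0 : ℝ), jensenBound n (gaussianMass n k) τ (6 * √(C' * δ) * k / τ)
        (2 ^ n * (4 * √(C' * δ) * k / τ + C * (√(C' * δ) / k + δ))) < 1 + ε := by
    have hc : Continuous fun δ => jensenBound n (gaussianMass n k) τ (6 * √(C' * δ) * k / τ)
        (2 ^ n * (4 * √(C' * δ) * k / τ + C * (√(C' * δ) / k + δ))) := by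
      unfold jensenBound; fun_prop
    have h1 := hc.tendsto 0
    simp only [mul_zero, Real.sqrt_zero, zero_mul, zero_div, add_zero] at h1
    exact (h1.mono_left nhdsWithin_le_nhds).eventually_lt_const hk
  have hd1 : ∀ᶠ δ in 𝓝[>] (0 : ℝ), √3 * √(C' * δ) < 1 := by
    have hc : Continuous fun δ => √3 * √(C' * δ) := by fun_prop
    have h1 := hc.tendsto 0
    simp only [mul_zero, Real.sqrt_zero] at h1
    exact (h1.mono_left nhdsWithin_le_nhds).eventually_lt_const one_pos
  obtain ⟨δ, ⟨hd, hd1⟩, hd0⟩ := ((hd.and hd1).and self_mem_nhdsWithin).exists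
  exact ⟨τ, k, δ, hτ0, hτ1, hk1, hkp, hd0, hd1.le, hd⟩

theorem exists_aInftyConst_le (n : ℕ) (K : ℝ≥0) {ε : ℝ} (hε : 0 < ε) : ∃ δ : ℝ, 0 < δ ∧
    ∀ w : Rn n → ℝ, IsWeight w → IsDoublingWith (weightMeasure w) K →
      carlesonNorm (logGradMeasure w (gaussianS n)) ≤ ENNReal.ofReal δ →
        aInftyConst w ≤ ENNReal.ofReal (1 + ε) := by
  have hg := isGood_gaussianS n
  obtain ⟨C, hC0, hC⟩ := exists_average_bounds n
  obtain ⟨C', hC't, hC'⟩ := exists_logGrad_le_boxNorm K hg hg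
  obtain ⟨τ, k, δ, hτ0, hτ1, hk, hp, hδ, hΛ1, hJ⟩ := exists_jensenBound_lt n C C'.toReal hε
  have hC'0 : 0 ≤ C'.toReal := ENNReal.toReal_nonneg
  refine ⟨δ, hδ, fun w hw h hle => ?_⟩
  have := isLocallyFiniteMeasure_weightMeasure hw
  rw [carlesonNorm_logGradMeasure hw h hg] at hle
  change boxNorm _ _ ≤ _ at hle
  -- The pointwise estimate bounds the square of the scaled gradient by `C'` times the Carleson
  -- norm.
  set Λ := √(C'.toReal * δ) with hΛ
  have hgrad : ∀ x r, 0 < r → r * logGrad (weightMeasure w) (gaussianS n) x r ≤ Λ := by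
    intro x r hr
    have h1 := (hC' (weightMeasure w) h x r hr).trans (mul_le_mul_right hle _)
    rw [← ENNReal.ofReal_toReal hC't, ← ENNReal.ofReal_mul hC'0, ← ENNReal.ofReal_pow
      (mul_nonneg hr.le (logGrad_nonneg hg h hr x)), ENNReal.ofReal_le_ofReal_iff (by positivity)] at h1
    exact Real.le_sqrt_of_sq_le h1
  refine aInftyConst_le (by linarith) (fun x r hr => ?_) fun x r => measure_ball_lt_top.ne
  obtain ⟨a, ha, hpos, hint, hup, hlow⟩ := hC w K hw h Λ δ (Real.sqrt_nonneg _) hΛ1 hδ.le hgrad hle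
    x r τ k hr hτ0 hτ1 hk hp
  refine ⟨hpos, hint, hup.trans ?_⟩
  have hV : 0 < volume.real (Metric.ball x r) :=
    ENNReal.toReal_pos (Metric.measure_ball_pos _ _ hr).ne' measure_ball_lt_top.ne
  refine mul_le_mul_of_nonneg_right ?_ hV.le
  rw [setAverage_eq, smul_eq_mul]
  rw [← le_inv_mul_iff₀' hV] at hlow
  refine le_trans ?_ (mul_le_mul hJ.le (Real.exp_le_exp.2 hlow) (Real.exp_pos _).le (by linarith))
  rw [jensenBound, Real.exp_sub, Real.exp_log ha]
  set E := 2 ^ n * (4 * Λ * k / τ + C * (Λ / k + δ)) +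
    (gaussianMass n k)⁻¹ * Real.exp (6 * Λ * k / τ) * ((1 + 2 * τ) ^ n - (1 - τ) ^ n)
  refine le_of_eq ?_
  have := Real.exp_ne_zero E
  field_simp

end

end CarlesonWeights

end

theorem mainTheorem3 (n : ℕ) (hn : 1 ≤ n)
    (φ : Rn n → ℝ) (hφ : IsReferenceBump φ) (K : ℝ≥0) :
    (∀ w : Rn n → ℝ, IsWeight w → IsDoublingWith (weightMeasure w) K →
      (carlesonNorm (logGradMeasure w (gaussian n)) < ⊤ ↔
        carlesonNorm (logGradMeasure w φ) < ⊤)) ∧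
    (∃ C₂ : ℝ, 1 < C₂ ∧
      ∀ w : Rn n → ℝ, IsWeight w → IsDoublingWith (weightMeasure w) K →
        ENNReal.ofReal (1 / C₂) * carlesonNorm (logGradMeasure w (gaussian n)) ≤
            carlesonNorm (logGradMeasure w φ) ∧
          carlesonNorm (logGradMeasure w φ) ≤
            ENNReal.ofReal C₂ * carlesonNorm (logGradMeasure w (gaussian n))) ∧
    (∀ ε₀ : ℝ, 0 < ε₀ → ∃ δ₀ : ℝ, 0 < δ₀ ∧
      ∀ w : Rn n → ℝ, IsWeight w → IsDoublingWith (weightMeasure w) K →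
        carlesonNorm (logGradMeasure w φ) ≤ ENNReal.ofReal δ₀ →
          aInftyConst w ≤ ENNReal.ofReal (1 + ε₀)) := by
  obtain ⟨f, rfl, hf⟩ := exists_schwartz_bump hφ
  have hg := isGood_gaussianS n
  obtain ⟨C₁, hC₁, h₁⟩ := exists_carlesonNorm_le K hf hg
  obtain ⟨C₂, hC₂, h₂⟩ := exists_carlesonNorm_le K hg hf
  rw [coe_gaussianS] at h₁ h₂
  -- The constants for the two directions differ; their maximum serves both inequalities.
  refine ⟨fun w hw hd => ⟨fun h => ?_, fun h => ?_⟩, ⟨max C₁ C₂, lt_max_of_lt_left hC₁,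
    fun w hw hd => ⟨?_, ?_⟩⟩, fun ε hε => ?_⟩
  · exact (h₂ w hw hd).trans_lt (ENNReal.mul_lt_top ENNReal.ofReal_lt_top h)
  · exact (h₁ w hw hd).trans_lt (ENNReal.mul_lt_top ENNReal.ofReal_lt_top h)
  · have h0 : 0 < max C₁ C₂ := by positivity
    refine (mul_le_mul_right (h₁ w hw hd) _).trans ?_
    rw [← mul_assoc, ← ENNReal.ofReal_mul (by positivity)]
    refine mul_le_of_le_one_left bot_le ?_
    rw [ENNReal.ofReal_le_one, one_div, inv_mul_le_one₀ h0]
    exact le_max_left _ _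
  · refine (h₂ w hw hd).trans ?_
    gcongr
    exact le_max_right _ _
  · obtain ⟨δ, hδ, h⟩ := exists_aInftyConst_le n K hε
    have hC0 : 0 < C₁ := by linarith
    -- Passing from the bump to the Gaussian costs `C₁`, after which the Gaussian threshold `δ`
    -- applies.
    refine ⟨δ / C₁, by positivity, fun w hw hd hle => h w hw hd ?_⟩
    refine (h₁ w hw hd).trans ((mul_le_mul_right hle _).trans_eq ?_)
    rw [← ENNReal.ofReal_mul hC0.le, mul_div_cancel₀ _ hC0.ne']
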